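/- **Setting.** Let $G=(V,E,(r_e)_{e\in E})$ be a finite connected graph on $V=\{1,\dots,n\}$, $n\ge 2$, with edge weights $r_e>0$. Let $m\ge2$ be an integer and $s=b/a$ with $a,b$ coprime positive integers; put $\chi(k)=ak+b$ and $N=a(m-1)+bn$. For $k\ge 0$ let $\Omega_k=\{\xi\in\mathbb N_0^V:\sum_v\xi(v)=k\}$, and write $C_{\xi,v}=\xi+\delta_v$. For $e=\{v,w\}\in E$ let $\mathrm P_e(\xi,\xi')$ be the probability that a beta-binomial split on $e$ takes $\xi$ to $\xi'$: it is the probability that a BetaBin$(\xi(v)+\xi(w),s,s)$ variable equals $\xi'(v)$ if $\xi'=\xi$ off $e$ and $\xi'(v)+\xi'(w)=\xi(v)+\xi(w)$, and $0$ otherwise. For $y,z\in e$ let $$\mathrm P_{e,\xi,\xi'}(y,z)=\frac{\xi'(z)+1}{\xi(v)+\xi(w)+1}\cdot\frac{\mathrm P_e(C_{\xi,y},C_{\xi',z})}{\mathrm P_e(\xi,\xi')} .$$ **Graphical construction.** On a probability space take, all independent: a Poisson process of rate $\sum_e r_e$ with points $\tau_1<\tau_2<\cdots$ (rings); edges $e_1,e_2,\dots$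 with $\mathbb P(e_i=e)\propto r_e$; variables $U^b_i,U^c_i$ uniform on $[0,1]$; fair coins $d_1,d_2,\dots\in\{0,1\}$. **MaBB.** The marked beta-binomial splitting process $(\xi_t,m_t)\in\Omega_{m-1}\times V$ started at $(\xi,x)$ changes only at the times $\tau_i$. There $\xi_{\tau_i}$ is obtained from $\xi_{\tau_i-}$ by sampling from $\mathrm P_{e_i}(\xi_{\tau_i-},\cdot)$ by inverse transform with $U_i^b$ (outcomes ordered by how close to even the split on $e_i$ is, ties in favour of fewer particles on the smaller vertex of $e_i$). If $m_{\tau_i-}\in e_i$, the mark stays put if $U^c_i<\mathrm P_{e_i,\xi_{\tau_i-},\xi_{\tau_i}}(m_{\tau_i-},m_{\tau_i-})$ and otherwise moves to the other vertex of $e_i$; if $m_{\tau_i-}\notin e_i$ it stays. Let $\pi^{(m)}(\zeta)\propto\prod_v\Gamma(s+\zeta(v))/\zeta(v)!$ on $\Omega_m$ and, for $\zeta\in\Omega_{m-1}$, $\pi_\zeta(v)\propto\pi^{(m)}(C_{\zeta,v})(\zeta(v)+1)$, $v\in V$ (the conditional law of the mark at equilibrium). Let $\tilde m_t$ have law $\pi_\zeta$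 conditionally on $\xi_t=\zeta$. **Chameleon process** with round length $T>0$ associated with the MaBB started at $(\xi,x)$. Its state gives the numbers $B(v),R(v),P(v)$ of black, red and pink particles at each $v$, the number $W(v)=\chi(B(v))-R(v)-P(v)$ of white ones, and labels on some red and white particles; a red and a white particle with the same label are *paired*. Write $|R|=\sum_vR(v)$ etc. Initially $B=\xi$, $R=\chi(\xi(x))\delta_x$, $P=0$. At time $0$ and after each time $iT$, $i\ge1$, all labels are renewed: $\min(|R|,|W|)$ red and equally many white particles get the labels $1,2,\dots$ in the order of their vertices. *End of a round.* At time $iT$, $i\ge1$, if $|P|\ge\min(|R|,|W|)$, all pink particles turn red if $d_i=1$ and white if $d_i=0$. *Ring.* When $e=\{v,w\}$, $v<w$, rings at time $\tau_i$, the black particles move exactly like the non-marked particles of the MaBB, from $B$ to $B'$. Write $R_e=R(v)+R(w)$, $P_e=P(v)+P(w)$ and $$\ell(v)=(R_e-\chi(B'(w)))\vee0,\quad u(v)=\chi(B'(v))\wedge R_e,\quad \ell(w)=R_e-u(v),\quad u(w)=\chi(B'(w))\wedge R_e,$$ $$\ell^P=(P_e-\chi(B'(w))+u(w))\vee0,\quad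 u^P=(\chi(B'(v))-u(v))\wedge P_e,$$ and let $\theta\in[0,1]$ solve (take $\theta=0$ if every $\theta$ is a solution) $$\theta\big[\ell(v)+\tfrac12\ell^P\big]+(1-\theta)\big[u(v)+\tfrac12u^P\big]=\big(R(v)+\tfrac12P(v)\big)\mathrm P_{e,B,B'}(v,v)+\big(R(w)+\tfrac12P(w)\big)\mathrm P_{e,B,B'}(w,v).$$ Take all non-black particles off $e$ into a pool. With all random choices made from $U_i^c$: 1. Choose $\ell(v)+\ell(w)$ reds from the pool uniformly, but using reds whose partner is also on $e$ ("paired reds" below) only when the others are exhausted; put a uniform $\ell(v)$ of them on $v$ and the other $\ell(w)$ on $w$. 2. With probability $2\min(\theta,1-\theta)$ do 3a, otherwise 3b. 3. (3a) Let $k$ be the number of paired reds left in the pool. Choose uniformly $\min\big(k,\lceil(\min(|R|,|W|)+\frac12|P|)/3\rceil-\frac12|P|\big)$ of them; these become pink and go to $v$, their white partners become pink and go to $w$ (all of these lose their labels). Each red still in the pool goes to $v$ or $w$ with probability $\frac12$ independently. (3b) All reds still in the pool go to $v$ if $\theta<\frac12$ and to $w$ if $\theta\ge\frac12$. 4. Place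 $p$ of the $P_e$ old pink particles on $v$ and the rest on $w$. If $\ell^P\le u^P$, then $p=\ell^P$ with probability $\theta$ and $p=u^P$ otherwise, independently of the earlier choices. If $\ell^P>u^P$, then a target is chosen — after 3a it is $\ell^P$ or $u^P$ with probability $\frac12$ each, independently; after 3b it is $u^P$ if $\theta<\frac12$ and $\ell^P$ if $\theta\ge\frac12$ — and $p$ is the number closest to the target for which neither $v$ nor $w$ receives more than $\chi(B'(v))$, respectively $\chi(B'(w))$, non-black particles. 5. A uniform choice of the remaining white particles fills $v$ up to $\chi(B'(v))$ non-black particles; the rest go to $w$. Let $\mathrm{ink}_t=\sum_v(R_t(v)+\frac12P_t(v))$ be the total ink at time $t$, and $\mathrm{Fill}=\{\lim_{t\to\infty}\mathrm{ink}_t=N\}$. **Proposition.** For every $\xi\in\Omega_{m-1}$, $x\in V$ and $T>0$, $$\mathbb P(\mathrm{Fill})=\frac{\chi(\xi(x))}{a(m-1)+bn},$$ and for every $t>0$ $$\big\|\mathcal L((\xi_t,m_t))-\mathcal L((\xi_t,\tilde m_t))\big\|_{\mathrm{TV}}\;\le\;1-\mathbb E\left[\frac{\mathrm{ink}_t}{a(m-1)+bn}\;\Big|\;\mathrm{Fill}\right],$$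 where $\|\mu-\nu\|_{\mathrm{TV}}=\sum_\omega(\mu(\omega)-\nu(\omega))_+$. -/

import Mathlib

open MeasureTheory ProbabilityTheory Filter Topology

noncomputable section

namespace BBSplit

/-! ### The graph and particle configurations -/

/-- The edges `{v, w}` of a graph on `{0, …, n - 1}`, each written once as the pair `(v, w)` with
`v < w`. -/
abbrev Edge {n : ℕ} (G : SimpleGraph (Fin n)) : Type :=
  {e : Fin n × Fin n // e.1 < e.2 ∧ G.Adj e.1 e.2}

instance {n : ℕ} (G : SimpleGraph (Fin n)) : Fintype (Edge G) := Fintype.ofFinite _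

/-- The set of configurations of `k` particles on `n` vertices. -/
def configs (n k : ℕ) : Finset (Fin n → ℕ) := Finset.piAntidiag Finset.univ k

/-- The configuration `ξ` with one more particle at `v`. -/
def addAt {n : ℕ} (ξ : Fin n → ℕ) (v : Fin n) : Fin n → ℕ := ξ + Pi.single v 1

/-- Total variation distance of two mass functions on the finite set `S`. -/
def tvDist {α : Type*} (S : Finset α) (p q : α → ℝ) : ℝ := ∑ ω ∈ S, max (p ω - q ω) 0

/-! ### The beta-binomial splitting process: one step and equilibrium -/

/-- The mass at `j` of the beta-binomial distribution with parameters `(k, s, s)`. -/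
def betaBin (s : ℝ) (k j : ℕ) : ℝ :=
  (k.choose j : ℝ) * beta ((j : ℝ) + s) ((k : ℝ) - j + s) / beta s s

open Classical in
/-- The probability that the splitting process moves from `ξ` to `ξ'` when `e = {v, w}` rings. -/
def bbProb (s : ℝ) {n : ℕ} (e : Fin n × Fin n) (ξ ξ' : Fin n → ℕ) : ℝ :=
  if (∀ u, u ≠ e.1 → u ≠ e.2 → ξ' u = ξ u) ∧ ξ' e.1 + ξ' e.2 = ξ e.1 + ξ e.2 then
    betaBin s (ξ e.1 + ξ e.2) (ξ' e.1)
  else 0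

/-- The equilibrium distribution of the splitting process with `k` particles, proportional to
`∏ v, Γ(s + ξ v) / (ξ v)!`. -/
def bbEquil (s : ℝ) (n k : ℕ) (ξ : Fin n → ℕ) : ℝ :=
  (∏ v, Real.Gamma (s + ξ v) / (ξ v).factorial) /
    ∑ ζ ∈ configs n k, ∏ v, Real.Gamma (s + ζ v) / (ζ v).factorial

/-- The equilibrium distribution of the marked process with `m` particles (`m - 1` of them
non-marked), proportional to `bbEquil (addAt ξ v) * (ξ v + 1)`. -/
def mabbEquil (s : ℝ) (n m : ℕ) (ξ : Fin n → ℕ) (v : Fin n) : ℝ :=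
  bbEquil s n m (addAt ξ v) * ((ξ v : ℝ) + 1) /
    ∑ ζ ∈ configs n (m - 1), ∑ y, bbEquil s n m (addAt ζ y) * ((ζ y : ℝ) + 1)

/-- The law `π_ξ` of the marked particle at equilibrium, given the non-marked ones. -/
def condEquil (s : ℝ) (n m : ℕ) (ξ : Fin n → ℕ) (v : Fin n) : ℝ :=
  mabbEquil s n m ξ v / ∑ y, mabbEquil s n m ξ y

/-! ### Sampling from a uniform variable -/

/-- Inverse transform sampling along a list: the first `x` in the list whose cumulative weight is
at least `u` (and `d` if there is none). -/
def quantile {α : Type*} (p : α → ℝ) (d : α) : List α → ℝ → α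
  | [], _ => d
  | x :: l, u => if u ≤ p x then x else quantile p d l (u - p x)

open Classical in
/-- A value with law `p`, for a `p` of finite support, obtained from a uniform `u`. -/
def samplePMF {α : Type*} (p : PMF α) (u : ℝ) : α :=
  quantile (fun x => (p x).toReal) p.support_nonempty.some
    (if h : p.support.Finite then h.toFinset.toList else []) u

open Classical in
/-- The uniform distribution on a finite set (and a point mass at `d` if the set is empty). -/
def unif {α : Type*} (S : Finset α) (d : α) : PMF α :=
  if h : S.Nonempty then PMF.uniformOfFinset S h else PMF.pure d

/-- The distribution on `Bool` that gives mass `p` to `true`, for `p ∈ [0, 1]`. -/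
def coinFlip (p : ℝ) : PMF Bool :=
  PMF.ofFintype
    (fun c => if c then ENNReal.ofReal (max 0 (min p 1)) else ENNReal.ofReal (1 - max 0 (min p 1)))
    (by
      have h0 : (0 : ℝ) ≤ max 0 (min p 1) := le_max_left _ _
      have h1 : max 0 (min p 1) ≤ (1 : ℝ) := max_le zero_le_one (min_le_right _ _)
      rw [Fintype.sum_bool]
      simp only [if_true, Bool.false_eq_true, if_false]
      rw [← ENNReal.ofReal_add h0 (by linarith)]
      simp)

/-! ### The marked process (MaBB): one step -/

/-- The probability `P_{e, ξ, ξ'}(y, z)` that the marked particle goes from `y` to `z` (both on `e`)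
when `e` rings and the non-marked particles go from `ξ` to `ξ'`. -/
def markProb (s : ℝ) {n : ℕ} (e : Fin n × Fin n) (ξ ξ' : Fin n → ℕ) (y z : Fin n) : ℝ :=
  ((ξ' z : ℝ) + 1) / ((ξ e.1 : ℝ) + ξ e.2 + 1) *
    (bbProb s e (addAt ξ y) (addAt ξ' z) / bbProb s e ξ ξ')

/-- `ξ` with the particles on `e` redistributed so that `j` of them are on the first end. -/
def splitAt {n : ℕ} (e : Fin n × Fin n) (ξ : Fin n → ℕ) (j : ℕ) : Fin n → ℕ :=
  fun u => if u = e.1 then j else if u = e.2 then ξ e.1 + ξ e.2 - j else ξ u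

/-- The numbers `0, …, k` sorted by their distance from `k / 2`, the smaller one first in a tie. -/
def splitOrder (k : ℕ) : List ℕ :=
  (List.range (k + 1)).mergeSort (fun i j =>
    decide (|2 * (i : ℤ) - k| < |2 * (j : ℤ) - k| ∨
      (|2 * (i : ℤ) - k| = |2 * (j : ℤ) - k| ∧ i ≤ j)))

/-- The new configuration of the non-marked particles. -/
def mabb (s u : ℝ) {n : ℕ} (e : Fin n × Fin n) (ξ : Fin n → ℕ) : Fin n → ℕ :=
  splitAt e ξ
    (quantile (fun j => bbProb s e ξ (splitAt e ξ j)) (ξ e.1) (splitOrder (ξ e.1 + ξ e.2)) u)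

/-- The new location of the marked particle, which is at `y` before `e` rings. -/
def mabbStar (s u u' : ℝ) {n : ℕ} (e : Fin n × Fin n) (ξ : Fin n → ℕ) (y : Fin n) : Fin n :=
  if y = e.1 then (if u' < markProb s e ξ (mabb s u e ξ) y y then y else e.2)
  else if y = e.2 then (if u' < markProb s e ξ (mabb s u e ξ) y y then y else e.1)
  else y

/-! ### The graphical construction -/

/-- A realisation of the graphical construction. The `k`-th ring (`k = 0, 1, …`) is on `edge k` and
comes `gap k` after the previous ring (or after time `0`); it uses `ub k` and `uc k`. The flip
`coin j` is the one available at the end of the `j`-th round (`j = 0, 1, …`). -/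
structure Drive {n : ℕ} (G : SimpleGraph (Fin n)) where
  gap : ℕ → ℝ
  edge : ℕ → Edge G
  ub : ℕ → ℝ
  uc : ℕ → ℝ
  coin : ℕ → Bool

/-- The law on edges that is proportional to the weights. -/
def edgeLaw {n : ℕ} {G : SimpleGraph (Fin n)} (r : Edge G → ℝ) : Measure (Edge G) :=
  ∑ e, ENNReal.ofReal (r e / ∑ e', r e') • Measure.dirac e

/-- The joint law of `(gap, edge, ub, uc, coin)`: independent, with the gap exponential of rate
`∑ e, r e`, the edge proportional to the weights, `ub` and `uc` uniform on `[0, 1]`, and a fair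
coin. -/
def tickLaw {n : ℕ} {G : SimpleGraph (Fin n)} (r : Edge G → ℝ) :
    Measure (ℝ × Edge G × ℝ × ℝ × Bool) :=
  (expMeasure (∑ e, r e)).prod ((edgeLaw r).prod
    ((volume.restrict (Set.Icc (0 : ℝ) 1)).prod ((volume.restrict (Set.Icc (0 : ℝ) 1)).prod
      (PMF.uniformOfFintype Bool).toMeasure)))

/-- `D` is a random graphical construction on the probability space `(Ω, μ)`: rings at the times of
a Poisson process of rate `∑ e, r e`, and everything independent. -/
structure IsGraphical {n : ℕ} {G : SimpleGraph (Fin n)} (r : Edge G → ℝ) {Ω : Type*}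
    [MeasurableSpace Ω] (μ : Measure Ω) (D : Ω → Drive G) : Prop where
  measurable_tick : ∀ k, Measurable fun ω =>
    ((D ω).gap k, (D ω).edge k, (D ω).ub k, (D ω).uc k, (D ω).coin k)
  law_tick : ∀ k, μ.map (fun ω =>
    ((D ω).gap k, (D ω).edge k, (D ω).ub k, (D ω).uc k, (D ω).coin k)) = tickLaw r
  indep_tick : iIndepFun (fun k ω =>
    ((D ω).gap k, (D ω).edge k, (D ω).ub k, (D ω).uc k, (D ω).coin k)) μ

/-- The time of the `k`-th ring. -/
def ringTime {n : ℕ} {G : SimpleGraph (Fin n)} (D : Drive G) (k : ℕ) : ℝ :=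
  ∑ i ∈ Finset.range (k + 1), D.gap i

/-- The number of rings up to and including time `t`. -/
def ringCount {n : ℕ} {G : SimpleGraph (Fin n)} (D : Drive G) (t : ℝ) : ℕ :=
  Set.ncard {k : ℕ | ringTime D k ≤ t}

/-- The marked process after `k` rings: non-marked configuration and marked location. -/
def mabbSkeleton (s : ℝ) {n : ℕ} {G : SimpleGraph (Fin n)} (D : Drive G) (ξ : Fin n → ℕ)
    (x : Fin n) : ℕ → (Fin n → ℕ) × Fin n
  | 0 => (ξ, x)
  | k + 1 =>
    let c := mabbSkeleton s D ξ x k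
    (mabb s (D.ub k) (D.edge k).1 c.1, mabbStar s (D.ub k) (D.uc k) (D.edge k).1 c.1 c.2)

/-- The marked process `(ξ_t, m_t)` started at `(ξ, x)`. -/
def mabbAt (s : ℝ) {n : ℕ} {G : SimpleGraph (Fin n)} (D : Drive G) (ξ : Fin n → ℕ)
    (x : Fin n) (t : ℝ) : (Fin n → ℕ) × Fin n :=
  mabbSkeleton s D ξ x (ringCount D t)

/-! ### The chameleon process -/

/-- The colour function: a vertex with `k` black particles holds `a * k + b` non-black ones. -/
def chi (a b k : ℕ) : ℕ := a * k + b

/-- A state of the chameleon process with `N` non-black particles: numbers of black, red and pink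
particles at each vertex, and the vertices of the labelled red and white particles (`none` if no
particle has the label). A red and a white particle with the same label are a pair. -/
structure ChamState (n N : ℕ) where
  B : Fin n → ℕ
  R : Fin n → ℕ
  P : Fin n → ℕ
  LR : Fin N → Option (Fin n)
  LW : Fin N → Option (Fin n)

/-- The number of white particles at `v`. -/
def ChamState.W (a b : ℕ) {n N : ℕ} (σ : ChamState n N) (v : Fin n) : ℕ :=
  chi a b (σ.B v) - σ.R v - σ.P v

/-- The ink at `v`. -/
def ChamState.ink {n N : ℕ} (σ : ChamState n N) (v : Fin n) : ℝ := (σ.R v : ℝ) + (σ.P v : ℝ) / 2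

/-- The total ink. -/
def ChamState.totalInk {n N : ℕ} (σ : ChamState n N) : ℝ := ∑ v, σ.ink v

/-- `ℓ(v) = (R_{v,w} - χ(B'(w))) ∨ 0`, with `cw = χ(B'(w))`, `Re = R_{v,w}`. -/
def redLow (cw Re : ℕ) : ℕ := Re - cw

/-- `u(v) = χ(B'(v)) ∧ R_{v,w}`, with `cv = χ(B'(v))`. -/
def redUp (cv Re : ℕ) : ℕ := min cv Re

/-- `ℓᴾ(v) = (P_{v,w} - χ(B'(w)) + u(w)) ∨ 0`, with `Pe = P_{v,w}`. -/
def pinkLow (cw Re Pe : ℕ) : ℕ := Pe + redUp cw Re - cw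

/-- `uᴾ(v) = (χ(B'(v)) - u(v)) ∧ P_{v,w}`. -/
def pinkUp (cv Re Pe : ℕ) : ℕ := min (cv - redUp cv Re) Pe

/-- `m*(v)` for `v = e.1`, `w = e.2`: the mean ink that `v` has to have after the ring. -/
def meanInk (s : ℝ) {n N : ℕ} (e : Fin n × Fin n) (B' : Fin n → ℕ) (σ : ChamState n N) : ℝ :=
  σ.ink e.1 * markProb s e σ.B B' e.1 e.1 + σ.ink e.2 * markProb s e σ.B B' e.2 e.1

/-- `θ(v)` for `v = e.1`: the solution `θ` of
`θ (ℓ(v) + ℓᴾ(v)/2) + (1 - θ) (u(v) + uᴾ(v)/2) = m*(v)`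
(`0` in the degenerate case where every `θ` is a solution). -/
def theta (a b : ℕ) {n N : ℕ} (e : Fin n × Fin n) (B' : Fin n → ℕ) (σ : ChamState n N) : ℝ :=
  let cv := chi a b (B' e.1)
  let cw := chi a b (B' e.2)
  let Re := σ.R e.1 + σ.R e.2
  let Pe := σ.P e.1 + σ.P e.2
  let lower : ℝ := (redLow cw Re : ℝ) + (pinkLow cw Re Pe : ℝ) / 2
  let upper : ℝ := (redUp cv Re : ℝ) + (pinkUp cv Re Pe : ℝ) / 2
  (upper - meanInk ((b : ℝ) / a) e B' σ) / (upper - lower)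

/-- Names for the particles of one colour on a ringing edge: `inl i` is the particle with label
`i`, and the `inr j` are the particles without a label. -/
abbrev Token (N : ℕ) : Type := Fin N ⊕ Fin N

open Classical in
/-- The `count` particles of one colour on `e`, where `L` gives the labelled ones. -/
def tokens {n N : ℕ} (e : Fin n × Fin n) (L : Fin N → Option (Fin n)) (count : ℕ) :
    Finset (Token N) :=
  let labelled := Finset.univ.filter fun i => L i = some e.1 ∨ L i = some e.2
  Finset.univ.filter fun p =>
    match p with
    | Sum.inl i => i ∈ labelled
    | Sum.inr j => (j : ℕ) < count - labelled.card

open Classical in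
/-- The law of the state just after `e = {v, w}` rings in state `σ`, given that the black particles
move to `B'`. -/
def chamKernel (a b : ℕ) {n N : ℕ} (e : Fin n × Fin n) (B' : Fin n → ℕ) (σ : ChamState n N) :
    PMF (ChamState n N) :=
  let cv := chi a b (B' e.1)
  let cw := chi a b (B' e.2)
  let Re := σ.R e.1 + σ.R e.2
  let Pe := σ.P e.1 + σ.P e.2
  let lv := redLow cw Re
  let lw := Re - redUp cv Re
  let lP := pinkLow cw Re Pe
  let uP := pinkUp cv Re Pe
  let θ := theta a b e B' σ
  let reds := tokens e σ.LR Re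
  let whites := tokens e σ.LW (σ.W a b e.1 + σ.W a b e.2)
  let paired := reds.filter fun p => ∃ i, p = Sum.inl i ∧ p ∈ whites
  let cap : ℕ := ⌈(((min (∑ y, σ.R y) (∑ y, σ.W a b y) : ℕ) : ℚ) + ((∑ y, σ.P y : ℕ) : ℚ) / 2) / 3⌉₊
    - (∑ y, σ.P y) / 2
  do
    -- Step 1: `S` is the set of reds for the lower bounds, chosen uniformly, non-paired reds first;
    -- `Sv` is the part of `S` that goes to `v`.
    let S ← unif ((reds.powersetCard (lv + lw)).filter fun S =>
      S ⊆ reds \ paired ∨ reds \ paired ⊆ S) ∅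
    let Sv ← unif (S.powersetCard lv) ∅
    let pool := reds \ S
    -- Step 2: `fork` says whether Step 3a is done (else Step 3b).
    let fork ← coinFlip (2 * min θ (1 - θ))
    -- Step 3a: `K` is the set of paired reds that turn pink, together with their white partners.
    let K ← if fork then
        unif ((pool ∩ paired).powersetCard (min (pool ∩ paired).card cap)) ∅
      else PMF.pure ∅
    -- Steps 3a and 3b: `Y` is the set of remaining reds that go to `v`; the others go to `w`.
    let Y ← if fork then unif (pool \ K).powerset ∅
      else PMF.pure (if θ < 1 / 2 then pool else ∅)
    -- Step 4: `pv` old pink particles go to `v`, the others to `w`. The room that is left for them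
    -- is `roomV` on `v` and `roomW` on `w`. If `lP ≤ uP`, then `lP` (with probability `θ`) or `uP`
    -- of them go to `v`. If `lP > uP`, the choice between `lP` and `uP` goes along with the
    -- placement of the reds, and the number is moved as little as the room requires.
    let roomV := cv - (Sv.card + Y.card + K.card)
    let roomW := cw - ((S \ Sv).card + ((pool \ K) \ Y).card + K.card)
    let low ← if lP ≤ uP then coinFlip θ
      else if fork then coinFlip (1 / 2)
      else PMF.pure (decide (¬ θ < 1 / 2))
    let pv := max (Pe - roomW) (min (min roomV Pe) (if low then lP else uP))
    -- Step 5: white particles fill `v`, chosen uniformly; the others go to `w`.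
    let Wv ← unif ((whites \ K).powersetCard (roomV - pv)) ∅
    PMF.pure
      { B := B'
        R := fun y => if y = e.1 then Sv.card + Y.card
          else if y = e.2 then (S \ Sv).card + ((pool \ K) \ Y).card else σ.R y
        P := fun y => if y = e.1 then K.card + pv
          else if y = e.2 then K.card + (Pe - pv) else σ.P y
        LR := fun i => if Sum.inl i ∈ reds then
            (if Sum.inl i ∈ K then none
              else if Sum.inl i ∈ Sv ∪ Y then some e.1 else some e.2)
          else σ.LR i
        LW := fun i => if Sum.inl i ∈ whites then
            (if Sum.inl i ∈ K then none
              else if Sum.inl i ∈ Wv then some e.1 else some e.2)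
          else σ.LW i }

/-- The update of the chameleon process at the `k`-th ring. -/
def chamRing (a b : ℕ) {n N : ℕ} {G : SimpleGraph (Fin n)} (D : Drive G) (k : ℕ)
    (σ : ChamState n N) : ChamState n N :=
  samplePMF (chamKernel a b (D.edge k).1 (mabb ((b : ℝ) / a) (D.ub k) (D.edge k).1 σ.B) σ) (D.uc k)

/-- Labels `1, …, M` (here `0, …, M - 1`) given in the order of the vertices to particles of which
there are `cnt v` at `v`. -/
def relabel {n : ℕ} (N : ℕ) (cnt : Fin n → ℕ) (M : ℕ) : Fin N → Option (Fin n) :=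
  fun j => if (j : ℕ) < M then
      (List.finRange n).find? fun v => decide ((j : ℕ) + 1 ≤ ∑ k ∈ Finset.Iic v, cnt k)
    else none

/-- The initial state for a marked process started at `(ξ, x)`. -/
def chamInit (a b N : ℕ) {n : ℕ} (ξ : Fin n → ℕ) (x : Fin n) : ChamState n N where
  B := ξ
  R := fun v => if v = x then chi a b (ξ x) else 0
  P := fun _ => 0
  LR := relabel N (fun v => if v = x then chi a b (ξ x) else 0)
    (min (chi a b (ξ x)) (N - chi a b (ξ x)))
  LW := relabel N (fun v => if v = x then 0 else chi a b (ξ v))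
    (min (chi a b (ξ x)) (N - chi a b (ξ x)))

/-- The update at the end of a round, with coin flip `d`: if there are at least as many pink
particles as red ones or as white ones, all pink particles turn red (`d = true`) or white. In any
case red and white particles are paired anew. -/
def roundEnd (a b : ℕ) {n N : ℕ} (d : Bool) (σ : ChamState n N) : ChamState n N :=
  let depink : Prop := min (∑ v, σ.R v) (∑ v, σ.W a b v) ≤ ∑ v, σ.P v
  open Classical in
  let R' : Fin n → ℕ := fun v => if depink then σ.R v + (if d then σ.P v else 0) else σ.R v
  open Classical in
  let P' : Fin n → ℕ := fun v => if depink then 0 else σ.P v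
  let M : ℕ := min (∑ v, R' v) (N - ∑ v, (R' v + P' v))
  { B := σ.B
    R := R'
    P := P'
    LR := relabel N R' M
    LW := relabel N (fun v => chi a b (σ.B v) - R' v - P' v) M }

/-- The effect of the rings `i, i + 1, …, k - 1`. -/
def chamRun (a b : ℕ) {n N : ℕ} {G : SimpleGraph (Fin n)} (D : Drive G) (i k : ℕ)
    (σ : ChamState n N) : ChamState n N :=
  (List.range' i (k - i)).foldl (fun τ j => chamRing a b D j τ) σ

/-- The chameleon process at time `j * T`, the start of the `j`-th round (`j = 0, 1, …`). -/
def chamRound (a b N : ℕ) {n : ℕ} {G : SimpleGraph (Fin n)} (D : Drive G) (T : ℝ)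
    (ξ : Fin n → ℕ) (x : Fin n) : ℕ → ChamState n N
  | 0 => chamInit a b N ξ x
  | j + 1 => roundEnd a b (D.coin j)
      (chamRun a b D (ringCount D (j * T)) (ringCount D ((j + 1) * T))
        (chamRound a b N D T ξ x j))

/-- The chameleon process at time `t ≥ 0`, with round length `T > 0`. -/
def chamAt (a b N : ℕ) {n : ℕ} {G : SimpleGraph (Fin n)} (D : Drive G) (T : ℝ)
    (ξ : Fin n → ℕ) (x : Fin n) (t : ℝ) : ChamState n N :=
  chamRun a b D (ringCount D (⌊t / T⌋₊ * T)) (ringCount D t) (chamRound a b N D T ξ x ⌊t / T⌋₊)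

/-- The total ink at time `t`. -/
def inkAt (a b N : ℕ) {n : ℕ} {G : SimpleGraph (Fin n)} (D : Drive G) (T : ℝ)
    (ξ : Fin n → ℕ) (x : Fin n) (t : ℝ) : ℝ :=
  (chamAt a b N D T ξ x t).totalInk

/-- The event Fill: the total ink tends to `N`. -/
def fillEvent (a b N : ℕ) {n : ℕ} {G : SimpleGraph (Fin n)} {Ω : Type*} (D : Ω → Drive G) (T : ℝ)
    (ξ : Fin n → ℕ) (x : Fin n) : Set Ω :=
  {ω | Tendsto (fun t : ℝ => inkAt a b N (D ω) T ξ x t) atTop (𝓝 (N : ℝ))}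

/-! ### The two laws that are compared -/

/-- The mass function of the law of `(ξ_t, m_t)`. -/
def mabbLaw (s : ℝ) {n : ℕ} {G : SimpleGraph (Fin n)} {Ω : Type*} [MeasurableSpace Ω]
    (μ : Measure Ω) (D : Ω → Drive G) (ξ : Fin n → ℕ) (x : Fin n) (t : ℝ) :
    (Fin n → ℕ) × Fin n → ℝ :=
  fun c => μ.real {ω | mabbAt s (D ω) ξ x t = c}

/-- The mass function of the law of `(ξ_t, m̃_t)`, where `m̃_t` has law `π_ζ` given `ξ_t = ζ`. -/
def mixedLaw (s : ℝ) {n : ℕ} {G : SimpleGraph (Fin n)} {Ω : Type*} [MeasurableSpace Ω]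
    (μ : Measure Ω) (D : Ω → Drive G) (m : ℕ) (ξ : Fin n → ℕ) (x : Fin n) (t : ℝ) :
    (Fin n → ℕ) × Fin n → ℝ :=
  fun c => μ.real {ω | (mabbAt s (D ω) ξ x t).1 = c.1} * condEquil s n m c.1 c.2

end BBSplit

end

open MeasureTheory ProbabilityTheory Filter Topology

noncomputable section

namespace BBSplit

/-! ### Inverse transform sampling -/

section Sampling

variable {α : Type*}

/-! With `s = b/a` the Gamma and binomial factors in `P_{e,B,B'}(y,z)` collapse to `χ(B'(z)) /
(χ(B'(v)) + χ(B'(w)))` (`markProb_eq_chi`), and likewise `π_ζ(v) = χ(ζ(v)) / N` (`condEquil_eq`). So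
a ring shares the law of the mark between the two ends of the edge in proportion to `χ`, wherever on
the edge the mark was. The rules of the chameleon process make the mean ink do the same
(`mean_twoInk_fst`, `mean_twoInk_snd`); the delicate case is the one in which the targets for the
old pink particles cross (`balanced_targets`). Call the gaps, the edges and the variables of the
black particles the frame. Given the frame, ink and mark obey the same linear recursion, and the ink
starts as `χ(ξ(x)) δ_x`; hence `E[ink_t(v) | frame] = χ(ξ(x)) P(m_t = v | frame)`
(`lintegral_twoInk`).

The total ink changes only at ends of rounds, up or down with equal probability, so given the frame
it is a bounded martingale. Its increments are square summable and take discrete values, so almost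
surely only finitely many are nonzero (`ae_depinked_eventually_zero`). It cannot rest at an
intermediate level: while pink particles may still be created, there is a red-white pair, and each
ring has a probability bounded below of creating pink particles or of bringing the closest pair
nearer (`exists_progress`, `exists_progress_rate`). Late rounds contain arbitrarily long runs of
such rings (`ae_gap`, `ae_exists_progress_run`), whereas distances and numbers of pink particles are
bounded (`total_eventually_extreme`). The ink is therefore absorbed at `0` or `N`, and `P(Fill |
frame) = χ(ξ(x)) / N`. This does not depend on the frame, so Fill is independent of the black
particles.

Consequently `χ(ξ(x)) P(ξ_t = ζ) π_ζ(v) = E[χ(ζ(v)); ξ_t = ζ, Fill]`, whereas `χ(ξ(x)) P(ξ_t = ζ,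
m_t = v) = E[ink_t(v); ξ_t = ζ]`, which is at least `E[ink_t(v); ξ_t = ζ, Fill]`. The positive part
of the difference is at most the mean on Fill of the nonnegative deficit `χ(ζ(v)) - ink_t(v)`
(`mixedLaw_sub_le`). Summing over `ζ` and `v` gives `E[N - ink_t; Fill]`, and division by `χ(ξ(x)) =
N P(Fill)` gives the bound. Ink is counted in halves below, so that it is a natural number. -/

theorem quantile_mem {p : α → ℝ} {d : α} : ∀ {l : List α} {u : ℝ},
    u ≤ (l.map p).sum → 0 < u → quantile p d l u ∈ l
  | [], u, h, h0 => absurd (h0.trans_le h) (by simp)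
  | x :: l, u, h, h0 => by
    rw [quantile]
    split_ifs with hu
    · simp
    · refine List.mem_cons_of_mem _ (quantile_mem ?_ (by linarith))
      simp only [List.map_cons, List.sum_cons] at h
      linarith

theorem quantile_mem_or_eq (p : α → ℝ) (d : α) :
    ∀ (l : List α) (u : ℝ), quantile p d l u ∈ l ∨ quantile p d l u = d
  | [], u => Or.inr rfl
  | x :: l, u => by
    rw [quantile]
    split_ifs
    · simp
    · rcases quantile_mem_or_eq p d l (u - p x) with h | h
      · exact Or.inl (List.mem_cons_of_mem _ h)
      · exact Or.inr h

theorem measurable_quantile [MeasurableSpace α] (p : α → ℝ) (d : α) :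
    ∀ l : List α, Measurable (quantile p d l)
  | [] => measurable_const
  | x :: l => by
    have h := measurable_quantile p d l
    exact Measurable.ite measurableSet_Iic measurable_const (h.comp (measurable_id.sub_const _))

/-- The interval from 0 to the total mass is cut into consecutive half-open pieces of lengths `p x`;
removing the head of the list translates the rest by its mass. Outside this interval the default, or
the head whatever its mass, would be returned. -/
theorem volume_quantile_eq {p : α → ℝ} (hp : ∀ x, 0 ≤ p x) (d : α) :
    ∀ {l : List α}, l.Nodup → ∀ x ∈ l,
      volume {u : ℝ | 0 < u ∧ u ≤ (l.map p).sum ∧ quantile p d l u = x} = ENNReal.ofReal (p x)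
  | [], _, x, hx => by simp at hx
  | y :: l, hl, x, hx => by
    rw [List.nodup_cons] at hl
    have hS : 0 ≤ (l.map p).sum := List.sum_nonneg (by simpa using fun a _ => hp a)
    by_cases hxy : x = y
    · subst hxy
      have : {u : ℝ | 0 < u ∧ u ≤ ((x :: l).map p).sum ∧ quantile p d (x :: l) u = x} =
          Set.Ioc 0 (p x) := by
        ext u
        simp only [Set.mem_ofPred_eq, List.map_cons, List.sum_cons, Set.mem_Ioc, quantile]
        constructor
        · rintro ⟨h0, h1, h2⟩
          refine ⟨h0, ?_⟩
          by_contra hu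
          rw [if_neg hu] at h2
          refine hl.1 (h2 ▸ quantile_mem (p := p) (d := d) ?_ ?_) <;> linarith
        · rintro ⟨h0, h1⟩
          exact ⟨h0, by linarith, if_pos h1⟩
      rw [this, Real.volume_Ioc, sub_zero]
    · have hxl : x ∈ l := by simpa [hxy] using hx
      have : {u : ℝ | 0 < u ∧ u ≤ ((y :: l).map p).sum ∧ quantile p d (y :: l) u = x} =
          (fun u => u - p y) ⁻¹' {u | 0 < u ∧ u ≤ (l.map p).sum ∧ quantile p d l u = x} := by
        ext u
        simp only [Set.mem_ofPred_eq, List.map_cons, List.sum_cons, Set.mem_preimage, quantile]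
        constructor
        · rintro ⟨h0, h1, h2⟩
          by_cases hu : u ≤ p y
          · rw [if_pos hu] at h2
            exact absurd h2.symm hxy
          · rw [if_neg hu] at h2
            exact ⟨by linarith, by linarith, h2⟩
        · rintro ⟨h0, h1, h2⟩
          have := hp y
          exact ⟨by linarith, by linarith, by rw [if_neg (by linarith)]; exact h2⟩
      have hm : (fun u => u - p y) = fun u => u + -p y := by simp only [sub_eq_add_neg]
      rw [this, hm, measure_preimage_add_right, volume_quantile_eq hp d hl.2 x hxl]

/-- The uniform law on the unit interval. -/
abbrev unitLaw : Measure ℝ := volume.restrict (Set.Icc (0 : ℝ) 1)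

instance : IsProbabilityMeasure unitLaw := ⟨by simp⟩

/-- Valid for every real `u`, since the default also lies in the support. Invariants of the process
can thus be proved for each path, without null sets. -/
theorem samplePMF_mem_support {p : PMF α} (hp : p.support.Finite) (u : ℝ) :
    samplePMF p u ∈ p.support := by
  rw [samplePMF, dif_pos hp]
  rcases quantile_mem_or_eq (fun x => (p x).toReal) p.support_nonempty.some
    hp.toFinset.toList u with h | h
  · simpa using h
  · rw [h]
    exact p.support_nonempty.some_mem

theorem measurable_samplePMF [MeasurableSpace α] (p : PMF α) : Measurable (samplePMF p) :=
  measurable_quantile _ _ _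

theorem unitLaw_samplePMF_eq {p : PMF α} (hp : p.support.Finite) (x : α) :
    unitLaw {u | samplePMF p u = x} = p x := by
  classical
  by_cases hx : x ∈ p.support
  · have hsum : (hp.toFinset.toList.map fun x => (p x).toReal).sum = 1 := by
      rw [Finset.sum_map_toList, ← ENNReal.toReal_sum fun a _ => p.apply_ne_top a]
      have h1 : ∑' x, p x = ∑ x ∈ hp.toFinset, p x := tsum_eq_sum fun b hb => by
        simpa [PMF.mem_support_iff] using hb
      rw [← h1, p.tsum_coe, ENNReal.toReal_one]
    have h := volume_quantile_eq (p := fun x => (p x).toReal) (fun _ => ENNReal.toReal_nonneg)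
      p.support_nonempty.some hp.toFinset.nodup_toList x (by simpa using hx)
    rw [hsum, ENNReal.ofReal_toReal (p.apply_ne_top x)] at h
    -- The null point 0 is dropped, because `volume_quantile_eq` concerns a half-open interval.
    rw [← h, unitLaw, ← restrict_Ioc_eq_restrict_Icc]
    let _ : MeasurableSpace α := ⊤
    have hm : MeasurableSet {u | samplePMF p u = x} :=
      measurable_samplePMF p (MeasurableSpace.measurableSet_top (s := {x}))
    rw [Measure.restrict_apply hm]
    congr 1
    ext u
    simp only [samplePMF, dif_pos hp, Set.mem_inter_iff, Set.mem_ofPred_eq, Set.mem_Ioc]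
    tauto
  · have : {u | samplePMF p u = x} = ∅ := by
      ext u
      simp only [Set.mem_ofPred_eq, Set.mem_empty_iff_false, iff_false]
      rintro rfl
      exact hx (samplePMF_mem_support hp u)
    rw [this, measure_empty, (p.apply_eq_zero_iff x).2 hx]

/-! ### Means of discrete laws -/

/-- The mean of `f` under `p`. -/
def pmfMean (p : PMF α) (f : α → ENNReal) : ENNReal := ∑' x, p x * f x

theorem lintegral_samplePMF [Countable α] {p : PMF α} (hp : p.support.Finite)
    (f : α → ENNReal) : ∫⁻ u, f (samplePMF p u) ∂unitLaw = pmfMean p f := by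
  let _ : MeasurableSpace α := ⊤
  rw [← lintegral_map (f := f) (Measurable.of_discrete) (measurable_samplePMF p),
    lintegral_countable', pmfMean]
  refine tsum_congr fun x => ?_
  rw [Measure.map_apply (measurable_samplePMF p) (MeasurableSet.of_discrete), mul_comm]
  congr 1
  exact unitLaw_samplePMF_eq hp x

@[simp]
theorem pmfMean_pure (x : α) (f : α → ENNReal) : pmfMean (PMF.pure x) f = f x := by
  classical
  rw [pmfMean, tsum_eq_single x]
  · simp
  · intro y hy
    simp [PMF.pure_apply, hy]

theorem pmfMean_bind {β : Type*} (p : PMF α) (q : α → PMF β) (f : β → ENNReal) :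
    pmfMean (p.bind q) f = pmfMean p fun x => pmfMean (q x) f := by
  simp only [pmfMean, PMF.bind_apply, ← ENNReal.tsum_mul_right, ← ENNReal.tsum_mul_left]
  rw [ENNReal.tsum_comm]
  simp only [mul_assoc]

theorem pmfMean_congr {p : PMF α} {f g : α → ENNReal} (h : ∀ x ∈ p.support, f x = g x) :
    pmfMean p f = pmfMean p g := by
  refine tsum_congr fun x => ?_
  by_cases hx : x ∈ p.support
  · rw [h x hx]
  · rw [(p.apply_eq_zero_iff x).2 hx, zero_mul, zero_mul]

theorem pmfMean_of_const {p : PMF α} {f : α → ENNReal} {c : ENNReal}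
    (h : ∀ x ∈ p.support, f x = c) : pmfMean p f = c := by
  rw [pmfMean_congr (g := fun _ => c) h, pmfMean, ENNReal.tsum_mul_right, p.tsum_coe, one_mul]

theorem pmfMean_add (p : PMF α) (f g : α → ENNReal) :
    pmfMean p (fun x => f x + g x) = pmfMean p f + pmfMean p g := by
  simp only [pmfMean, mul_add, ENNReal.tsum_add]

theorem pmfMean_coinFlip {p : ℝ} (h0 : 0 ≤ p) (h1 : p ≤ 1) (f : Bool → ENNReal) :
    pmfMean (coinFlip p) f = ENNReal.ofReal p * f true + ENNReal.ofReal (1 - p) * f false := by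
  simp [pmfMean, coinFlip, min_eq_left h1, max_eq_right h0]

theorem mem_support_coinFlip_true {p : ℝ} (h0 : 0 < p) : true ∈ (coinFlip p).support := by
  simp [coinFlip, h0]

/-! ### Uniform laws on finite sets -/

theorem support_unif {S : Finset α} (hS : S.Nonempty) (d : α) : (unif S d).support = S := by
  rw [unif, dif_pos hS, PMF.support_uniformOfFinset]

theorem finite_support_unif (S : Finset α) (d : α) : (unif S d).support.Finite := by
  by_cases hS : S.Nonempty
  · rw [support_unif hS]
    exact S.finite_toSet
  · rw [unif, dif_neg hS, PMF.support_pure]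
    exact Set.finite_singleton d

theorem mem_support_unif {S : Finset α} {d x : α} (hx : x ∈ S) : x ∈ (unif S d).support := by
  rw [support_unif ⟨x, hx⟩]
  exact hx

theorem unif_mem {S : Finset α} (hS : S.Nonempty) {d x : α} (hx : x ∈ (unif S d).support) :
    x ∈ S := by
  rwa [support_unif hS] at hx

/-- A bijection of the underlying set preserves the mean of a uniform law. -/
theorem pmfMean_unif_comp {S : Finset α} (hS : S.Nonempty) (d : α) (f : α → ENNReal)
    (φ : α → α) (hφ : ∀ x ∈ S, φ x ∈ S) (hφφ : ∀ x ∈ S, φ (φ x) = x) :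
    pmfMean (unif S d) (fun x => f (φ x)) = pmfMean (unif S d) f := by
  classical
  have key : ∀ g : α → ENNReal, pmfMean (unif S d) g = ∑ x ∈ S, (S.card : ENNReal)⁻¹ * g x := by
    intro g
    rw [pmfMean, tsum_eq_sum (s := S)]
    · refine Finset.sum_congr rfl fun x hx => ?_
      rw [unif, dif_pos hS, PMF.uniformOfFinset_apply_of_mem _ hx]
    · intro x hx
      rw [unif, dif_pos hS, PMF.uniformOfFinset_apply_of_notMem _ hx, zero_mul]
  rw [key, key]
  exact Finset.sum_bij' (fun x _ => φ x) (fun x _ => φ x) hφ hφ hφφ hφφ (fun _ _ => rfl)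

end Sampling

/-! ### Explicit formulas for the mark -/

/-- The functional equation of Gamma is used once above and once below the fraction bar, and the
quotient of binomial coefficients cancels the prefactor. -/
theorem betaBin_succ_succ {s : ℝ} (hs : 0 < s) {k j : ℕ} (hj : j ≤ k) :
    ((j : ℝ) + 1) / ((k : ℝ) + 1) * (betaBin s (k + 1) (j + 1) / betaBin s k j) =
      ((j : ℝ) + s) / ((k : ℝ) + 2 * s) := by
  have hj' : (j : ℝ) ≤ k := by exact_mod_cast hj
  have h1 : 0 < (j : ℝ) + s := by positivity
  have h2 : 0 < (k : ℝ) - j + s := by linarith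
  have h3 : 0 < (k : ℝ) + 2 * s := by positivity
  have hc : ((k + 1).choose (j + 1) : ℝ) * (j + 1) = (k + 1) * k.choose j := by
    exact_mod_cast (Nat.add_one_mul_choose_eq k j).symm
  have hc0 : (0 : ℝ) < k.choose j := by exact_mod_cast Nat.choose_pos hj
  have e1 : ((j + 1 : ℕ) : ℝ) + s = ((j : ℝ) + s) + 1 := by push_cast; ring
  have e2 : ((k + 1 : ℕ) : ℝ) - ((j + 1 : ℕ) : ℝ) + s = (k : ℝ) - j + s := by push_cast; ring
  have e3 : (j : ℝ) + s + 1 + ((k : ℝ) - j + s) = ((k : ℝ) + 2 * s) + 1 := by ring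
  have e4 : (j : ℝ) + s + ((k : ℝ) - j + s) = (k : ℝ) + 2 * s := by ring
  have g0 := Real.Gamma_pos_of_pos hs
  have g00 := Real.Gamma_pos_of_pos (add_pos hs hs)
  have g1 := Real.Gamma_pos_of_pos h1
  have g2 := Real.Gamma_pos_of_pos h2
  have g3 := Real.Gamma_pos_of_pos h3
  rw [betaBin, betaBin, e1, e2, beta, beta, beta, e3, e4, Real.Gamma_add_one h1.ne',
    Real.Gamma_add_one h3.ne']
  have hc' : ((k + 1).choose (j + 1) : ℝ) = (k + 1) * k.choose j / (j + 1) := by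
    field_simp
    linarith
  rw [hc']
  field_simp

theorem betaBin_succ {s : ℝ} (hs : 0 < s) {k j : ℕ} (hj : j ≤ k) :
    ((k : ℝ) - j + 1) / ((k : ℝ) + 1) * (betaBin s (k + 1) j / betaBin s k j) =
      ((k : ℝ) - j + s) / ((k : ℝ) + 2 * s) := by
  have hj' : (j : ℝ) ≤ k := by exact_mod_cast hj
  have h1 : 0 < (j : ℝ) + s := by positivity
  have h2 : 0 < (k : ℝ) - j + s := by linarith
  have h3 : 0 < (k : ℝ) + 2 * s := by positivity
  have h4 : 0 < (k : ℝ) - j + 1 := by linarith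
  have hc : (k.choose j : ℝ) * (k + 1) = (k + 1).choose j * ((k : ℝ) - j + 1) := by
    have := Nat.choose_mul_succ_eq k j
    have h : ((k + 1 - j : ℕ) : ℝ) = (k : ℝ) - j + 1 := by
      rw [Nat.cast_sub (by omega)]
      push_cast
      ring
    rw [← h]
    exact_mod_cast this
  have hc0 : (0 : ℝ) < k.choose j := by exact_mod_cast Nat.choose_pos hj
  have e2 : ((k + 1 : ℕ) : ℝ) - (j : ℝ) + s = ((k : ℝ) - j + s) + 1 := by push_cast; ring
  have e3 : (j : ℝ) + s + ((k : ℝ) - j + s + 1) = ((k : ℝ) + 2 * s) + 1 := by ring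
  have e4 : (j : ℝ) + s + ((k : ℝ) - j + s) = (k : ℝ) + 2 * s := by ring
  have g0 := Real.Gamma_pos_of_pos hs
  have g00 := Real.Gamma_pos_of_pos (add_pos hs hs)
  have g1 := Real.Gamma_pos_of_pos h1
  have g2 := Real.Gamma_pos_of_pos h2
  have g3 := Real.Gamma_pos_of_pos h3
  rw [betaBin, betaBin, e2, beta, beta, beta, e3, e4, Real.Gamma_add_one h2.ne',
    Real.Gamma_add_one h3.ne']
  have hc' : ((k + 1).choose j : ℝ) = k.choose j * (k + 1) / ((k : ℝ) - j + 1) := by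
    rw [hc]
    field_simp
  rw [hc']
  field_simp

/-- `ξ'` can be the configuration after `e` rings in configuration `ξ`. -/
def IsSplit {n : ℕ} (e : Fin n × Fin n) (ξ ξ' : Fin n → ℕ) : Prop :=
  (∀ u, u ≠ e.1 → u ≠ e.2 → ξ' u = ξ u) ∧ ξ' e.1 + ξ' e.2 = ξ e.1 + ξ e.2

section Mark

variable {n : ℕ} {e : Fin n × Fin n} {ξ ξ' : Fin n → ℕ}

theorem bbProb_of_isSplit (s : ℝ) (h : IsSplit e ξ ξ') :
    bbProb s e ξ ξ' = betaBin s (ξ e.1 + ξ e.2) (ξ' e.1) := if_pos h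

theorem addAt_same (ξ : Fin n → ℕ) (v : Fin n) : addAt ξ v v = ξ v + 1 := by
  simp [addAt]

theorem addAt_of_ne (ξ : Fin n → ℕ) {u v : Fin n} (h : u ≠ v) : addAt ξ v u = ξ u := by
  simp [addAt, h]

theorem addAt_edge_sum (he : e.1 ≠ e.2) (ξ : Fin n → ℕ) {y : Fin n} (hy : y = e.1 ∨ y = e.2) :
    addAt ξ y e.1 + addAt ξ y e.2 = ξ e.1 + ξ e.2 + 1 := by
  rcases hy with rfl | rfl
  · rw [addAt_same, addAt_of_ne _ he.symm]
    omega
  · rw [addAt_same, addAt_of_ne _ he]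
    omega

theorem IsSplit.addAt (he : e.1 ≠ e.2) (h : IsSplit e ξ ξ') {y z : Fin n} (hy : y = e.1 ∨ y = e.2)
    (hz : z = e.1 ∨ z = e.2) : IsSplit e (addAt ξ y) (addAt ξ' z) := by
  refine ⟨fun u h1 h2 => ?_, ?_⟩
  · rw [addAt_of_ne _ (by rintro rfl; tauto), addAt_of_ne _ (by rintro rfl; tauto), h.1 u h1 h2]
  · rw [addAt_edge_sum he _ hy, addAt_edge_sum he _ hz, h.2]

/-- The starting point `y` drops out: a ring on `e` forgets at which end the mark was. -/
theorem markProb_eq {s : ℝ} (hs : 0 < s) (he : e.1 ≠ e.2) (h : IsSplit e ξ ξ') {y z : Fin n}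
    (hy : y = e.1 ∨ y = e.2) (hz : z = e.1 ∨ z = e.2) :
    markProb s e ξ ξ' y z = ((ξ' z : ℝ) + s) / ((ξ e.1 : ℝ) + ξ e.2 + 2 * s) := by
  have h2 : (ξ' e.2 : ℝ) = ((ξ e.1 + ξ e.2 : ℕ) : ℝ) - ξ' e.1 := by
    rw [← h.2]
    push_cast
    ring
  have hle : ξ' e.1 ≤ ξ e.1 + ξ e.2 := by
    rw [← h.2]
    omega
  rw [markProb, bbProb_of_isSplit s h, bbProb_of_isSplit s (h.addAt he hy hz),
    addAt_edge_sum he _ hy]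
  rcases hz with rfl | rfl
  · rw [addAt_same]
    have := betaBin_succ_succ hs hle
    push_cast at this ⊢
    exact this
  · rw [addAt_of_ne _ he, h2]
    have := betaBin_succ hs hle
    push_cast at this ⊢
    exact this

theorem markProb_eq_chi {a b : ℕ} (ha : 0 < a) (hb : 0 < b) (he : e.1 ≠ e.2)
    (h : IsSplit e ξ ξ') {y z : Fin n} (hy : y = e.1 ∨ y = e.2) (hz : z = e.1 ∨ z = e.2) :
    markProb ((b : ℝ) / a) e ξ ξ' y z =
      (chi a b (ξ' z) : ℝ) / (chi a b (ξ' e.1) + chi a b (ξ' e.2)) := by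
  have ha' : (0 : ℝ) < a := by exact_mod_cast ha
  have hb' : (0 : ℝ) < b := by exact_mod_cast hb
  have h2 : (ξ' e.1 : ℝ) + ξ' e.2 = ξ e.1 + ξ e.2 := by exact_mod_cast h.2
  rw [markProb_eq (by positivity) he h hy hz, ← h2]
  simp only [chi]
  push_cast
  rw [div_eq_div_iff (by positivity) (by positivity)]
  field_simp
  ring

theorem isSplit_splitAt (he : e.1 ≠ e.2) (ξ : Fin n → ℕ) {j : ℕ} (hj : j ≤ ξ e.1 + ξ e.2) :
    IsSplit e ξ (splitAt e ξ j) := by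
  refine ⟨fun u h1 h2 => ?_, ?_⟩
  · simp [splitAt, h1, h2]
  · simp only [splitAt, if_true, if_neg he.symm]
    omega

/-- The default value `ξ e.1` of the sampler is an admissible split too, so no condition on `u` is
needed. -/
theorem isSplit_mabb (s u : ℝ) (he : e.1 ≠ e.2) (ξ : Fin n → ℕ) : IsSplit e ξ (mabb s u e ξ) := by
  refine isSplit_splitAt he ξ ?_
  rcases quantile_mem_or_eq (fun j => bbProb s e ξ (splitAt e ξ j)) (ξ e.1)
    (splitOrder (ξ e.1 + ξ e.2)) u with h | h
  · have := List.mem_range.1 (List.mem_mergeSort.1 h)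
    omega
  · rw [h]
    omega

theorem IsSplit.sum_eq (he : e.1 ≠ e.2) (h : IsSplit e ξ ξ') : ∑ v, ξ' v = ∑ v, ξ v := by
  have key : ∀ f : Fin n → ℕ,
      ∑ v, f v = f e.1 + f e.2 + ∑ v ∈ (Finset.univ.erase e.1).erase e.2, f v := by
    intro f
    rw [← Finset.add_sum_erase Finset.univ f (Finset.mem_univ e.1),
      ← Finset.add_sum_erase (Finset.univ.erase e.1) f (a := e.2) (by simp [he.symm]), add_assoc]
  rw [key ξ', key ξ, h.2]
  congr 1
  refine Finset.sum_congr rfl fun v hv => ?_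
  simp only [Finset.mem_erase, Finset.mem_univ, and_true] at hv
  exact h.1 v hv.2 hv.1

end Mark

/-! ### The conditional equilibrium law -/

theorem mem_configs {n k : ℕ} {ξ : Fin n → ℕ} : ξ ∈ configs n k ↔ ∑ v, ξ v = k := by
  simp [configs]

/-- The unnormalised equilibrium weight. -/
def equilWeight (s : ℝ) {n : ℕ} (ξ : Fin n → ℕ) : ℝ :=
  ∏ v, Real.Gamma (s + ξ v) / (ξ v).factorial

theorem equilWeight_pos {s : ℝ} (hs : 0 < s) {n : ℕ} (ξ : Fin n → ℕ) : 0 < equilWeight s ξ :=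
  Finset.prod_pos fun v _ => div_pos (Real.Gamma_pos_of_pos (by positivity))
    (by exact_mod_cast (ξ v).factorial_pos)

theorem equilWeight_addAt {s : ℝ} (hs : 0 < s) {n : ℕ} (ξ : Fin n → ℕ) (v : Fin n) :
    equilWeight s (addAt ξ v) * ((ξ v : ℝ) + 1) = equilWeight s ξ * (s + ξ v) := by
  classical
  rw [equilWeight, equilWeight, ← Finset.mul_prod_erase Finset.univ _ (Finset.mem_univ v),
    ← Finset.mul_prod_erase Finset.univ (fun v => Real.Gamma (s + ξ v) / (ξ v).factorial)
      (Finset.mem_univ v)]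
  have h : ∏ u ∈ Finset.univ.erase v, Real.Gamma (s + addAt ξ v u) / (addAt ξ v u).factorial =
      ∏ u ∈ Finset.univ.erase v, Real.Gamma (s + ξ u) / (ξ u).factorial := by
    refine Finset.prod_congr rfl fun u hu => ?_
    rw [addAt_of_ne _ (Finset.ne_of_mem_erase hu)]
  have hs' : s + (ξ v : ℝ) ≠ 0 := by positivity
  rw [h, addAt_same, Nat.factorial_succ]
  push_cast
  rw [← add_assoc, Real.Gamma_add_one hs']
  have : ((ξ v).factorial : ℝ) ≠ 0 := by exact_mod_cast (ξ v).factorial_ne_zero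
  field_simp

theorem bbEquil_pos {s : ℝ} (hs : 0 < s) {n k : ℕ} {ξ : Fin n → ℕ} (hξ : ξ ∈ configs n k) :
    0 < bbEquil s n k ξ :=
  div_pos (equilWeight_pos hs ξ) (Finset.sum_pos (fun ζ _ => equilWeight_pos hs ζ) ⟨ξ, hξ⟩)

theorem addAt_mem_configs {n k : ℕ} {ξ : Fin n → ℕ} (hξ : ξ ∈ configs n k) (v : Fin n) :
    addAt ξ v ∈ configs n (k + 1) := by
  rw [mem_configs] at hξ ⊢
  simp [addAt, Finset.sum_add_distrib, hξ, Finset.sum_pi_single']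

theorem sum_chi (a b : ℕ) {n k : ℕ} {ξ : Fin n → ℕ} (hξ : ∑ v, ξ v = k) :
    ∑ v, chi a b (ξ v) = a * k + b * n := by
  simp only [chi, Finset.sum_add_distrib, ← Finset.mul_sum, hξ]
  simp [mul_comm]

theorem condEquil_eq {a b : ℕ} (ha : 0 < a) (hb : 0 < b) {n m : ℕ} (hm : 1 ≤ m)
    {ξ : Fin n → ℕ} (hξ : ξ ∈ configs n (m - 1)) (v : Fin n) :
    condEquil ((b : ℝ) / a) n m ξ v =
      (chi a b (ξ v) : ℝ) / ((a * (m - 1) + b * n : ℕ) : ℝ) := by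
  have ha' : (0 : ℝ) < a := by exact_mod_cast ha
  have hb' : (0 : ℝ) < b := by exact_mod_cast hb
  set s : ℝ := (b : ℝ) / a with hs_def
  have hs : 0 < s := by positivity
  have hm1 : m - 1 + 1 = m := by omega
  set Z : ℝ := ∑ ζ ∈ configs n (m - 1), ∑ y, bbEquil s n m (addAt ζ y) * ((ζ y : ℝ) + 1) with hZ
  set Z' : ℝ := ∑ ζ ∈ configs n m, equilWeight s ζ with hZ'
  have hZ'0 : 0 < Z' := Finset.sum_pos (fun ζ _ => equilWeight_pos hs ζ)
    ⟨addAt ξ v, by simpa [hm1] using addAt_mem_configs hξ v⟩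
  have hpos : ∀ ζ ∈ configs n (m - 1), ∀ y, 0 < bbEquil s n m (addAt ζ y) * ((ζ y : ℝ) + 1) :=
    fun ζ hζ y => mul_pos (bbEquil_pos hs (by simpa [hm1] using addAt_mem_configs hζ y))
      (by positivity)
  have hZ0 : 0 < Z := Finset.sum_pos (fun ζ hζ => Finset.sum_pos (fun y _ => hpos ζ hζ y)
    ⟨v, Finset.mem_univ v⟩) ⟨ξ, hξ⟩
  -- Only the factor `χ(ξ(y))` depends on `y`; all normalising constants cancel in the conditional
  -- law.
  have hme : ∀ y, mabbEquil s n m ξ y = equilWeight s ξ / (Z' * Z * a) * chi a b (ξ y) := by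
    intro y
    have h1 : bbEquil s n m (addAt ξ y) = equilWeight s (addAt ξ y) / Z' := rfl
    have h2 := equilWeight_addAt hs ξ y
    have h3 : s + (ξ y : ℝ) = (chi a b (ξ y) : ℝ) / a := by
      rw [hs_def, chi]
      push_cast
      field_simp
      ring
    rw [mabbEquil, h1, ← hZ, div_mul_eq_mul_div, h2, h3]
    field_simp
  have hC : equilWeight s ξ / (Z' * Z * a) ≠ 0 :=
    (div_pos (equilWeight_pos hs ξ) (by positivity)).ne'
  rw [condEquil]
  simp only [hme]
  rw [← Finset.mul_sum, mul_div_mul_left _ _ hC, ← sum_chi a b (mem_configs.1 hξ)]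
  push_cast
  rfl

/-! ### The interpolation parameter -/

theorem redLow_eq (cw Re : ℕ) : (redLow cw Re : ℝ) = Re - redUp cw Re := by
  have : redLow cw Re + redUp cw Re = Re := by
    simp only [redLow, redUp]
    omega
  rw [eq_sub_iff_add_eq]
  exact_mod_cast this

theorem pinkLow_eq (cw Re Pe : ℕ) : (pinkLow cw Re Pe : ℝ) = Pe - pinkUp cw Re Pe := by
  have : pinkLow cw Re Pe + pinkUp cw Re Pe = Pe := by
    simp only [pinkLow, pinkUp, redUp]
    omega
  rw [eq_sub_iff_add_eq]
  exact_mod_cast this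

/-- The right side is the most ink that `v` can hold when reds are placed first and pinks next. The
proportional share exceeds it in no case, and stays strictly below it if the edge carries a red and
is not entirely red. -/
theorem mean_le_inkUp {cv cw Re Pe : ℕ} (hv : 0 < cv) (hw : 0 < cw) (h : Re + Pe ≤ cv + cw) :
    ((Re : ℝ) + (Pe : ℝ) / 2) * (cv / (cv + cw)) ≤
        (redUp cv Re : ℝ) + (pinkUp cv Re Pe : ℝ) / 2 ∧
      (0 < Re → Re < cv + cw → ((Re : ℝ) + (Pe : ℝ) / 2) * (cv / (cv + cw)) <
        (redUp cv Re : ℝ) + (pinkUp cv Re Pe : ℝ) / 2) := by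
  have hv' : (0 : ℝ) < cv := by exact_mod_cast hv
  have hw' : (0 : ℝ) < cw := by exact_mod_cast hw
  have hR : (0 : ℝ) ≤ Re := Nat.cast_nonneg _
  have hP : (0 : ℝ) ≤ Pe := Nat.cast_nonneg _
  have h' : (Re : ℝ) + Pe ≤ cv + cw := by exact_mod_cast h
  rw [← mul_div_assoc, div_le_iff₀ (by positivity), div_lt_iff₀ (by positivity)]
  -- The reds fill `v`; or all reds and pinks fit on `v`; or the reds fit and the pinks overflow.
  have hcases : (redUp cv Re = cv ∧ pinkUp cv Re Pe = 0) ∨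
      (redUp cv Re = Re ∧ pinkUp cv Re Pe = Pe) ∨
      (redUp cv Re = Re ∧ pinkUp cv Re Pe + Re = cv ∧ cv < Re + Pe) := by
    simp only [redUp, pinkUp]
    omega
  have hlt : Re < cv + cw → (Re : ℝ) < cv + cw := fun h => by exact_mod_cast h
  have hpos : 0 < Re → (0 : ℝ) < Re := fun h => by exact_mod_cast h
  rcases hcases with ⟨h1, h2⟩ | ⟨h1, h2⟩ | ⟨h1, h2, h3⟩
  · rw [h1, h2]
    refine ⟨by push_cast; nlinarith, fun h0 h3 => ?_⟩
    have := hlt h3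
    push_cast
    nlinarith
  · rw [h1, h2]
    refine ⟨by nlinarith, fun h0 h3 => ?_⟩
    have := hpos h0
    nlinarith
  · have h2' : (pinkUp cv Re Pe : ℝ) = cv - Re := by
      rw [eq_sub_iff_add_eq]
      exact_mod_cast h2
    rw [h1, h2']
    refine ⟨by nlinarith [mul_nonneg hR hw'.le], fun h0 h3 => ?_⟩
    have := mul_pos (hpos h0) hw'
    nlinarith

/-- The interpolation parameter of the ring, in terms of the numbers of particles. -/
structure ThetaSpec (θ : ℝ) (cv cw Re Pe : ℕ) : Prop where
  nonneg : 0 ≤ θ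
  le_one : θ ≤ 1
  pos : 0 < Re → Re < cv + cw → 0 < θ
  lt_one : 0 < Re → Re < cv + cw → θ < 1
  eq : θ * ((redLow cw Re : ℝ) + (pinkLow cw Re Pe : ℝ) / 2) +
      (1 - θ) * ((redUp cv Re : ℝ) + (pinkUp cv Re Pe : ℝ) / 2) =
    ((Re : ℝ) + (Pe : ℝ) / 2) * (cv / (cv + cw))

/-- The least ink at `v` is the total minus the largest ink at `w`, so both inequalities come from
`mean_le_inkUp`, applied once to each end. -/
theorem thetaSpec {cv cw Re Pe : ℕ} (hv : 0 < cv) (hw : 0 < cw) (h : Re + Pe ≤ cv + cw) :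
    ThetaSpec (((redUp cv Re : ℝ) + (pinkUp cv Re Pe : ℝ) / 2 -
        ((Re : ℝ) + (Pe : ℝ) / 2) * (cv / (cv + cw))) /
      ((redUp cv Re : ℝ) + (pinkUp cv Re Pe : ℝ) / 2 -
        ((redLow cw Re : ℝ) + (pinkLow cw Re Pe : ℝ) / 2))) cv cw Re Pe := by
  have hv' : (0 : ℝ) < cv := by exact_mod_cast hv
  have hw' : (0 : ℝ) < cw := by exact_mod_cast hw
  obtain ⟨h1, h1'⟩ := mean_le_inkUp hv hw h
  obtain ⟨h2, h2'⟩ := mean_le_inkUp hw hv (by omega : Re + Pe ≤ cw + cv)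
  have hc : ((Re : ℝ) + (Pe : ℝ) / 2) * (cw / (cw + cv)) =
      (Re : ℝ) + (Pe : ℝ) / 2 - ((Re : ℝ) + (Pe : ℝ) / 2) * (cv / (cv + cw)) := by
    field_simp
    ring
  rw [hc] at h2 h2'
  rw [redLow_eq, pinkLow_eq]
  set U := (redUp cv Re : ℝ) + (pinkUp cv Re Pe : ℝ) / 2
  set M := ((Re : ℝ) + (Pe : ℝ) / 2) * (cv / (cv + cw))
  set L := (Re : ℝ) - redUp cw Re + ((Pe : ℝ) - pinkUp cw Re Pe) / 2 with hL
  have hLM : L ≤ M := by linarith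
  have hLM' : 0 < Re → Re < cv + cw → L < M := fun h3 h4 => by
    have := h2' h3 (by omega)
    linarith
  constructor
  · exact div_nonneg (by linarith) (by linarith)
  · exact div_le_one_of_le₀ (by linarith) (by linarith)
  · intro h3 h4
    exact div_pos (by linarith [h1' h3 h4]) (by linarith [h1' h3 h4])
  · intro h3 h4
    have := h1' h3 h4
    have := hLM' h3 h4
    rw [div_lt_one (by linarith)]
    linarith
  · rw [redLow_eq, pinkLow_eq, ← hL]
    -- If the bounds coincide, division by zero gives `θ = 0`, the value prescribed for this case,
    -- and the mean, being squeezed between them, equals both.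
    by_cases hUL : U - L = 0
    · rw [hUL, div_zero, zero_mul, zero_add, sub_zero, one_mul]
      change U = M
      linarith
    · change (U - M) / (U - L) * L + (1 - (U - M) / (U - L)) * U = M
      generalize M = M' at *
      field_simp
      ring

/-! ### Valid states -/

/-- The properties of a state that all updates of the chameleon process preserve. -/
structure ChamState.Valid (a b : ℕ) {n N : ℕ} (σ : ChamState n N) : Prop where
  chi_sum : ∑ v, chi a b (σ.B v) = N
  le : ∀ v, σ.R v + σ.P v ≤ chi a b (σ.B v)
  labR : ∀ v, (Finset.univ.filter fun i => σ.LR i = some v).card ≤ σ.R v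
  labW : ∀ v, (Finset.univ.filter fun i => σ.LW i = some v).card ≤ σ.W a b v
  lab_iff : ∀ i, σ.LR i = none ↔ σ.LW i = none
  pairs : min (∑ v, σ.R v) (∑ v, σ.W a b v) ≤
    (Finset.univ.filter fun i => σ.LR i ≠ none).card

theorem ChamState.Valid.sum_W {a b n N : ℕ} {σ : ChamState n N} (h : σ.Valid a b) :
    ∑ v, σ.R v + ∑ v, σ.P v + ∑ v, σ.W a b v = N := by
  refine Eq.trans ?_ h.chi_sum
  rw [← Finset.sum_add_distrib, ← Finset.sum_add_distrib]
  refine Finset.sum_congr rfl fun v _ => ?_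
  have := h.le v
  simp only [ChamState.W]
  omega

theorem sum_edge {n : ℕ} {e : Fin n × Fin n} (he : e.1 ≠ e.2) (f : Fin n → ℕ) :
    ∑ v, f v = f e.1 + f e.2 + ∑ v ∈ (Finset.univ.erase e.1).erase e.2, f v := by
  rw [← Finset.add_sum_erase Finset.univ f (Finset.mem_univ e.1),
    ← Finset.add_sum_erase (Finset.univ.erase e.1) f (a := e.2) (by simp [he.symm]), add_assoc]

theorem sum_edge_congr {n : ℕ} {e : Fin n × Fin n} {f g : Fin n → ℕ}
    (h : ∀ u, u ≠ e.1 → u ≠ e.2 → f u = g u) :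
    ∑ v ∈ (Finset.univ.erase e.1).erase e.2, f v = ∑ v ∈ (Finset.univ.erase e.1).erase e.2, g v := by
  refine Finset.sum_congr rfl fun v hv => ?_
  simp only [Finset.mem_erase, Finset.mem_univ, and_true] at hv
  exact h v hv.2 hv.1

/-! ### Tokens -/

section Tokens

variable {n N : ℕ} {e : Fin n × Fin n} {L : Fin N → Option (Fin n)} {count : ℕ}

theorem inl_mem_tokens {i : Fin N} :
    Sum.inl i ∈ tokens e L count ↔ L i = some e.1 ∨ L i = some e.2 := by
  simp [tokens]

/-- Unlabelled particles are named by `Fin N` as well, so `count ≤ N` is what guarantees enough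
names. -/
theorem card_tokens (h1 : (Finset.univ.filter fun i => L i = some e.1 ∨ L i = some e.2).card ≤ count)
    (h2 : count ≤ N) : (tokens e L count).card = count := by
  classical
  have h : tokens e L count =
      (Finset.univ.filter fun i => L i = some e.1 ∨ L i = some e.2).disjSum
        (Finset.univ.filter fun j : Fin N => (j : ℕ) < count -
          (Finset.univ.filter fun i => L i = some e.1 ∨ L i = some e.2).card) := by
    ext p
    rcases p with i | j
    · simp [tokens]
    · simp only [tokens, Finset.mem_filter, Finset.mem_univ, true_and, Finset.inr_mem_disjSum]
  rw [h, Finset.card_disjSum, Fin.card_filter_val_lt]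
  omega

theorem card_filter_le_of_inl_mem {p : Fin N → Prop} [DecidablePred p] {T : Finset (Token N)}
    (h : ∀ i, p i → Sum.inl i ∈ T) : (Finset.univ.filter p).card ≤ T.card :=
  Finset.card_le_card_of_injOn Sum.inl (by intro i hi; simpa using h i (by simpa using hi))
    (fun _ _ _ _ h => Sum.inl_injective h)

theorem card_filter_or_le (h1 : (Finset.univ.filter fun i => L i = some e.1).card ≤ count)
    {count' : ℕ} (h2 : (Finset.univ.filter fun i => L i = some e.2).card ≤ count') :
    (Finset.univ.filter fun i => L i = some e.1 ∨ L i = some e.2).card ≤ count + count' := by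
  rw [Finset.filter_or]
  exact (Finset.card_union_le _ _).trans (add_le_add h1 h2)

end Tokens

/-! ### The choices made at a ring -/

section Ring

variable {n N : ℕ}

/-- The red particles on `e`. -/
abbrev redTokens (e : Fin n × Fin n) (σ : ChamState n N) : Finset (Token N) :=
  tokens e σ.LR (σ.R e.1 + σ.R e.2)

/-- The white particles on `e`. -/
abbrev whiteTokens (a b : ℕ) (e : Fin n × Fin n) (σ : ChamState n N) : Finset (Token N) :=
  tokens e σ.LW (σ.W a b e.1 + σ.W a b e.2)

open Classical in
/-- The red particles on `e` whose partner is also on `e`. -/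
def pairedTokens (a b : ℕ) (e : Fin n × Fin n) (σ : ChamState n N) : Finset (Token N) :=
  (redTokens e σ).filter fun p => ∃ i, p = Sum.inl i ∧ p ∈ whiteTokens a b e σ

/-- The largest number of pairs that may turn pink. -/
def pinkCap (a b : ℕ) (σ : ChamState n N) : ℕ :=
  ⌈(((min (∑ y, σ.R y) (∑ y, σ.W a b y) : ℕ) : ℚ) + ((∑ y, σ.P y : ℕ) : ℚ) / 2) / 3⌉₊
    - (∑ y, σ.P y) / 2

/-- The room for old pink particles on `e.1`. -/
def roomFst (a b : ℕ) (e : Fin n × Fin n) (B' : Fin n → ℕ) (Sv Y K : Finset (Token N)) : ℕ :=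
  chi a b (B' e.1) - (Sv.card + Y.card + K.card)

open Classical in
/-- The room for old pink particles on `e.2`. -/
def roomSnd (a b : ℕ) (e : Fin n × Fin n) (B' : Fin n → ℕ) (reds S Sv Y K : Finset (Token N)) : ℕ :=
  chi a b (B' e.2) - ((S \ Sv).card + (((reds \ S) \ K) \ Y).card + K.card)

/-- The number of old pink particles on `e.1` after the ring, when the target is `x`. -/
def pinkFst (Pe roomV roomW x : ℕ) : ℕ := max (Pe - roomW) (min (min roomV Pe) x)

open Classical in
/-- The state after a ring, in terms of the choices made. -/
def ringOut (e : Fin n × Fin n) (B' : Fin n → ℕ) (σ : ChamState n N)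
    (reds whites S Sv K Y Wv : Finset (Token N)) (pv : ℕ) : ChamState n N where
  B := B'
  R := fun y => if y = e.1 then Sv.card + Y.card
    else if y = e.2 then (S \ Sv).card + (((reds \ S) \ K) \ Y).card else σ.R y
  P := fun y => if y = e.1 then K.card + pv
    else if y = e.2 then K.card + (σ.P e.1 + σ.P e.2 - pv) else σ.P y
  LR := fun i => if Sum.inl i ∈ reds then
      (if Sum.inl i ∈ K then none
        else if Sum.inl i ∈ Sv ∪ Y then some e.1 else some e.2)
    else σ.LR i
  LW := fun i => if Sum.inl i ∈ whites then
      (if Sum.inl i ∈ K then none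
        else if Sum.inl i ∈ Wv then some e.1 else some e.2)
    else σ.LW i

theorem ite_bind {α β : Type*} (c : Prop) [Decidable c] (p q : PMF α) (f : α → PMF β) :
    (if c then p else q).bind f = if c then p.bind f else q.bind f := by
  split_ifs <;> rfl

open Classical in
theorem chamKernel_eq (a b : ℕ) (e : Fin n × Fin n) (B' : Fin n → ℕ) (σ : ChamState n N) :
    chamKernel a b e B' σ =
      (let cv := chi a b (B' e.1)
      let cw := chi a b (B' e.2)
      let Re := σ.R e.1 + σ.R e.2
      let Pe := σ.P e.1 + σ.P e.2
      let lv := redLow cw Re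
      let lw := Re - redUp cv Re
      let lP := pinkLow cw Re Pe
      let uP := pinkUp cv Re Pe
      let θ := theta a b e B' σ
      let reds := redTokens e σ
      let whites := whiteTokens a b e σ
      let paired := pairedTokens a b e σ
      (unif ((reds.powersetCard (lv + lw)).filter fun S =>
        S ⊆ reds \ paired ∨ reds \ paired ⊆ S) ∅).bind fun S =>
      (unif (S.powersetCard lv) ∅).bind fun Sv =>
      (coinFlip (2 * min θ (1 - θ))).bind fun fork =>
      (if fork then unif (((reds \ S) ∩ paired).powersetCard
        (min ((reds \ S) ∩ paired).card (pinkCap a b σ))) ∅ else PMF.pure ∅).bind fun K =>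
      (if fork then unif ((reds \ S) \ K).powerset ∅
        else PMF.pure (if θ < 1 / 2 then reds \ S else ∅)).bind fun Y =>
      (if lP ≤ uP then coinFlip θ else if fork then coinFlip (1 / 2)
        else PMF.pure (decide (¬ θ < 1 / 2))).bind fun low =>
      let pv := pinkFst Pe (roomFst a b e B' Sv Y K) (roomSnd a b e B' reds S Sv Y K)
        (if low then lP else uP)
      (unif ((whites \ K).powersetCard (roomFst a b e B' Sv Y K - pv)) ∅).bind fun Wv =>
      PMF.pure (ringOut e B' σ reds whites S Sv K Y Wv pv)) := by
  simp only [ite_bind]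
  rfl

end Ring

/-! ### One ring: capacities, conservation of particles, validity of the outcome. -/

section Ring

variable {a b n N : ℕ} {e : Fin n × Fin n} {B' : Fin n → ℕ} {σ : ChamState n N}

/-- The hypotheses under which a ring is analysed: the state is valid and the black particles make
a move that is possible. -/
structure RingSetup (a b : ℕ) (e : Fin n × Fin n) (B' : Fin n → ℕ) (σ : ChamState n N) : Prop where
  a_pos : 0 < a
  b_pos : 0 < b
  ne : e.1 ≠ e.2
  split : IsSplit e σ.B B'
  valid : σ.Valid a b

namespace RingSetup

/-- As `χ` is affine and the number of black particles on `e` is preserved, so is the number of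
places for non-black ones. -/
theorem edge_sum (h : RingSetup a b e B' σ) :
    chi a b (B' e.1) + chi a b (B' e.2) =
      (σ.R e.1 + σ.R e.2) + (σ.P e.1 + σ.P e.2) + (σ.W a b e.1 + σ.W a b e.2) := by
  have h1 := h.valid.le e.1
  have h2 := h.valid.le e.2
  have h3 : chi a b (B' e.1) + chi a b (B' e.2) = chi a b (σ.B e.1) + chi a b (σ.B e.2) := by
    have := h.split.2
    simp only [chi]
    have h4 : a * B' e.1 + a * B' e.2 = a * σ.B e.1 + a * σ.B e.2 := by rw [← mul_add, this, mul_add]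
    omega
  simp only [ChamState.W]
  omega

theorem chi_sum' (h : RingSetup a b e B' σ) : ∑ v, chi a b (B' v) = N := by
  have h1 := h.valid.chi_sum
  rw [sum_edge h.ne] at h1 ⊢
  have h4 := h.valid.le e.1
  have h5 := h.valid.le e.2
  have h2 := h.edge_sum
  have h3 := sum_edge_congr (e := e) (f := fun v => chi a b (B' v))
    (g := fun v => chi a b (σ.B v)) fun u h1 h2 => by rw [h.split.1 u h1 h2]
  simp only [ChamState.W] at h2
  omega

theorem edge_sum_le (h : RingSetup a b e B' σ) : chi a b (B' e.1) + chi a b (B' e.2) ≤ N := by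
  have := h.chi_sum'
  rw [sum_edge h.ne] at this
  omega

theorem chi_pos (h : RingSetup a b e B' σ) (v : Fin n) : 0 < chi a b (B' v) := by
  have := h.b_pos
  simp only [chi]
  omega

theorem card_reds (h : RingSetup a b e B' σ) : (redTokens e σ).card = σ.R e.1 + σ.R e.2 := by
  have h1 := h.edge_sum
  have h2 := h.edge_sum_le
  exact card_tokens (card_filter_or_le (h.valid.labR _) (h.valid.labR _)) (by omega)

theorem card_whites (h : RingSetup a b e B' σ) :
    (whiteTokens a b e σ).card = σ.W a b e.1 + σ.W a b e.2 := by
  have h1 := h.edge_sum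
  have h2 := h.edge_sum_le
  exact card_tokens (card_filter_or_le (h.valid.labW _) (h.valid.labW _)) (by omega)

theorem thetaSpec (h : RingSetup a b e B' σ) :
    ThetaSpec (theta a b e B' σ) (chi a b (B' e.1)) (chi a b (B' e.2)) (σ.R e.1 + σ.R e.2)
      (σ.P e.1 + σ.P e.2) := by
  have h1 := h.edge_sum
  have := BBSplit.thetaSpec (h.chi_pos e.1) (h.chi_pos e.2)
    (by omega : (σ.R e.1 + σ.R e.2) + (σ.P e.1 + σ.P e.2) ≤ _)
  convert this using 1
  rw [theta]
  congr 2
  rw [meanInk, markProb_eq_chi h.a_pos h.b_pos h.ne h.split (Or.inl rfl) (Or.inl rfl),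
    markProb_eq_chi h.a_pos h.b_pos h.ne h.split (Or.inr rfl) (Or.inl rfl), ChamState.ink,
    ChamState.ink]
  push_cast
  ring

end RingSetup

theorem pairedTokens_subset_reds : pairedTokens a b e σ ⊆ redTokens e σ :=
  Finset.filter_subset _ _

theorem pairedTokens_subset_whites : pairedTokens a b e σ ⊆ whiteTokens a b e σ := by
  intro p hp
  obtain ⟨_, i, _, h⟩ := Finset.mem_filter.1 hp
  exact h

/-- Choices for the red particles at a ring that have positive probability. -/
structure RedChoice (a b : ℕ) (e : Fin n × Fin n) (B' : Fin n → ℕ) (σ : ChamState n N)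
    (S Sv K Y : Finset (Token N)) : Prop where
  S_sub : S ⊆ redTokens e σ
  S_card : S.card = redLow (chi a b (B' e.2)) (σ.R e.1 + σ.R e.2) +
    (σ.R e.1 + σ.R e.2 - redUp (chi a b (B' e.1)) (σ.R e.1 + σ.R e.2))
  Sv_sub : Sv ⊆ S
  Sv_card : Sv.card = redLow (chi a b (B' e.2)) (σ.R e.1 + σ.R e.2)
  K_sub : K ⊆ (redTokens e σ \ S) ∩ pairedTokens a b e σ
  Y_sub : Y ⊆ (redTokens e σ \ S) \ K

/-- Choices for the old pink and the white particles at a ring that have positive probability. -/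
structure WhiteChoice (a b : ℕ) (e : Fin n × Fin n) (B' : Fin n → ℕ) (σ : ChamState n N)
    (S Sv K Y Wv : Finset (Token N)) (pv : ℕ) : Prop where
  le_pv : σ.P e.1 + σ.P e.2 - roomSnd a b e B' (redTokens e σ) S Sv Y K ≤ pv
  pv_le : pv ≤ σ.P e.1 + σ.P e.2
  pv_le_room : pv ≤ roomFst a b e B' Sv Y K
  Wv_sub : Wv ⊆ whiteTokens a b e σ \ K
  Wv_card : Wv.card = roomFst a b e B' Sv Y K - pv

variable {S Sv K Y Wv : Finset (Token N)} {pv : ℕ}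

theorem RedChoice.card_sdiff (c : RedChoice a b e B' σ S Sv K Y) :
    (S \ Sv).card = σ.R e.1 + σ.R e.2 - redUp (chi a b (B' e.1)) (σ.R e.1 + σ.R e.2) := by
  have := Finset.card_sdiff_add_card_eq_card c.Sv_sub
  have h1 := c.S_card
  have h2 := c.Sv_card
  omega

theorem RedChoice.K_sub_whites (c : RedChoice a b e B' σ S Sv K Y) : K ⊆ whiteTokens a b e σ :=
  (c.K_sub.trans Finset.inter_subset_right).trans pairedTokens_subset_whites

theorem RedChoice.K_sub_reds (c : RedChoice a b e B' σ S Sv K Y) : K ⊆ redTokens e σ :=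
  (c.K_sub.trans Finset.inter_subset_right).trans pairedTokens_subset_reds

section RedChoice

variable (h : RingSetup a b e B' σ) (c : RedChoice a b e B' σ S Sv K Y)
include h c

/-- The numbers of red particles involved. -/
theorem RedChoice.card_rest :
    (((redTokens e σ \ S) \ K) \ Y).card + Y.card + K.card + S.card = σ.R e.1 + σ.R e.2 := by
  have h1 : K ⊆ redTokens e σ \ S := c.K_sub.trans Finset.inter_subset_left
  rw [Finset.card_sdiff_add_card_eq_card c.Y_sub, Finset.card_sdiff_add_card_eq_card h1,
    Finset.card_sdiff_add_card_eq_card c.S_sub, h.card_reds]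

theorem RedChoice.card_whites_sdiff :
    (whiteTokens a b e σ \ K).card + K.card = σ.W a b e.1 + σ.W a b e.2 := by
  rw [Finset.card_sdiff_add_card_eq_card (c.K_sub_whites), h.card_whites]

/-- The truncated subtraction in `roomFst` is a true one: the lower reds of `v` together with the
whole pool number `u(v) ≤ χ(B'(v))`, so `v` has room whichever part of the pool it receives. -/
theorem RedChoice.room_fst :
    roomFst a b e B' Sv Y K + (Sv.card + Y.card + K.card) = chi a b (B' e.1) := by
  have h1 := c.card_rest h
  have h2 := c.S_card
  have h3 := c.Sv_card
  have h4 := h.edge_sum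
  simp only [roomFst, redUp, redLow] at *
  omega

theorem RedChoice.room_snd :
    roomSnd a b e B' (redTokens e σ) S Sv Y K +
      ((S \ Sv).card + (((redTokens e σ \ S) \ K) \ Y).card + K.card) = chi a b (B' e.2) := by
  have h1 := c.card_rest h
  have h2 := c.S_card
  have h3 := c.card_sdiff
  have h4 := h.edge_sum
  simp only [roomSnd, redUp, redLow] at *
  omega

/-- The two rooms together. -/
theorem RedChoice.room_add :
    roomFst a b e B' Sv Y K + roomSnd a b e B' (redTokens e σ) S Sv Y K =
      (σ.P e.1 + σ.P e.2) + (whiteTokens a b e σ \ K).card := by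
  have h1 := c.card_rest h
  have h2 := c.S_card
  have h3 := c.card_sdiff
  have h4 := h.edge_sum
  have h5 := c.room_fst h
  have h6 := c.room_snd h
  have h7 := c.card_whites_sdiff h
  have h8 := c.Sv_card
  omega

/-- The clamped number of old pinks is feasible for any target `x`: neither end overflows, and
enough white particles remain to fill `v`. This follows from `room_add`, since the two rooms
together hold exactly the old pinks and the remaining whites. -/
theorem RedChoice.pinkFst_spec (x : ℕ) :
    σ.P e.1 + σ.P e.2 - roomSnd a b e B' (redTokens e σ) S Sv Y K ≤
        pinkFst (σ.P e.1 + σ.P e.2) (roomFst a b e B' Sv Y K)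
          (roomSnd a b e B' (redTokens e σ) S Sv Y K) x ∧
      pinkFst (σ.P e.1 + σ.P e.2) (roomFst a b e B' Sv Y K)
          (roomSnd a b e B' (redTokens e σ) S Sv Y K) x ≤ σ.P e.1 + σ.P e.2 ∧
      pinkFst (σ.P e.1 + σ.P e.2) (roomFst a b e B' Sv Y K)
          (roomSnd a b e B' (redTokens e σ) S Sv Y K) x ≤ roomFst a b e B' Sv Y K ∧
      roomFst a b e B' Sv Y K - pinkFst (σ.P e.1 + σ.P e.2) (roomFst a b e B' Sv Y K)
          (roomSnd a b e B' (redTokens e σ) S Sv Y K) x ≤ (whiteTokens a b e σ \ K).card := by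
  have := c.room_add h
  simp only [pinkFst]
  omega

end RedChoice

section Outcome

variable (h : RingSetup a b e B' σ) (c : RedChoice a b e B' σ S Sv K Y)
  (d : WhiteChoice a b e B' σ S Sv K Y Wv pv)

/-- The state after a ring. -/
abbrev ringResult (a b : ℕ) (e : Fin n × Fin n) (B' : Fin n → ℕ) (σ : ChamState n N)
    (S Sv K Y Wv : Finset (Token N)) (pv : ℕ) : ChamState n N :=
  ringOut e B' σ (redTokens e σ) (whiteTokens a b e σ) S Sv K Y Wv pv

theorem ringOut_R_fst : (ringResult a b e B' σ S Sv K Y Wv pv).R e.1 = Sv.card + Y.card := by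
  simp [ringOut]

include h in
theorem ringOut_R_snd : (ringResult a b e B' σ S Sv K Y Wv pv).R e.2 =
    (S \ Sv).card + (((redTokens e σ \ S) \ K) \ Y).card := by
  simp [ringOut, h.ne.symm]

theorem ringOut_P_fst : (ringResult a b e B' σ S Sv K Y Wv pv).P e.1 = K.card + pv := by
  simp [ringOut]

include h in
theorem ringOut_P_snd : (ringResult a b e B' σ S Sv K Y Wv pv).P e.2 =
    K.card + (σ.P e.1 + σ.P e.2 - pv) := by
  simp [ringOut, h.ne.symm]

theorem ringOut_R_of_ne {u : Fin n} (h1 : u ≠ e.1) (h2 : u ≠ e.2) :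
    (ringResult a b e B' σ S Sv K Y Wv pv).R u = σ.R u := by
  simp [ringOut, h1, h2]

theorem ringOut_P_of_ne {u : Fin n} (h1 : u ≠ e.1) (h2 : u ≠ e.2) :
    (ringResult a b e B' σ S Sv K Y Wv pv).P u = σ.P u := by
  simp [ringOut, h1, h2]

include h c in
theorem RedChoice.sum_R :
    ∑ v, (ringResult a b e B' σ S Sv K Y Wv pv).R v + K.card = ∑ v, σ.R v := by
  rw [sum_edge h.ne, sum_edge h.ne σ.R, ringOut_R_fst, ringOut_R_snd h,
    sum_edge_congr fun u h1 h2 => ringOut_R_of_ne h1 h2]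
  have h1 := c.card_rest h
  have h2 := Finset.card_sdiff_add_card_eq_card c.Sv_sub
  omega

include h d in
theorem WhiteChoice.sum_P :
    ∑ v, (ringResult a b e B' σ S Sv K Y Wv pv).P v = ∑ v, σ.P v + 2 * K.card := by
  rw [sum_edge h.ne, sum_edge h.ne σ.P, ringOut_P_fst, ringOut_P_snd h,
    sum_edge_congr fun u h1 h2 => ringOut_P_of_ne h1 h2]
  have h1 := d.pv_le
  omega

include h c d in
theorem ringOut_le (v : Fin n) : (ringResult a b e B' σ S Sv K Y Wv pv).R v +
    (ringResult a b e B' σ S Sv K Y Wv pv).P v ≤ chi a b (B' v) := by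
  have h1 := c.room_fst h
  have h2 := c.room_snd h
  have h3 := d.pv_le_room
  have h4 := d.le_pv
  by_cases hv : v = e.1
  · subst hv
    rw [ringOut_R_fst, ringOut_P_fst]
    omega
  by_cases hw : v = e.2
  · subst hw
    rw [ringOut_R_snd h, ringOut_P_snd h]
    omega
  rw [ringOut_R_of_ne hv hw, ringOut_P_of_ne hv hw, h.split.1 v hv hw]
  exact h.valid.le v

include h c d in
theorem RedChoice.sum_W :
    ∑ v, (ringResult a b e B' σ S Sv K Y Wv pv).W a b v + K.card = ∑ v, σ.W a b v := by
  have h1 := h.valid.sum_W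
  have h2 := c.sum_R h (Wv := Wv) (pv := pv)
  have h3 := d.sum_P h
  have h4 : ∑ v, (ringResult a b e B' σ S Sv K Y Wv pv).R v +
      ∑ v, (ringResult a b e B' σ S Sv K Y Wv pv).P v +
      ∑ v, (ringResult a b e B' σ S Sv K Y Wv pv).W a b v = N := by
    refine Eq.trans ?_ h.chi_sum'
    rw [← Finset.sum_add_distrib, ← Finset.sum_add_distrib]
    refine Finset.sum_congr rfl fun v _ => ?_
    have := ringOut_le h c d v
    simp only [ChamState.W]
    change _ + (chi a b (B' v) - _ - _) = _
    omega
  have h5 : K.card ≤ ∑ v, σ.W a b v := by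
    have h6 := c.card_whites_sdiff h
    have h7 := sum_edge h.ne (σ.W a b)
    omega
  omega

include c in
theorem ringOut_LR_eq_none (i : Fin N) : (ringResult a b e B' σ S Sv K Y Wv pv).LR i = none ↔
    Sum.inl i ∈ K ∨ σ.LR i = none := by
  have hK := c.K_sub_reds
  have hr := inl_mem_tokens (e := e) (L := σ.LR) (count := σ.R e.1 + σ.R e.2) (i := i)
  simp only [ringOut]
  by_cases h1 : Sum.inl i ∈ redTokens e σ
  · rw [if_pos h1]
    have h3 := hr.1 h1
    by_cases h2 : Sum.inl i ∈ K
    · simp [h2]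
    · rw [if_neg h2]
      split_ifs <;> rcases h3 with h3 | h3 <;> simp [h2, h3]
  · rw [if_neg h1]
    have : Sum.inl i ∉ K := fun h => h1 (hK h)
    simp [this]

include c in
theorem ringOut_LW_eq_none (i : Fin N) : (ringResult a b e B' σ S Sv K Y Wv pv).LW i = none ↔
    Sum.inl i ∈ K ∨ σ.LW i = none := by
  have hK := c.K_sub_whites
  have hr := inl_mem_tokens (e := e) (L := σ.LW) (count := σ.W a b e.1 + σ.W a b e.2) (i := i)
  simp only [ringOut]
  by_cases h1 : Sum.inl i ∈ whiteTokens a b e σ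
  · rw [if_pos h1]
    have h3 := hr.1 h1
    by_cases h2 : Sum.inl i ∈ K
    · simp [h2]
    · rw [if_neg h2]
      split_ifs <;> rcases h3 with h3 | h3 <;> simp [h2, h3]
  · rw [if_neg h1]
    have : Sum.inl i ∉ K := fun h => h1 (hK h)
    simp [this]

include h c d in
theorem valid_ringOut : (ringResult a b e B' σ S Sv K Y Wv pv).Valid a b := by
  have hne := h.ne
  have hr : ∀ i, Sum.inl i ∈ redTokens e σ ↔ σ.LR i = some e.1 ∨ σ.LR i = some e.2 :=
    fun i => inl_mem_tokens
  have hw : ∀ i, Sum.inl i ∈ whiteTokens a b e σ ↔ σ.LW i = some e.1 ∨ σ.LW i = some e.2 :=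
    fun i => inl_mem_tokens
  constructor
  · exact h.chi_sum'
  · exact ringOut_le h c d
  · intro v
    by_cases hv : v = e.1
    · subst hv
      rw [ringOut_R_fst]
      refine le_trans (card_filter_le_of_inl_mem (T := Sv ∪ Y) fun i hi => ?_)
        (Finset.card_union_le _ _)
      simp only [ringOut] at hi
      split_ifs at hi with h1 h2 h3
      · exact h3
      · simp [hne.symm] at hi
      · rw [hr] at h1
        tauto
    by_cases hv2 : v = e.2
    · subst hv2
      rw [ringOut_R_snd h]
      refine le_trans (card_filter_le_of_inl_mem
        (T := (S \ Sv) ∪ (((redTokens e σ \ S) \ K) \ Y)) fun i hi => ?_)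
        (Finset.card_union_le _ _)
      simp only [ringOut] at hi
      split_ifs at hi with h1 h2 h3
      · simp [hne] at hi
      · simp only [Finset.mem_union, Finset.mem_sdiff] at h3 ⊢
        tauto
      · rw [hr] at h1
        tauto
    · rw [ringOut_R_of_ne hv hv2]
      refine le_trans (Finset.card_le_card fun i hi => ?_) (h.valid.labR v)
      simp only [Finset.mem_filter, Finset.mem_univ, true_and, ringOut] at hi ⊢
      split_ifs at hi with h1 h2 h3
      · exact absurd (Option.some_injective _ hi).symm hv
      · exact absurd (Option.some_injective _ hi).symm hv2
      · exact hi
  · have e1 := c.room_fst h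
    have e2 := c.room_snd h
    have e3 := c.room_add h
    intro v
    by_cases hv : v = e.1
    · subst hv
      refine le_trans (card_filter_le_of_inl_mem (T := Wv) fun i hi => ?_) ?_
      · simp only [ringOut] at hi
        split_ifs at hi with h1 h2 h3
        · exact h3
        · simp [hne.symm] at hi
        · rw [hw] at h1
          tauto
      · rw [ChamState.W, ringOut_R_fst, ringOut_P_fst, d.Wv_card]
        change _ ≤ chi a b (B' e.1) - _ - _
        omega
    by_cases hv2 : v = e.2
    · subst hv2
      refine le_trans (card_filter_le_of_inl_mem
        (T := (whiteTokens a b e σ \ K) \ Wv) fun i hi => ?_) ?_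
      · simp only [ringOut] at hi
        split_ifs at hi with h1 h2 h3
        · simp [hne] at hi
        · simp only [Finset.mem_sdiff]
          tauto
        · rw [hw] at h1
          tauto
      · rw [ChamState.W, ringOut_R_snd h, ringOut_P_snd h]
        change _ ≤ chi a b (B' e.2) - _ - _
        have e4 := Finset.card_sdiff_add_card_eq_card d.Wv_sub
        have e5 := d.Wv_card
        have e6 := d.le_pv
        have e7 := d.pv_le_room
        have e8 := d.pv_le
        omega
    · rw [ChamState.W, ringOut_R_of_ne hv hv2, ringOut_P_of_ne hv hv2]
      change _ ≤ chi a b (B' v) - _ - _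
      rw [h.split.1 v hv hv2]
      refine le_trans (Finset.card_le_card fun i hi => ?_) (h.valid.labW v)
      simp only [Finset.mem_filter, Finset.mem_univ, true_and, ringOut] at hi ⊢
      split_ifs at hi with h1 h2 h3
      · exact absurd (Option.some_injective _ hi).symm hv
      · exact absurd (Option.some_injective _ hi).symm hv2
      · exact hi
  · intro i
    rw [ringOut_LR_eq_none c, ringOut_LW_eq_none c, h.valid.lab_iff]
  -- The smaller of the red and white totals drops by exactly `K.card`, and the number of labels by
  -- at most that.
  · have h1 := c.sum_R h (Wv := Wv) (pv := pv)
    have h2 := c.sum_W h d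
    have h3 := h.valid.pairs
    have h4 : (Finset.univ.filter fun i => σ.LR i ≠ none).card ≤
        (Finset.univ.filter fun i => (ringResult a b e B' σ S Sv K Y Wv pv).LR i ≠ none).card +
          K.card := by
      have h5 : (Finset.univ.filter fun i : Fin N => Sum.inl i ∈ K).card ≤ K.card :=
        card_filter_le_of_inl_mem fun i hi => hi
      refine le_trans ?_ (Nat.add_le_add_left h5 _)
      refine le_trans (Finset.card_le_card fun i hi => ?_) (Finset.card_union_le _ _)
      simp only [Finset.mem_union, Finset.mem_filter, Finset.mem_univ, true_and, ne_eq,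
        ringOut_LR_eq_none c] at hi ⊢
      tauto
    omega

end Outcome

end Ring

/-! ### The law of one ring and its support. -/

section Ring

variable {a b n N : ℕ} {e : Fin n × Fin n} {B' : Fin n → ℕ} {σ : ChamState n N}

theorem finite_support_bind {α β : Type*} {p : PMF α} {q : α → PMF β} (hp : p.support.Finite)
    (hq : ∀ x, (q x).support.Finite) : (p.bind q).support.Finite := by
  rw [PMF.support_bind]
  exact hp.biUnion fun x _ => hq x

theorem finite_support_pure {α : Type*} (x : α) : (PMF.pure x).support.Finite := by
  rw [PMF.support_pure]
  exact Set.finite_singleton x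

/-- `samplePMF` realises a law only when its support is finite; otherwise it returns a fixed value.
-/
theorem finite_support_chamKernel (a b : ℕ) (e : Fin n × Fin n) (B' : Fin n → ℕ)
    (σ : ChamState n N) : (chamKernel a b e B' σ).support.Finite := by
  rw [chamKernel_eq]
  refine finite_support_bind (finite_support_unif _ _) fun S => ?_
  refine finite_support_bind (finite_support_unif _ _) fun Sv => ?_
  refine finite_support_bind (Set.toFinite _) fun fork => ?_
  refine finite_support_bind ?_ fun K => ?_
  · split_ifs
    exacts [finite_support_unif _ _, finite_support_pure _]
  refine finite_support_bind ?_ fun Y => ?_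
  · split_ifs
    exacts [finite_support_unif _ _, finite_support_pure _, finite_support_pure _]
  refine finite_support_bind (Set.toFinite _) fun low => ?_
  exact finite_support_bind (finite_support_unif _ _) fun Wv => finite_support_pure _

/-- The part of a ring after the red particles of the first step have been chosen. -/
def afterLower (a b : ℕ) (e : Fin n × Fin n) (B' : Fin n → ℕ) (σ : ChamState n N)
    (S Sv : Finset (Token N)) (fork : Bool) (K Y : Finset (Token N)) : PMF (ChamState n N) :=
  let lP := pinkLow (chi a b (B' e.2)) (σ.R e.1 + σ.R e.2) (σ.P e.1 + σ.P e.2)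
  let uP := pinkUp (chi a b (B' e.1)) (σ.R e.1 + σ.R e.2) (σ.P e.1 + σ.P e.2)
  let θ := theta a b e B' σ
  (if lP ≤ uP then coinFlip θ else if fork then coinFlip (1 / 2)
    else PMF.pure (decide (¬ θ < 1 / 2))).bind fun low =>
  let pv := pinkFst (σ.P e.1 + σ.P e.2) (roomFst a b e B' Sv Y K)
    (roomSnd a b e B' (redTokens e σ) S Sv Y K) (if low then lP else uP)
  (unif ((whiteTokens a b e σ \ K).powersetCard (roomFst a b e B' Sv Y K - pv)) ∅).bind fun Wv =>
    PMF.pure (ringResult a b e B' σ S Sv K Y Wv pv)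

/-- The possible sets `S` in the first step of a ring. -/
def lowerSets (a b : ℕ) (e : Fin n × Fin n) (B' : Fin n → ℕ) (σ : ChamState n N) :
    Finset (Finset (Token N)) :=
  ((redTokens e σ).powersetCard (redLow (chi a b (B' e.2)) (σ.R e.1 + σ.R e.2) +
    (σ.R e.1 + σ.R e.2 - redUp (chi a b (B' e.1)) (σ.R e.1 + σ.R e.2)))).filter fun S =>
      S ⊆ redTokens e σ \ pairedTokens a b e σ ∨ redTokens e σ \ pairedTokens a b e σ ⊆ S

/-- The law of the set of pairs that turn pink. -/
def pinkLaw (a b : ℕ) (e : Fin n × Fin n) (σ : ChamState n N) (S : Finset (Token N))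
    (fork : Bool) : PMF (Finset (Token N)) :=
  if fork then unif (((redTokens e σ \ S) ∩ pairedTokens a b e σ).powersetCard
    (min ((redTokens e σ \ S) ∩ pairedTokens a b e σ).card (pinkCap a b σ))) ∅ else PMF.pure ∅

/-- The law of the set of upper red particles that go to `e.1`. -/
def upperLaw (e : Fin n × Fin n) (σ : ChamState n N) (θ : ℝ) (S : Finset (Token N))
    (fork : Bool) (K : Finset (Token N)) : PMF (Finset (Token N)) :=
  if fork then unif ((redTokens e σ \ S) \ K).powerset ∅
    else PMF.pure (if θ < 1 / 2 then redTokens e σ \ S else ∅)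

theorem chamKernel_eq_bind (a b : ℕ) (e : Fin n × Fin n) (B' : Fin n → ℕ) (σ : ChamState n N) :
    chamKernel a b e B' σ =
      (unif (lowerSets a b e B' σ) ∅).bind fun S =>
      (unif (S.powersetCard (redLow (chi a b (B' e.2)) (σ.R e.1 + σ.R e.2))) ∅).bind fun Sv =>
      (coinFlip (2 * min (theta a b e B' σ) (1 - theta a b e B' σ))).bind fun fork =>
      (pinkLaw a b e σ S fork).bind fun K =>
      (upperLaw e σ (theta a b e B' σ) S fork K).bind fun Y =>
      afterLower a b e B' σ S Sv fork K Y := by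
  rw [chamKernel_eq]
  simp only [lowerSets, pinkLaw, upperLaw, afterLower]

theorem RingSetup.lower_le (h : RingSetup a b e B' σ) :
    redLow (chi a b (B' e.2)) (σ.R e.1 + σ.R e.2) +
      (σ.R e.1 + σ.R e.2 - redUp (chi a b (B' e.1)) (σ.R e.1 + σ.R e.2)) ≤ σ.R e.1 + σ.R e.2 := by
  have := h.edge_sum
  simp only [redLow, redUp]
  omega

/-- Needed so that `unif` does not fall back on its default `∅`. If the unpaired reds suffice, the
set is chosen among them; otherwise they are extended by paired ones. -/
theorem RingSetup.lowerSets_nonempty (h : RingSetup a b e B' σ) :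
    (lowerSets a b e B' σ).Nonempty := by
  have h1 := h.lower_le.trans_eq h.card_reds.symm
  rcases le_total (redLow (chi a b (B' e.2)) (σ.R e.1 + σ.R e.2) +
      (σ.R e.1 + σ.R e.2 - redUp (chi a b (B' e.1)) (σ.R e.1 + σ.R e.2)))
      (redTokens e σ \ pairedTokens a b e σ).card with h2 | h2
  · obtain ⟨S, hS, hc⟩ := Finset.exists_subset_card_eq h2
    refine ⟨S, Finset.mem_filter.2 ⟨Finset.mem_powersetCard.2 ⟨?_, hc⟩, Or.inl hS⟩⟩
    exact hS.trans Finset.sdiff_subset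
  · obtain ⟨S, hS1, hS2, hc⟩ := Finset.exists_subsuperset_card_eq Finset.sdiff_subset h2 h1
    exact ⟨S, Finset.mem_filter.2 ⟨Finset.mem_powersetCard.2 ⟨hS2, hc⟩, Or.inr hS1⟩⟩

theorem lower_subset {S : Finset (Token N)} (hS : S ∈ lowerSets a b e B' σ) :
    S ⊆ redTokens e σ := (Finset.mem_powersetCard.1 (Finset.mem_filter.1 hS).1).1

theorem lower_card {S : Finset (Token N)} (hS : S ∈ lowerSets a b e B' σ) :
    S.card = redLow (chi a b (B' e.2)) (σ.R e.1 + σ.R e.2) +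
      (σ.R e.1 + σ.R e.2 - redUp (chi a b (B' e.1)) (σ.R e.1 + σ.R e.2)) :=
  (Finset.mem_powersetCard.1 (Finset.mem_filter.1 hS).1).2

theorem lowerFst_nonempty {S : Finset (Token N)} (hS : S ∈ lowerSets a b e B' σ) :
    (S.powersetCard (redLow (chi a b (B' e.2)) (σ.R e.1 + σ.R e.2))).Nonempty := by
  rw [Finset.powersetCard_nonempty, lower_card hS]
  omega

variable {S Sv K Y : Finset (Token N)} {fork : Bool} {θ : ℝ}

theorem pinkLaw_subset (hK : K ∈ (pinkLaw a b e σ S fork).support) :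
    K ⊆ (redTokens e σ \ S) ∩ pairedTokens a b e σ := by
  rw [pinkLaw] at hK
  split_ifs at hK
  · have := unif_mem (Finset.powersetCard_nonempty.2 (min_le_left _ _)) hK
    exact (Finset.mem_powersetCard.1 this).1
  · rw [PMF.support_pure, Set.mem_singleton_iff] at hK
    simp [hK]

theorem pinkLaw_false (hK : K ∈ (pinkLaw a b e σ S false).support) : K = ∅ := by
  simpa [pinkLaw] using hK

theorem upperLaw_subset (hK : K ∈ (pinkLaw a b e σ S fork).support)
    (hY : Y ∈ (upperLaw e σ θ S fork K).support) : Y ⊆ (redTokens e σ \ S) \ K := by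
  rw [upperLaw] at hY
  split_ifs at hY with h1 h2
  · exact Finset.mem_powerset.1 (unif_mem (Finset.powerset_nonempty _) hY)
  · rw [PMF.support_pure, Set.mem_singleton_iff] at hY
    -- Without Step 3a no pair turns pink, so the whole pool is also the pool without `K`.
    rw [Bool.not_eq_true] at h1
    rw [h1] at hK
    simp [hY, pinkLaw_false hK]
  · rw [PMF.support_pure, Set.mem_singleton_iff] at hY
    simp [hY]

theorem redChoice (hS : S ∈ lowerSets a b e B' σ)
    (hSv : Sv ∈ S.powersetCard (redLow (chi a b (B' e.2)) (σ.R e.1 + σ.R e.2)))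
    (hK : K ∈ (pinkLaw a b e σ S fork).support)
    (hY : Y ∈ (upperLaw e σ θ S fork K).support) : RedChoice a b e B' σ S Sv K Y where
  S_sub := lower_subset hS
  S_card := lower_card hS
  Sv_sub := (Finset.mem_powersetCard.1 hSv).1
  Sv_card := (Finset.mem_powersetCard.1 hSv).2
  K_sub := pinkLaw_subset hK
  Y_sub := upperLaw_subset hK hY

theorem RedChoice.whites_nonempty (h : RingSetup a b e B' σ) (c : RedChoice a b e B' σ S Sv K Y)
    (x : ℕ) : ((whiteTokens a b e σ \ K).powersetCard (roomFst a b e B' Sv Y K -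
      pinkFst (σ.P e.1 + σ.P e.2) (roomFst a b e B' Sv Y K)
        (roomSnd a b e B' (redTokens e σ) S Sv Y K) x)).Nonempty :=
  Finset.powersetCard_nonempty.2 (c.pinkFst_spec h x).2.2.2

theorem RedChoice.whiteChoice (h : RingSetup a b e B' σ) (c : RedChoice a b e B' σ S Sv K Y)
    (x : ℕ) {Wv : Finset (Token N)}
    (hW : Wv ∈ (whiteTokens a b e σ \ K).powersetCard (roomFst a b e B' Sv Y K -
      pinkFst (σ.P e.1 + σ.P e.2) (roomFst a b e B' Sv Y K)
        (roomSnd a b e B' (redTokens e σ) S Sv Y K) x)) :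
    WhiteChoice a b e B' σ S Sv K Y Wv (pinkFst (σ.P e.1 + σ.P e.2) (roomFst a b e B' Sv Y K)
        (roomSnd a b e B' (redTokens e σ) S Sv Y K) x) := by
  obtain ⟨h1, h2, h3, h4⟩ := c.pinkFst_spec h x
  rw [Finset.mem_powersetCard] at hW
  exact ⟨h1, h2, h3, hW.1, hW.2⟩

/-- Every possible outcome of a ring comes from possible choices. -/
theorem exists_choice (h : RingSetup a b e B' σ) {σ' : ChamState n N}
    (hσ' : σ' ∈ (chamKernel a b e B' σ).support) :
    ∃ S Sv K Y Wv pv, RedChoice a b e B' σ S Sv K Y ∧ WhiteChoice a b e B' σ S Sv K Y Wv pv ∧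
      σ' = ringResult a b e B' σ S Sv K Y Wv pv := by
  rw [chamKernel_eq_bind] at hσ'
  simp only [PMF.mem_support_bind_iff, afterLower] at hσ'
  obtain ⟨S, hS, Sv, hSv, fork, -, K, hK, Y, hY, low, -, Wv, hWv, hout⟩ := hσ'
  have hS' := unif_mem h.lowerSets_nonempty hS
  have hSv' := unif_mem (lowerFst_nonempty hS') hSv
  have c := redChoice hS' hSv' hK hY
  refine ⟨S, Sv, K, Y, Wv, _, c, c.whiteChoice h _ (unif_mem (c.whites_nonempty h _) hWv), ?_⟩
  simpa using hout

/-- What a ring preserves, and how it changes the totals. -/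
structure RingStep (a b : ℕ) (B' : Fin n → ℕ) (σ σ' : ChamState n N) : Prop where
  valid : σ'.Valid a b
  black : σ'.B = B'
  totals : ∃ k, ∑ v, σ'.R v + k = ∑ v, σ.R v ∧ ∑ v, σ'.P v = ∑ v, σ.P v + 2 * k ∧
    ∑ v, σ'.W a b v + k = ∑ v, σ.W a b v

theorem ringStep (h : RingSetup a b e B' σ) {σ' : ChamState n N}
    (hσ' : σ' ∈ (chamKernel a b e B' σ).support) : RingStep a b B' σ σ' := by
  obtain ⟨S, Sv, K, Y, Wv, pv, c, d, rfl⟩ := exists_choice h hσ'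
  exact ⟨valid_ringOut h c d, rfl, K.card, c.sum_R h, d.sum_P h, c.sum_W h d⟩

end Ring

/-! ### The mean ink after one ring. -/

theorem pmfMean_coinFlip_ofReal {p : ℝ} (h0 : 0 ≤ p) (h1 : p ≤ 1) {g : Bool → ℝ}
    (hg : ∀ c, 0 ≤ g c) : pmfMean (coinFlip p) (fun c => ENNReal.ofReal (g c)) =
      ENNReal.ofReal (p * g true + (1 - p) * g false) := by
  rw [pmfMean_coinFlip h0 h1, ← ENNReal.ofReal_mul h0, ← ENNReal.ofReal_mul (by linarith),
    ← ENNReal.ofReal_add (mul_nonneg h0 (hg _)) (mul_nonneg (by linarith) (hg _))]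

/-- The mean of a function that is balanced by an involution of the underlying set. -/
theorem pmfMean_unif_of_balanced {α : Type*} {S : Finset α} (hS : S.Nonempty) (d : α)
    {f : α → ENNReal} (φ : α → α) (hφ : ∀ x ∈ S, φ x ∈ S) (hφφ : ∀ x ∈ S, φ (φ x) = x)
    {c : ENNReal} (hc : ∀ x ∈ S, f x + f (φ x) = 2 * c) : pmfMean (unif S d) f = c := by
  have h1 := pmfMean_unif_comp hS d f φ hφ hφφ
  have h2 : pmfMean (unif S d) (fun x => f x + f (φ x)) = 2 * c :=
    pmfMean_of_const fun x hx => hc x (unif_mem hS hx)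
  rw [pmfMean_add, h1, ← two_mul] at h2
  exact (ENNReal.mul_right_inj (by simp) (by simp)).1 h2

section Ring

variable {a b n N : ℕ} {e : Fin n × Fin n} {B' : Fin n → ℕ} {σ : ChamState n N}
  {S Sv K Y : Finset (Token N)} {fork : Bool}

/-- Twice the ink at `v`. -/
def ChamState.twoInk (σ : ChamState n N) (v : Fin n) : ℕ := 2 * σ.R v + σ.P v

/-- Twice the ink on `e.1` after a ring, when `low` says which target is chosen for the old pink
particles. -/
def outInk (a b : ℕ) (e : Fin n × Fin n) (B' : Fin n → ℕ) (σ : ChamState n N)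
    (S Sv K Y : Finset (Token N)) (low : Bool) : ℕ :=
  2 * (Sv.card + Y.card) + K.card +
    pinkFst (σ.P e.1 + σ.P e.2) (roomFst a b e B' Sv Y K)
      (roomSnd a b e B' (redTokens e σ) S Sv Y K)
      (if low then pinkLow (chi a b (B' e.2)) (σ.R e.1 + σ.R e.2) (σ.P e.1 + σ.P e.2)
        else pinkUp (chi a b (B' e.1)) (σ.R e.1 + σ.R e.2) (σ.P e.1 + σ.P e.2))

/-- The choice of white particles does not affect the ink; only the target for the old pinks remains
random. -/
theorem mean_afterLower (S Sv : Finset (Token N)) (fork : Bool) (K Y : Finset (Token N)) :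
    pmfMean (afterLower a b e B' σ S Sv fork K Y) (fun τ => ENNReal.ofReal (τ.twoInk e.1)) =
      pmfMean (if pinkLow (chi a b (B' e.2)) (σ.R e.1 + σ.R e.2) (σ.P e.1 + σ.P e.2) ≤
          pinkUp (chi a b (B' e.1)) (σ.R e.1 + σ.R e.2) (σ.P e.1 + σ.P e.2)
        then coinFlip (theta a b e B' σ) else if fork then coinFlip (1 / 2)
        else PMF.pure (decide (¬ theta a b e B' σ < 1 / 2)))
        (fun low => ENNReal.ofReal (outInk a b e B' σ S Sv K Y low)) := by
  rw [afterLower, pmfMean_bind]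
  refine pmfMean_congr fun low _ => ?_
  rw [pmfMean_bind]
  refine pmfMean_of_const fun Wv _ => ?_
  rw [pmfMean_pure, ChamState.twoInk, ringOut_R_fst, ringOut_P_fst, outInk]
  congr 2
  ring

/-- The set of upper red particles that go to `e.2`, as a choice of those that go to `e.1`. -/
theorem RedChoice.compl (c : RedChoice a b e B' σ S Sv K Y) :
    RedChoice a b e B' σ S Sv K (((redTokens e σ \ S) \ K) \ Y) :=
  { c with Y_sub := Finset.sdiff_subset }

theorem pinkFst_of_le {Pe rv rw x : ℕ} (h1 : Pe - rw ≤ x) (h2 : x ≤ rv) (h3 : x ≤ Pe) :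
    pinkFst Pe rv rw x = x := by
  rw [pinkFst, min_eq_right (le_min h2 h3), max_eq_right h1]

/-- If the targets for the old pink particles cross, opposite choices balance. -/
theorem balanced_targets {y y' k lv sw cv cw Re Pe We rv rw rv' rw' lP uP : ℕ}
    (h1 : rv + (lv + y + k) = cv) (h2 : rw + (sw + y' + k) = cw)
    (h3 : rv' + (lv + y' + k) = cv) (h4 : rw' + (sw + y + k) = cw)
    (h5 : y + y' + k + lv + sw = Re) (h6 : cv + cw = Re + Pe + We) (hk : k ≤ We)
    (hcv : lv + (y + y' + k) ≤ cv) (hcw : sw + (y + y' + k) ≤ cw)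
    (hlP : lP = Pe + (sw + (y + y' + k)) - cw)
    (huP : uP = min (cv - (lv + (y + y' + k))) Pe) (hlt : uP < lP) :
    (2 * (lv + y) + k + pinkFst Pe rv rw lP + (2 * (lv + y') + k + pinkFst Pe rv' rw' uP) =
      2 * (lv + (lv + (y + y' + k))) + (lP + uP)) ∧
    (2 * (lv + y) + k + pinkFst Pe rv rw uP + (2 * (lv + y') + k + pinkFst Pe rv' rw' lP) =
      2 * (lv + (lv + (y + y' + k))) + (lP + uP)) := by
  have hlP' : lP + cw = Pe + (sw + (y + y' + k)) := by omega
  have hPe : lP ≤ Pe := by omega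
  have huP' : uP + (lv + (y + y' + k)) = cv := by omega
  -- When `y` free reds go to `v` and `y'` to `w`, the number of old pinks on `v` has lower limit
  -- `lP - y` and upper limit the smaller of `uP + y'` and `Pe`; the opposite choice exchanges `y`
  -- and `y'`.
  have e1 : Pe - rw = lP - y := by omega
  have e2 : Pe - rw' = lP - y' := by omega
  have e3 : rv = uP + y' := by omega
  have e4 : rv' = uP + y := by omega
  -- In fact `lP - uP = y + y' + k - We`, and the `k` pairs use `k ≤ We` white particles. So the
  -- lower clamp cannot exceed the upper one.
  have hd : lP ≤ uP + (y + y') := by omega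
  have m1 : ∀ z, min (min (uP + z) Pe) uP = uP := by intro z; omega
  have m2 : ∀ z, min (min (uP + z) Pe) lP = min (uP + z) lP := by intro z; omega
  simp only [pinkFst, e1, e2, e3, e4, m1, m2]
  clear huP hlP h1 h2 h3 h4 h5 h6 e1 e2 e3 e4 m1 m2 hlP' huP' hcv hcw hk hPe
  -- The corrections cancel, since `min (uP + y') lP + max (lP - y') uP = lP + uP`, and the same
  -- with `y` in place of `y'`.
  constructor <;> omega

section

variable (h : RingSetup a b e B' σ) (c : RedChoice a b e B' σ S Sv K Y)
include h c

/-- `lP` is computed with `w` carrying `u(w)` reds and `uP` with `v` carrying `u(v)`, the worst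
cases for the pinks. Hence every target between `lP` and `uP` is feasible for any placement of the
reds, and the clamp is inactive. -/
theorem outInk_of_le (hle : pinkLow (chi a b (B' e.2)) (σ.R e.1 + σ.R e.2) (σ.P e.1 + σ.P e.2) ≤
      pinkUp (chi a b (B' e.1)) (σ.R e.1 + σ.R e.2) (σ.P e.1 + σ.P e.2)) (low : Bool) :
    outInk a b e B' σ S Sv K Y low = 2 * (Sv.card + Y.card) + K.card +
      (if low then pinkLow (chi a b (B' e.2)) (σ.R e.1 + σ.R e.2) (σ.P e.1 + σ.P e.2)
        else pinkUp (chi a b (B' e.1)) (σ.R e.1 + σ.R e.2) (σ.P e.1 + σ.P e.2)) := by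
  have h1 := c.card_rest h
  have h2 := c.S_card
  have h3 := c.Sv_card
  have h4 := c.card_sdiff
  have h5 := c.room_fst h
  have h6 := c.room_snd h
  have h7 := c.room_add h
  have h8 := h.edge_sum
  have h9 := c.card_whites_sdiff h
  rw [outInk]
  congr 1
  simp only [pinkFst, pinkLow, pinkUp, redLow, redUp] at *
  split_ifs <;> omega

theorem outInk_add_compl
    (hlt : pinkUp (chi a b (B' e.1)) (σ.R e.1 + σ.R e.2) (σ.P e.1 + σ.P e.2) <
      pinkLow (chi a b (B' e.2)) (σ.R e.1 + σ.R e.2) (σ.P e.1 + σ.P e.2)) (low : Bool) :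
    outInk a b e B' σ S Sv K Y low +
        outInk a b e B' σ S Sv K (((redTokens e σ \ S) \ K) \ Y) (!low) =
      2 * (redLow (chi a b (B' e.2)) (σ.R e.1 + σ.R e.2) +
        redUp (chi a b (B' e.1)) (σ.R e.1 + σ.R e.2)) +
      (pinkLow (chi a b (B' e.2)) (σ.R e.1 + σ.R e.2) (σ.P e.1 + σ.P e.2) +
        pinkUp (chi a b (B' e.1)) (σ.R e.1 + σ.R e.2) (σ.P e.1 + σ.P e.2)) := by
  have c' := c.compl
  have h1 := c.card_rest h
  have h2 := c.S_card
  have h3 := c.Sv_card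
  have h4 := c.card_sdiff
  have h5 := c.room_fst h
  have h6 := c.room_snd h
  have h5' := c'.room_fst h
  have h6' := c'.room_snd h
  have h8 := h.edge_sum
  have h9 := c.card_whites_sdiff h
  have hY : (((redTokens e σ \ S) \ K) \ (((redTokens e σ \ S) \ K) \ Y)) = Y :=
    Finset.sdiff_sdiff_eq_self c.Y_sub
  rw [hY] at h6'
  simp only [outInk]
  have k1 : redUp (chi a b (B' e.1)) (σ.R e.1 + σ.R e.2) = Sv.card +
      (Y.card + (((redTokens e σ \ S) \ K) \ Y).card + K.card) := by
    simp only [redUp, redLow] at *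
    omega
  have k2 : redUp (chi a b (B' e.2)) (σ.R e.1 + σ.R e.2) = (S \ Sv).card +
      (Y.card + (((redTokens e σ \ S) \ K) \ Y).card + K.card) := by
    simp only [redUp, redLow] at *
    omega
  rw [← h3, k1]
  have k3 : Sv.card + (S \ Sv).card = S.card := by
    have := Finset.card_sdiff_add_card_eq_card c.Sv_sub
    omega
  have key := balanced_targets h5 h6 h5' h6' (by omega) h8 (by omega)
    (by rw [← k1]; exact min_le_left _ _) (by rw [← k2]; exact min_le_left _ _)
    (lP := pinkLow (chi a b (B' e.2)) (σ.R e.1 + σ.R e.2) (σ.P e.1 + σ.P e.2))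
    (uP := pinkUp (chi a b (B' e.1)) (σ.R e.1 + σ.R e.2) (σ.P e.1 + σ.P e.2))
    (by rw [← k2]; rfl) (by rw [← k1]; rfl) hlt
  cases low
  · simp only [Bool.not_false, if_true, Bool.false_eq_true, if_false]
    exact key.2
  · simp only [Bool.not_true, if_true, Bool.false_eq_true, if_false]
    exact key.1

end

/-- Sending the complementary set of free reds to `v` is an involution of the choices. If the
targets do not cross, it balances the ink for each fixed target; if they cross, it does so together
with an exchange of the two targets, which are then equally likely. -/
theorem mean_upper_fork (h : RingSetup a b e B' σ) (hS : S ∈ lowerSets a b e B' σ)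
    (hSv : Sv ∈ S.powersetCard (redLow (chi a b (B' e.2)) (σ.R e.1 + σ.R e.2)))
    (hK : K ∈ (pinkLaw a b e σ S true).support) :
    pmfMean (upperLaw e σ (theta a b e B' σ) S true K) (fun Y =>
      pmfMean (afterLower a b e B' σ S Sv true K Y) (fun τ => ENNReal.ofReal (τ.twoInk e.1))) =
    ENNReal.ofReal ((redLow (chi a b (B' e.2)) (σ.R e.1 + σ.R e.2) : ℝ) +
        redUp (chi a b (B' e.1)) (σ.R e.1 + σ.R e.2) +
      if pinkLow (chi a b (B' e.2)) (σ.R e.1 + σ.R e.2) (σ.P e.1 + σ.P e.2) ≤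
          pinkUp (chi a b (B' e.1)) (σ.R e.1 + σ.R e.2) (σ.P e.1 + σ.P e.2)
      then theta a b e B' σ *
          pinkLow (chi a b (B' e.2)) (σ.R e.1 + σ.R e.2) (σ.P e.1 + σ.P e.2) +
        (1 - theta a b e B' σ) *
          pinkUp (chi a b (B' e.1)) (σ.R e.1 + σ.R e.2) (σ.P e.1 + σ.P e.2)
      else ((pinkLow (chi a b (B' e.2)) (σ.R e.1 + σ.R e.2) (σ.P e.1 + σ.P e.2) : ℝ) +
        pinkUp (chi a b (B' e.1)) (σ.R e.1 + σ.R e.2) (σ.P e.1 + σ.P e.2)) / 2) := by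
  have ht := h.thetaSpec
  have hc : ∀ Y ∈ ((redTokens e σ \ S) \ K).powerset, RedChoice a b e B' σ S Sv K Y := by
    intro Y hY
    refine redChoice (θ := 0) hS hSv hK ?_
    rw [upperLaw, if_pos rfl]
    exact mem_support_unif hY
  simp only [upperLaw, if_true, mean_afterLower]
  have h0 : ∀ x : ℕ, (0 : ℝ) ≤ x := fun x => Nat.cast_nonneg x
  have ht0 := ht.nonneg
  have ht1 : 0 ≤ 1 - theta a b e B' σ := sub_nonneg.2 ht.le_one
  refine pmfMean_unif_of_balanced (Finset.powerset_nonempty _) _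
    (fun Y => ((redTokens e σ \ S) \ K) \ Y)
    (fun Y _ => Finset.mem_powerset.2 Finset.sdiff_subset)
    (fun Y hY => by simpa using Finset.mem_powerset.1 hY) fun Y hY => ?_
  have c := hc Y hY
  have c' := c.compl
  rw [← ENNReal.ofReal_ofNat 2, ← ENNReal.ofReal_mul (by norm_num)]
  split_ifs with hle
  · have key : ∀ low, (outInk a b e B' σ S Sv K Y low : ℝ) +
        outInk a b e B' σ S Sv K (((redTokens e σ \ S) \ K) \ Y) low =
        2 * (redLow (chi a b (B' e.2)) (σ.R e.1 + σ.R e.2) +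
        redUp (chi a b (B' e.1)) (σ.R e.1 + σ.R e.2)) +
      2 * (if low then pinkLow (chi a b (B' e.2)) (σ.R e.1 + σ.R e.2) (σ.P e.1 + σ.P e.2)
        else pinkUp (chi a b (B' e.1)) (σ.R e.1 + σ.R e.2) (σ.P e.1 + σ.P e.2) : ℕ) := by
      intro low
      rw [outInk_of_le h c hle, outInk_of_le h c' hle]
      have h1 := c.card_rest h
      have h2 := c.S_card
      have h3 := c.Sv_card
      have h8 := h.edge_sum
      norm_cast
      generalize (if low = true then pinkLow (chi a b (B' e.2)) (σ.R e.1 + σ.R e.2)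
        (σ.P e.1 + σ.P e.2) else _) = x
      simp only [redLow, redUp] at *
      omega
    rw [pmfMean_coinFlip_ofReal ht.nonneg ht.le_one fun _ => h0 _,
      pmfMean_coinFlip_ofReal ht.nonneg ht.le_one fun _ => h0 _, ← ENNReal.ofReal_add (by positivity) (by positivity)]
    congr 1
    have k1 := key true
    have k2 := key false
    simp only [if_true, Bool.false_eq_true, if_false] at k1 k2
    linear_combination (theta a b e B' σ) * k1 + (1 - theta a b e B' σ) * k2
  · have hlt := not_le.1 hle
    rw [pmfMean_coinFlip_ofReal (by norm_num) (by norm_num) fun _ => h0 _,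
      pmfMean_coinFlip_ofReal (by norm_num) (by norm_num) fun _ => h0 _,
      ← ENNReal.ofReal_add (by positivity) (by positivity)]
    congr 1
    have k1 := outInk_add_compl h c hlt true
    have k2 := outInk_add_compl h c hlt false
    simp only [Bool.not_true, Bool.not_false] at k1 k2
    have k1' := congrArg (Nat.cast : ℕ → ℝ) k1
    have k2' := congrArg (Nat.cast : ℕ → ℝ) k2
    push_cast at k1' k2'
    linear_combination (1 / 2) * k1' + (1 / 2) * k2'

/-- With the whole pool at one end, the target that goes along with it is feasible, so the ink is
computed exactly and no averaging over placements is needed. -/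
theorem mean_upper_noFork (h : RingSetup a b e B' σ) (hS : S ∈ lowerSets a b e B' σ)
    (hSv : Sv ∈ S.powersetCard (redLow (chi a b (B' e.2)) (σ.R e.1 + σ.R e.2)))
    (hK : K ∈ (pinkLaw a b e σ S false).support) :
    pmfMean (upperLaw e σ (theta a b e B' σ) S false K) (fun Y =>
      pmfMean (afterLower a b e B' σ S Sv false K Y) (fun τ => ENNReal.ofReal (τ.twoInk e.1))) =
    ENNReal.ofReal ((if theta a b e B' σ < 1 / 2
        then 2 * (redUp (chi a b (B' e.1)) (σ.R e.1 + σ.R e.2) : ℝ)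
        else 2 * (redLow (chi a b (B' e.2)) (σ.R e.1 + σ.R e.2) : ℝ)) +
      if pinkLow (chi a b (B' e.2)) (σ.R e.1 + σ.R e.2) (σ.P e.1 + σ.P e.2) ≤
          pinkUp (chi a b (B' e.1)) (σ.R e.1 + σ.R e.2) (σ.P e.1 + σ.P e.2)
      then theta a b e B' σ *
          pinkLow (chi a b (B' e.2)) (σ.R e.1 + σ.R e.2) (σ.P e.1 + σ.P e.2) +
        (1 - theta a b e B' σ) *
          pinkUp (chi a b (B' e.1)) (σ.R e.1 + σ.R e.2) (σ.P e.1 + σ.P e.2)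
      else if theta a b e B' σ < 1 / 2
        then (pinkUp (chi a b (B' e.1)) (σ.R e.1 + σ.R e.2) (σ.P e.1 + σ.P e.2) : ℝ)
        else pinkLow (chi a b (B' e.2)) (σ.R e.1 + σ.R e.2) (σ.P e.1 + σ.P e.2)) := by
  have ht := h.thetaSpec
  have hK0 := pinkLaw_false hK
  subst hK0
  have c : RedChoice a b e B' σ S Sv ∅ (if theta a b e B' σ < 1 / 2 then redTokens e σ \ S else ∅) :=
    redChoice (fork := false) (θ := theta a b e B' σ) hS hSv hK (by simp [upperLaw])
  rw [upperLaw, if_neg (by simp), pmfMean_pure, mean_afterLower]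
  have h0 : ∀ x : ℕ, (0 : ℝ) ≤ x := fun x => Nat.cast_nonneg x
  have h1 := c.card_rest h
  have h2 := c.S_card
  have h3 := c.Sv_card
  have h4 := c.card_sdiff
  have h5 := c.room_fst h
  have h6 := c.room_snd h
  have h8 := h.edge_sum
  have hcard : (redTokens e σ \ S).card + S.card = σ.R e.1 + σ.R e.2 := by
    rw [Finset.card_sdiff_add_card_eq_card (lower_subset hS), h.card_reds]
  by_cases hle : pinkLow (chi a b (B' e.2)) (σ.R e.1 + σ.R e.2) (σ.P e.1 + σ.P e.2) ≤
          pinkUp (chi a b (B' e.1)) (σ.R e.1 + σ.R e.2) (σ.P e.1 + σ.P e.2)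
  · rw [if_pos hle, if_pos hle, pmfMean_coinFlip_ofReal ht.nonneg ht.le_one fun _ => h0 _,
      outInk_of_le h c hle, outInk_of_le h c hle]
    congr 1
    have key : 2 * (Sv.card + (if theta a b e B' σ < 1 / 2 then redTokens e σ \ S else ∅).card) =
        if theta a b e B' σ < 1 / 2 then 2 * (redUp (chi a b (B' e.1)) (σ.R e.1 + σ.R e.2))
        else 2 * (redLow (chi a b (B' e.2)) (σ.R e.1 + σ.R e.2)) := by
      simp only [redLow, redUp] at *
      split_ifs
      · omega
      · rw [Finset.card_empty]
        omega
    rw [key]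
    simp only [if_true, Bool.false_eq_true, if_false, Finset.card_empty]
    split_ifs <;> push_cast <;> ring
  · rw [if_neg hle, if_neg hle, if_neg (by simp), pmfMean_pure, outInk]
    by_cases hθ : theta a b e B' σ < 1 / 2
    · simp only [hθ, not_true_eq_false, decide_false, Bool.false_eq_true, if_false, if_true,
        Finset.card_empty, Finset.sdiff_empty, Finset.sdiff_self] at *
      refine congrArg ENNReal.ofReal ?_
      norm_cast
      rw [pinkFst_of_le] <;> simp only [pinkLow, pinkUp, redLow, redUp] at * <;> omega
    · simp only [hθ, not_false_eq_true, decide_true, if_false, if_true,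
        Finset.card_empty, Finset.sdiff_empty] at *
      refine congrArg ENNReal.ofReal ?_
      norm_cast
      rw [pinkFst_of_le] <;> simp only [pinkLow, pinkUp, redLow, redUp] at * <;> omega

/-- The mean ink on the first end of `e` after a ring. -/
theorem mean_twoInk_fst (h : RingSetup a b e B' σ) :
    pmfMean (chamKernel a b e B' σ) (fun τ => ENNReal.ofReal (τ.twoInk e.1)) =
      ENNReal.ofReal (((σ.twoInk e.1 : ℝ) + σ.twoInk e.2) *
        (chi a b (B' e.1) / (chi a b (B' e.1) + chi a b (B' e.2)))) := by
  have ht := h.thetaSpec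
  have h0 : ∀ x : ℕ, (0 : ℝ) ≤ x := fun x => Nat.cast_nonneg x
  have ht0 := ht.nonneg
  have ht1 : 0 ≤ 1 - theta a b e B' σ := sub_nonneg.2 ht.le_one
  have hmin : 0 ≤ min (theta a b e B' σ) (1 - theta a b e B' σ) := le_min ht0 ht1
  have hmin1 : 2 * min (theta a b e B' σ) (1 - theta a b e B' σ) ≤ 1 := by
    have h1 := min_le_left (theta a b e B' σ) (1 - theta a b e B' σ)
    have h2 := min_le_right (theta a b e B' σ) (1 - theta a b e B' σ)
    linarith
  rw [chamKernel_eq_bind, pmfMean_bind]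
  refine pmfMean_of_const fun S hS => ?_
  have hS' := unif_mem h.lowerSets_nonempty hS
  rw [pmfMean_bind]
  refine pmfMean_of_const fun Sv hSv => ?_
  have hSv' := unif_mem (lowerFst_nonempty hS') hSv
  rw [pmfMean_bind, pmfMean_coinFlip (by positivity) hmin1]
  simp only [pmfMean_bind]
  rw [pmfMean_of_const fun K hK => mean_upper_fork h hS' hSv' hK,
    pmfMean_of_const fun K hK => mean_upper_noFork h hS' hSv' hK,
    ← ENNReal.ofReal_mul (by positivity), ← ENNReal.ofReal_mul (by linarith),
    ← ENNReal.ofReal_add (mul_nonneg (by positivity) (by split_ifs <;> positivity))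
      (mul_nonneg (by linarith) (by split_ifs <;> positivity))]
  congr 1
  have heq := ht.eq
  have hink : (σ.twoInk e.1 : ℝ) + σ.twoInk e.2 =
      2 * (((σ.R e.1 + σ.R e.2 : ℕ) : ℝ) + ((σ.P e.1 + σ.P e.2 : ℕ) : ℝ) / 2) := by
    simp only [ChamState.twoInk]
    push_cast
    ring
  rw [hink]
  conv_rhs => rw [mul_assoc, ← heq]
  -- For `θ < 1/2` the weights are `2θ · (L + U)/2 + (1 - 2θ) U = θ L + (1 - θ) U`, where `L` and
  -- `U` are the extreme values of the ink; for `θ ≥ 1/2` the ends change roles. This explains the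
  -- probability `2 min(θ, 1 - θ)`.
  by_cases hθ : theta a b e B' σ < 1 / 2
  · rw [min_eq_left (by linarith), if_pos hθ, if_pos hθ]
    split_ifs <;> ring
  · rw [min_eq_right (by linarith), if_neg hθ, if_neg hθ]
    split_ifs <;> ring

theorem twoInk_edge (h : RingSetup a b e B' σ) {σ' : ChamState n N}
    (hσ' : σ' ∈ (chamKernel a b e B' σ).support) :
    σ'.twoInk e.1 + σ'.twoInk e.2 = σ.twoInk e.1 + σ.twoInk e.2 ∧
      ∀ u, u ≠ e.1 → u ≠ e.2 → σ'.twoInk u = σ.twoInk u := by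
  obtain ⟨S, Sv, K, Y, Wv, pv, c, d, rfl⟩ := exists_choice h hσ'
  constructor
  · simp only [ChamState.twoInk]
    rw [ringOut_R_fst, ringOut_P_fst, ringOut_R_snd h, ringOut_P_snd h]
    have h1 := c.card_rest h
    have h2 := Finset.card_sdiff_add_card_eq_card c.Sv_sub
    have h3 := d.pv_le
    omega
  · intro u h1 h2
    simp only [ChamState.twoInk]
    rw [ringOut_R_of_ne h1 h2, ringOut_P_of_ne h1 h2]

/-- The mean ink on the second end of `e` after a ring. -/
theorem mean_twoInk_snd (h : RingSetup a b e B' σ) :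
    pmfMean (chamKernel a b e B' σ) (fun τ => ENNReal.ofReal (τ.twoInk e.2)) =
      ENNReal.ofReal (((σ.twoInk e.1 : ℝ) + σ.twoInk e.2) *
        (chi a b (B' e.2) / (chi a b (B' e.1) + chi a b (B' e.2)))) := by
  have hv : (0 : ℝ) < chi a b (B' e.1) := by exact_mod_cast h.chi_pos _
  have hw : (0 : ℝ) < chi a b (B' e.2) := by exact_mod_cast h.chi_pos _
  have hsum : pmfMean (chamKernel a b e B' σ) (fun τ => ENNReal.ofReal (τ.twoInk e.1)) +
      pmfMean (chamKernel a b e B' σ) (fun τ => ENNReal.ofReal (τ.twoInk e.2)) =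
      ENNReal.ofReal ((σ.twoInk e.1 : ℝ) + σ.twoInk e.2) := by
    rw [← pmfMean_add]
    refine pmfMean_of_const fun τ hτ => ?_
    rw [← ENNReal.ofReal_add (by positivity) (by positivity)]
    congr 1
    exact_mod_cast (twoInk_edge h hτ).1
  rw [mean_twoInk_fst h] at hsum
  refine (ENNReal.add_right_inj ENNReal.ofReal_ne_top).1 (hsum.trans ?_)
  rw [← ENNReal.ofReal_add (by positivity) (by positivity)]
  congr 1
  field_simp

end Ring

/-! ### Outcomes of positive probability: new pinks, or a displaced red partner. -/

section Ring

variable {a b n N : ℕ} {e : Fin n × Fin n} {B' : Fin n → ℕ} {σ : ChamState n N}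
  {S Sv K Y : Finset (Token N)} {fork : Bool}

/-- With `p` pinks and `p < M`, where `M` is the smaller of the red and white totals, `(M + p/2)/3`
exceeds `p/2`. -/
theorem pinkCap_pos (h : ∑ y, σ.P y < min (∑ y, σ.R y) (∑ y, σ.W a b y)) : 0 < pinkCap a b σ := by
  rw [pinkCap, Nat.sub_pos_iff_lt, Nat.lt_ceil]
  generalize min (∑ y, σ.R y) (∑ y, σ.W a b y) = M at *
  generalize ∑ y, σ.P y = p at *
  have h1 : ((p / 2 : ℕ) : ℚ) ≤ (p : ℚ) / 2 := Nat.cast_div_le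
  have h2 : (p : ℚ) < M := by exact_mod_cast h
  linarith

/-- Choices for the red particles extend to a possible outcome of the ring. -/
theorem exists_mem_support (h : RingSetup a b e B' σ) (hS : S ∈ lowerSets a b e B' σ)
    (hSv : Sv ∈ S.powersetCard (redLow (chi a b (B' e.2)) (σ.R e.1 + σ.R e.2)))
    (hfork : fork ∈ (coinFlip (2 * min (theta a b e B' σ) (1 - theta a b e B' σ))).support)
    (hK : K ∈ (pinkLaw a b e σ S fork).support)
    (hY : Y ∈ (upperLaw e σ (theta a b e B' σ) S fork K).support) :
    ∃ Wv pv, WhiteChoice a b e B' σ S Sv K Y Wv pv ∧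
      ringResult a b e B' σ S Sv K Y Wv pv ∈ (chamKernel a b e B' σ).support := by
  have c := redChoice hS hSv hK hY
  obtain ⟨low, hlow⟩ := PMF.support_nonempty
    (if pinkLow (chi a b (B' e.2)) (σ.R e.1 + σ.R e.2) (σ.P e.1 + σ.P e.2) ≤
          pinkUp (chi a b (B' e.1)) (σ.R e.1 + σ.R e.2) (σ.P e.1 + σ.P e.2)
        then coinFlip (theta a b e B' σ) else if fork then coinFlip (1 / 2)
        else PMF.pure (decide (¬ theta a b e B' σ < 1 / 2)))
  obtain ⟨Wv, hWv⟩ := c.whites_nonempty h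
    (if low then pinkLow (chi a b (B' e.2)) (σ.R e.1 + σ.R e.2) (σ.P e.1 + σ.P e.2)
      else pinkUp (chi a b (B' e.1)) (σ.R e.1 + σ.R e.2) (σ.P e.1 + σ.P e.2))
  refine ⟨Wv, _, c.whiteChoice h _ hWv, ?_⟩
  rw [chamKernel_eq_bind]
  simp only [PMF.mem_support_bind_iff, afterLower]
  exact ⟨S, mem_support_unif hS, Sv, mem_support_unif hSv, fork, hfork, K, hK, Y, hY, low, hlow,
    Wv, mem_support_unif hWv, by simp⟩

theorem fork_mem_support (h : RingSetup a b e B' σ) (h0 : 0 < σ.R e.1 + σ.R e.2)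
    (h1 : σ.R e.1 + σ.R e.2 < chi a b (B' e.1) + chi a b (B' e.2)) :
    true ∈ (coinFlip (2 * min (theta a b e B' σ) (1 - theta a b e B' σ))).support := by
  have ht := h.thetaSpec
  refine mem_support_coinFlip_true (mul_pos two_pos (lt_min (ht.pos h0 h1) ?_))
  have := ht.lt_one h0 h1
  linarith

/-- If a pair is on the ringing edge, pink particles may be created. -/
theorem exists_pink (h : RingSetup a b e B' σ)
    (hP : ∑ y, σ.P y < min (∑ y, σ.R y) (∑ y, σ.W a b y))
    (hne : (pairedTokens a b e σ).Nonempty) :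
    ∃ σ' ∈ (chamKernel a b e B' σ).support, ∑ y, σ.P y < ∑ y, σ'.P y := by
  obtain ⟨p, hp⟩ := hne
  have hr : 0 < σ.R e.1 + σ.R e.2 := by
    rw [← h.card_reds, Finset.card_pos]
    exact ⟨p, pairedTokens_subset_reds hp⟩
  have hw : 0 < σ.W a b e.1 + σ.W a b e.2 := by
    rw [← h.card_whites, Finset.card_pos]
    exact ⟨p, pairedTokens_subset_whites hp⟩
  have hsum := h.edge_sum
  obtain ⟨S, hS⟩ := h.lowerSets_nonempty
  obtain ⟨Sv, hSv⟩ := lowerFst_nonempty hS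
  have hpos : 0 < ((redTokens e σ \ S) ∩ pairedTokens a b e σ).card := by
    rw [Finset.card_pos]
    -- Paired reds are used last for the lower bounds. So either none was used and `p` is still in
    -- the pool, or all unpaired reds were used and whatever is left in the pool is paired.
    rcases (Finset.mem_filter.1 hS).2 with h1 | h1
    · refine ⟨p, Finset.mem_inter.2 ⟨Finset.mem_sdiff.2 ⟨pairedTokens_subset_reds hp, ?_⟩, hp⟩⟩
      intro hpS
      exact (Finset.mem_sdiff.1 (h1 hpS)).2 hp
    · have h2 := h.card_reds
      have h3 := lower_card hS
      have h4 := Finset.card_sdiff_add_card_eq_card (lower_subset hS)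
      have h5 := h.chi_pos e.1
      have h6 := h.chi_pos e.2
      -- Both ends have places, and the edge holds at least one red and one white; the lower bounds
      -- therefore never use up all reds.
      have h7 : 0 < (redTokens e σ \ S).card := by
        simp only [redLow, redUp] at h3
        omega
      obtain ⟨q, hq⟩ := Finset.card_pos.1 h7
      refine ⟨q, Finset.mem_inter.2 ⟨hq, ?_⟩⟩
      by_contra hq'
      exact (Finset.mem_sdiff.1 hq).2 (h1 (Finset.mem_sdiff.2 ⟨(Finset.mem_sdiff.1 hq).1, hq'⟩))
  obtain ⟨K, hK⟩ := Finset.powersetCard_nonempty.2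
    (min_le_left ((redTokens e σ \ S) ∩ pairedTokens a b e σ).card (pinkCap a b σ))
  have hKpos : 0 < K.card := by
    rw [(Finset.mem_powersetCard.1 hK).2]
    exact lt_min hpos (pinkCap_pos hP)
  have hK' : K ∈ (pinkLaw a b e σ S true).support := by
    rw [pinkLaw, if_pos rfl]
    exact mem_support_unif hK
  have hY : ∅ ∈ (upperLaw e σ (theta a b e B' σ) S true K).support := by
    rw [upperLaw, if_pos rfl]
    exact mem_support_unif (by simp)
  obtain ⟨Wv, pv, d, hmem⟩ := exists_mem_support h hS hSv
    (fork_mem_support h hr (by omega)) hK' hY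
  refine ⟨_, hmem, ?_⟩
  rw [d.sum_P h]
  omega

/-- Without pairs on the ringing edge, a red particle may go to either end. -/
theorem exists_move (h : RingSetup a b e B' σ) (hne : pairedTokens a b e σ = ∅) {i : Fin N}
    (hi : σ.LR i = some e.1 ∨ σ.LR i = some e.2) {z : Fin n} (hz : z = e.1 ∨ z = e.2) :
    ∃ σ' ∈ (chamKernel a b e B' σ).support, σ'.LR i = some z ∧ σ'.LW i = σ.LW i := by
  have hir : Sum.inl i ∈ redTokens e σ := inl_mem_tokens.2 hi
  have hiw : Sum.inl i ∉ whiteTokens a b e σ := by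
    intro hw
    have : Sum.inl i ∈ pairedTokens a b e σ := Finset.mem_filter.2 ⟨hir, i, rfl, hw⟩
    rw [hne] at this
    simp at this
  have hr : 0 < σ.R e.1 + σ.R e.2 := by
    rw [← h.card_reds, Finset.card_pos]
    exact ⟨_, hir⟩
  have hsum := h.edge_sum
  have h2 := h.card_reds
  have h5 := h.chi_pos e.1
  have h6 := h.chi_pos e.2
  have hlow := h.lower_le
  have hKe : ∀ {S K : Finset (Token N)} {fork : Bool},
      K ∈ (pinkLaw a b e σ S fork).support → K = ∅ := by
    intro S K fork hK
    have := pinkLaw_subset hK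
    rw [hne, Finset.inter_empty] at this
    exact Finset.subset_empty.1 this
  -- it suffices to make choices that put the red particle where it should be
  have main : ∀ {S Sv Y : Finset (Token N)} {fork : Bool}, S ∈ lowerSets a b e B' σ →
      Sv ∈ S.powersetCard (redLow (chi a b (B' e.2)) (σ.R e.1 + σ.R e.2)) →
      fork ∈ (coinFlip (2 * min (theta a b e B' σ) (1 - theta a b e B' σ))).support →
      Y ∈ (upperLaw e σ (theta a b e B' σ) S fork ∅).support →
      (Sum.inl i ∈ Sv ∪ Y ↔ z = e.1) →
      ∃ σ' ∈ (chamKernel a b e B' σ).support, σ'.LR i = some z ∧ σ'.LW i = σ.LW i := by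
    intro S Sv Y fork hS hSv hf hY hiff
    obtain ⟨K, hK⟩ := (pinkLaw a b e σ S fork).support_nonempty
    have hK0 := hKe hK
    subst hK0
    obtain ⟨Wv, pv, d, hmem⟩ := exists_mem_support h hS hSv hf hK hY
    refine ⟨_, hmem, ?_, ?_⟩
    · simp only [ringOut]
      rw [if_pos hir, if_neg (Finset.notMem_empty _)]
      rcases hz with rfl | rfl
      · rw [if_pos (hiff.2 rfl)]
      · rw [if_neg fun h' => h.ne (hiff.1 h').symm]
    · simp only [ringOut]
      rw [if_neg hiw]
  have hmemS : ∀ {S : Finset (Token N)}, S ⊆ redTokens e σ →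
      S.card = redLow (chi a b (B' e.2)) (σ.R e.1 + σ.R e.2) +
        (σ.R e.1 + σ.R e.2 - redUp (chi a b (B' e.1)) (σ.R e.1 + σ.R e.2)) →
      S ∈ lowerSets a b e B' σ := by
    intro S h1 h2
    refine Finset.mem_filter.2 ⟨Finset.mem_powersetCard.2 ⟨h1, h2⟩, Or.inl ?_⟩
    rwa [hne, Finset.sdiff_empty]
  -- If the lower bounds leave a red over, particle `i` can be kept in the pool and sent to either
  -- end in Step 3a.
  rcases hlow.lt_or_eq with hlt | heq
  · have hcard : ((redTokens e σ).erase (Sum.inl i)).card = σ.R e.1 + σ.R e.2 - 1 := by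
      rw [Finset.card_erase_of_mem hir, h2]
    obtain ⟨S, hSsub, hScard⟩ := Finset.exists_subset_card_eq
      (s := (redTokens e σ).erase (Sum.inl i)) (hcard ▸ Nat.le_sub_one_of_lt hlt)
    have hiS : Sum.inl i ∉ S := fun hh => by simpa using hSsub hh
    have hS := hmemS (hSsub.trans (Finset.erase_subset _ _)) hScard
    obtain ⟨Sv, hSv⟩ := lowerFst_nonempty hS
    have hiSv : Sum.inl i ∉ Sv := fun hh => hiS ((Finset.mem_powersetCard.1 hSv).1 hh)
    have hf := fork_mem_support h hr (by
      simp only [redLow, redUp] at hlt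
      omega)
    by_cases hz1 : z = e.1
    · refine main (Y := {Sum.inl i}) hS hSv hf ?_ (by simp [hz1])
      rw [upperLaw, if_pos rfl]
      refine mem_support_unif ?_
      simp [hir, hiS]
    · refine main (Y := ∅) hS hSv hf ?_ (by simp [hz1, hiSv])
      rw [upperLaw, if_pos rfl]
      exact mem_support_unif (by simp)
  -- If the lower bounds use all reds, then both of them are positive, because both ends have
  -- places. Particle `i` can thus be put into the share of either end.
  · have hS := hmemS (Finset.Subset.refl _) (h2.trans heq.symm)
    obtain ⟨fork, hf⟩ := (coinFlip (2 * min (theta a b e B' σ) (1 - theta a b e B' σ))).support_nonempty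
    obtain ⟨K, hK⟩ := (pinkLaw a b e σ (redTokens e σ) fork).support_nonempty
    obtain ⟨Y, hY⟩ := (upperLaw e σ (theta a b e B' σ) (redTokens e σ) fork K).support_nonempty
    have hK0 := hKe hK
    subst hK0
    have hY0 : Y = ∅ := by
      have := upperLaw_subset hK hY
      simpa using this
    subst hY0
    by_cases hz1 : z = e.1
    · obtain ⟨Sv, h1, h3, h4⟩ := Finset.exists_subsuperset_card_eq
        (s := {Sum.inl i}) (t := redTokens e σ)
        (n := redLow (chi a b (B' e.2)) (σ.R e.1 + σ.R e.2))
        (Finset.singleton_subset_iff.2 hir)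
        (by
          rw [Finset.card_singleton]
          simp only [redLow, redUp] at heq ⊢
          omega)
        (by omega)
      refine main hS (Finset.mem_powersetCard.2 ⟨h3, h4⟩) hf hY ?_
      simp [hz1, Finset.singleton_subset_iff.1 h1]
    · have hcard : ((redTokens e σ).erase (Sum.inl i)).card = σ.R e.1 + σ.R e.2 - 1 := by
        rw [Finset.card_erase_of_mem hir, h2]
      obtain ⟨Sv, hsub, hc⟩ := Finset.exists_subset_card_eq
        (s := (redTokens e σ).erase (Sum.inl i))
        (n := redLow (chi a b (B' e.2)) (σ.R e.1 + σ.R e.2)) (by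
          rw [hcard]
          simp only [redLow, redUp] at heq ⊢
          omega)
      have hiS : Sum.inl i ∉ Sv := fun hh => by simpa using hsub hh
      refine main hS (Finset.mem_powersetCard.2 ⟨hsub.trans (Finset.erase_subset _ _), hc⟩) hf hY ?_
      simp [hz1, hiS]

end Ring

/-! ### Progress towards the creation of pink particles -/

section Progress

variable {a b n N : ℕ} (G : SimpleGraph (Fin n))

/-- The distances of the pairs of a state. -/
def pairDists (σ : ChamState n N) : Set ℕ :=
  {d | ∃ i x y, σ.LR i = some x ∧ σ.LW i = some y ∧ G.dist x y = d}

/-- The smallest distance of a pair. -/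
def pairDist (σ : ChamState n N) : ℕ := sInf (pairDists G σ)

/-- Pink particles can still be created. -/
def ChamState.Unsaturated (a b : ℕ) (σ : ChamState n N) : Prop :=
  ∑ y, σ.P y < min (∑ y, σ.R y) (∑ y, σ.W a b y)

/-- Guarantees that the infimum in `pairDist` is attained by some pair instead of being the default
0. -/
theorem pairDists_nonempty {σ : ChamState n N} (hσ : σ.Valid a b) (hP : σ.Unsaturated a b) :
    (pairDists G σ).Nonempty := by
  have h : 0 < (Finset.univ.filter fun i => σ.LR i ≠ none).card := by
    have := hσ.pairs
    simp only [ChamState.Unsaturated] at hP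
    omega
  obtain ⟨i, hi⟩ := Finset.card_pos.1 h
  have hi1 : σ.LR i ≠ none := (Finset.mem_filter.1 hi).2
  have hi2 : σ.LW i ≠ none := fun h => hi1 ((hσ.lab_iff i).2 h)
  obtain ⟨x, hx⟩ := Option.ne_none_iff_exists'.1 hi1
  obtain ⟨y, hy⟩ := Option.ne_none_iff_exists'.1 hi2
  exact ⟨_, i, x, y, hx, hy, rfl⟩

variable {G}

theorem exists_edge_of_adj {x z : Fin n} (h : G.Adj x z) :
    ∃ e : Edge G, (x = e.1.1 ∧ z = e.1.2) ∨ (x = e.1.2 ∧ z = e.1.1) := by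
  rcases lt_or_gt_of_ne h.ne with hlt | hlt
  · exact ⟨⟨(x, z), hlt, h⟩, Or.inl ⟨rfl, rfl⟩⟩
  · exact ⟨⟨(z, x), hlt, h.symm⟩, Or.inr ⟨rfl, rfl⟩⟩

theorem exists_adj_of_edge (hG : G.Connected) (e : Edge G) (x : Fin n) : ∃ z, G.Adj x z := by
  have : Nontrivial (Fin n) := ⟨⟨e.1.1, e.1.2, e.2.1.ne⟩⟩
  exact hG.preconnected.exists_adj_of_nontrivial x

/-- A state makes progress if it has more pink particles or a closer pair. -/
def Progress (G : SimpleGraph (Fin n)) (σ σ' : ChamState n N) : Prop :=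
  ∑ y, σ.P y < ∑ y, σ'.P y ∨ pairDist G σ' < pairDist G σ

/-- The edge is the first one on a shortest path from the red to the white particle of a closest
pair. It is chosen before `B'`, as it must be for a ring whose black variable is arbitrary. -/
theorem exists_progress (hG : G.Connected) (e₀ : Edge G) (ha : 0 < a) (hb : 0 < b)
    {σ : ChamState n N} (hσ : σ.Valid a b) (hP : σ.Unsaturated a b) :
    ∃ e : Edge G, ∀ B', IsSplit e.1 σ.B B' →
      ∃ σ' ∈ (chamKernel a b e.1 B' σ).support, Progress G σ σ' := by
  obtain ⟨i, x, y, hx, hy, hd⟩ := Nat.sInf_mem (pairDists_nonempty G hσ hP)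
  have hpair : ∀ e : Edge G, (x = e.1.1 ∨ x = e.1.2) → (y = e.1.1 ∨ y = e.1.2) → ∀ B',
      IsSplit e.1 σ.B B' → ∃ σ' ∈ (chamKernel a b e.1 B' σ).support, Progress G σ σ' := by
    intro e h1 h2 B' hB
    have hs : RingSetup a b e.1 B' σ := ⟨ha, hb, e.2.1.ne, hB, hσ⟩
    obtain ⟨σ', h3, h4⟩ := exists_pink hs hP ⟨Sum.inl i, Finset.mem_filter.2
      ⟨inl_mem_tokens.2 (by rw [hx]; simpa using h1), i, rfl,
        inl_mem_tokens.2 (by rw [hy]; simpa using h2)⟩⟩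
    exact ⟨σ', h3, Or.inl h4⟩
  -- A pair sitting at a single vertex is on every edge at that vertex.
  by_cases hxy : x = y
  · obtain ⟨z, hz⟩ := exists_adj_of_edge hG e₀ x
    obtain ⟨e, he⟩ := exists_edge_of_adj hz
    exact ⟨e, hpair e (by tauto) (by subst hxy; tauto)⟩
  · obtain ⟨w, hw⟩ := hG.exists_walk_length_eq_dist x y
    cases w with
    | nil => exact absurd rfl hxy
    | @cons _ z _ hadj p =>
      obtain ⟨e, he⟩ := exists_edge_of_adj hadj
      refine ⟨e, fun B' hB => ?_⟩
      have hs : RingSetup a b e.1 B' σ := ⟨ha, hb, e.2.1.ne, hB, hσ⟩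
      -- If any pair has both members on this edge, pinks may arise at once. Otherwise the red one
      -- can step to `z` while its partner, which is then off the edge, stays.
      rcases Finset.eq_empty_or_nonempty (pairedTokens a b e.1 σ) with h0 | h0
      · obtain ⟨σ', h1, h2, h3⟩ := exists_move hs h0 (i := i) (z := z)
          (by rw [hx]; simp only [Option.some.injEq]; tauto) (by tauto)
        refine ⟨σ', h1, Or.inr ?_⟩
        have h4 : pairDist G σ' ≤ G.dist z y := Nat.sInf_le ⟨i, z, y, h2, h3.trans hy, rfl⟩
        have h5 := SimpleGraph.dist_le p
        rw [SimpleGraph.Walk.length_cons] at hw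
        change _ < sInf (pairDists G σ)
        omega
      · obtain ⟨σ', h3, h4⟩ := exists_pink hs hP h0
        exact ⟨σ', h3, Or.inl h4⟩

end Progress

/-! ### Labels at the start of a round -/

section Relabel

variable {n N M : ℕ} {cnt : Fin n → ℕ}

/-- The indices of the labels at `v` lie in a block of `cnt v` consecutive integers. Index `j`
stands for the particle of rank `j + 1`, whence the strict inequality on the right. -/
theorem relabel_eq_some {j : Fin N} {v : Fin n} (h : relabel N cnt M j = some v) :
    (j : ℕ) < M ∧ ∑ k ∈ Finset.Iio v, cnt k ≤ j ∧ (j : ℕ) < ∑ k ∈ Finset.Iio v, cnt k + cnt v := by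
  rw [relabel] at h
  split_ifs at h with hj
  refine ⟨hj, ?_⟩
  rw [List.find?_eq_some_iff_append] at h
  obtain ⟨hp, as, bs, hl, has⟩ := h
  have hIic : ∑ k ∈ Finset.Iio v, cnt k + cnt v = ∑ k ∈ Finset.Iic v, cnt k := by
    rw [← Finset.Iio_insert, Finset.sum_insert (by simp), add_comm]
  have hlt : ∀ u < v, ∑ k ∈ Finset.Iic u, cnt k ≤ j := by
    intro u hu
    have hs := List.pairwise_lt_finRange n
    have hmem := List.mem_finRange u
    rw [hl] at hs hmem
    rw [List.pairwise_append, List.pairwise_cons] at hs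
    rw [List.mem_append, List.mem_cons] at hmem
    rcases hmem with h1 | h1 | h1
    · have := has u h1
      simp only [Bool.not_eq_true', decide_eq_false_iff_not] at this
      omega
    · exact absurd h1 hu.ne
    · exact absurd (hs.2.1.1 u h1) (not_lt.2 hu.le)
  constructor
  · by_cases hv : (v : ℕ) = 0
    · have : Finset.Iio v = ∅ := by
        ext u
        simp only [Finset.mem_Iio, Finset.notMem_empty, iff_false, not_lt, Fin.le_def]
        omega
      simp [this]
    · have h1 := hlt ⟨(v : ℕ) - 1, by omega⟩ (by simp only [Fin.lt_def]; omega)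
      have : Finset.Iio v = Finset.Iic (⟨(v : ℕ) - 1, by omega⟩ : Fin n) := by
        ext u
        simp only [Finset.mem_Iio, Finset.mem_Iic, Fin.le_def, Fin.lt_def]
        omega
      rwa [this]
  · rw [hIic]
    have := of_decide_eq_true hp
    omega

theorem card_relabel_le (v : Fin n) :
    (Finset.univ.filter fun j => relabel N cnt M j = some v).card ≤ cnt v := by
  have h : ((Finset.univ.filter fun j => relabel N cnt M j = some v).map Fin.valEmbedding).card ≤
      (Finset.Ico (∑ k ∈ Finset.Iio v, cnt k) (∑ k ∈ Finset.Iio v, cnt k + cnt v)).card := by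
    refine Finset.card_le_card fun i hi => ?_
    obtain ⟨j, hj, rfl⟩ := Finset.mem_map.1 hi
    exact Finset.mem_Ico.2 (relabel_eq_some (Finset.mem_filter.1 hj).2).2
  rw [Finset.card_map, Nat.card_Ico] at h
  omega

/-- At the last vertex the cumulative count is the full sum, which exceeds `j` when `j < M`, so the
search succeeds. -/
theorem relabel_eq_none (hM : M ≤ ∑ v, cnt v) (j : Fin N) :
    relabel N cnt M j = none ↔ ¬ (j : ℕ) < M := by
  rw [relabel]
  split_ifs with hj
  · simp only [hj, not_true_eq_false, iff_false]
    intro h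
    rw [List.find?_eq_none] at h
    have hn : 0 < n := by
      by_contra h0
      have : n = 0 := by omega
      subst this
      simp at hM
      omega
    have h1 := h ⟨n - 1, by omega⟩ (List.mem_finRange _)
    have h2 : Finset.Iic (⟨n - 1, by omega⟩ : Fin n) = Finset.univ := by
      ext u
      simp only [Finset.mem_Iic, Finset.mem_univ, iff_true, Fin.le_def]
      omega
    rw [h2] at h1
    simp only [decide_eq_true_eq] at h1
    omega
  · simp [hj]

theorem card_relabel_ne_none (hM : M ≤ ∑ v, cnt v) (hN : M ≤ N) :
    (Finset.univ.filter fun j => relabel N cnt M j ≠ none).card = M := by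
  simp only [ne_eq, relabel_eq_none hM, not_not]
  rw [Fin.card_filter_val_lt]
  omega

/-- A state with fresh labels is valid. -/
theorem valid_of_relabel {a b : ℕ} {σ : ChamState n N} (h1 : ∑ v, chi a b (σ.B v) = N)
    (h2 : ∀ v, σ.R v + σ.P v ≤ chi a b (σ.B v)) (hM : M = min (∑ v, σ.R v) (∑ v, σ.W a b v))
    (h3 : σ.LR = relabel N σ.R M) (h4 : σ.LW = relabel N (σ.W a b) M) : σ.Valid a b := by
  have hR : M ≤ ∑ v, σ.R v := hM ▸ min_le_left _ _
  have hW : M ≤ ∑ v, σ.W a b v := hM ▸ min_le_right _ _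
  have hRN : ∑ v, σ.R v ≤ N := by
    refine le_of_le_of_eq (Finset.sum_le_sum fun v _ => ?_) h1
    exact (Nat.le_add_right _ _).trans (h2 v)
  refine ⟨h1, h2, ?_, ?_, ?_, ?_⟩
  · intro v
    rw [h3]
    exact card_relabel_le v
  · intro v
    rw [h4]
    exact card_relabel_le v
  · intro i
    rw [h3, h4, relabel_eq_none hR, relabel_eq_none hW]
  · rw [h3, card_relabel_ne_none hR (hR.trans hRN), hM]

end Relabel

/-! ### The initial state and the end of a round -/

section RoundEnd

variable {a b n N : ℕ}

theorem sum_W_eq {σ : ChamState n N} (h1 : ∑ v, chi a b (σ.B v) = N)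
    (h2 : ∀ v, σ.R v + σ.P v ≤ chi a b (σ.B v)) :
    ∑ v, σ.W a b v = N - ∑ v, (σ.R v + σ.P v) := by
  have : ∑ v, σ.W a b v + ∑ v, (σ.R v + σ.P v) = N := by
    refine Eq.trans ?_ h1
    rw [← Finset.sum_add_distrib]
    refine Finset.sum_congr rfl fun v _ => ?_
    have := h2 v
    simp only [ChamState.W]
    omega
  omega

theorem valid_chamInit {ξ : Fin n → ℕ} (h1 : ∑ v, chi a b (ξ v) = N) (x : Fin n) :
    (chamInit a b N ξ x).Valid a b := by
  have h2 : ∀ v, (chamInit a b N ξ x).R v + (chamInit a b N ξ x).P v ≤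
      chi a b ((chamInit a b N ξ x).B v) := by
    intro v
    simp only [chamInit]
    split_ifs with h
    · rw [h]
      omega
    · omega
  have hR : ∑ v, (chamInit a b N ξ x).R v = chi a b (ξ x) := by
    simp [chamInit]
  have hW : (chamInit a b N ξ x).W a b = fun v => if v = x then 0 else chi a b (ξ v) := by
    funext v
    simp only [ChamState.W, chamInit]
    split_ifs with h
    · rw [h]
      omega
    · omega
  have hM : min (chi a b (ξ x)) (N - chi a b (ξ x)) =
      min (∑ v, (chamInit a b N ξ x).R v) (∑ v, (chamInit a b N ξ x).W a b v) := by
    rw [sum_W_eq (σ := chamInit a b N ξ x) h1 h2, Finset.sum_add_distrib, hR]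
    simp [chamInit]
  refine valid_of_relabel (M := min (chi a b (ξ x)) (N - chi a b (ξ x))) h1 h2 hM rfl ?_
  rw [hW]
  rfl

/-- The condition under which pink particles change colour at the end of a round. -/
def Saturated (a b : ℕ) (σ : ChamState n N) : Prop :=
  min (∑ v, σ.R v) (∑ v, σ.W a b v) ≤ ∑ v, σ.P v

theorem unsaturated_iff {σ : ChamState n N} : σ.Unsaturated a b ↔ ¬ Saturated a b σ :=
  not_le.symm

open Classical in
theorem roundEnd_R (d : Bool) (σ : ChamState n N) (v : Fin n) : (roundEnd a b d σ).R v =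
    if Saturated a b σ then σ.R v + (if d then σ.P v else 0) else σ.R v := by
  by_cases h : Saturated a b σ
  · rw [if_pos h]
    exact if_pos h
  · rw [if_neg h]
    exact if_neg h

open Classical in
theorem roundEnd_P (d : Bool) (σ : ChamState n N) (v : Fin n) : (roundEnd a b d σ).P v =
    if Saturated a b σ then 0 else σ.P v := by
  by_cases h : Saturated a b σ
  · rw [if_pos h]
    exact if_pos h
  · rw [if_neg h]
    exact if_neg h

theorem roundEnd_B (d : Bool) (σ : ChamState n N) : (roundEnd a b d σ).B = σ.B := rfl

theorem valid_roundEnd {σ : ChamState n N} (h : σ.Valid a b) (d : Bool) :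
    (roundEnd a b d σ).Valid a b := by
  have h2 : ∀ v, (roundEnd a b d σ).R v + (roundEnd a b d σ).P v ≤
      chi a b ((roundEnd a b d σ).B v) := by
    intro v
    have := h.le v
    rw [roundEnd_R, roundEnd_P, roundEnd_B]
    split_ifs <;> omega
  refine valid_of_relabel (M := min (∑ v, (roundEnd a b d σ).R v)
    (N - ∑ v, ((roundEnd a b d σ).R v + (roundEnd a b d σ).P v))) h.chi_sum h2 ?_ rfl rfl
  rw [sum_W_eq (σ := roundEnd a b d σ) h.chi_sum h2]

/-- Twice the total ink. -/
def ChamState.total (σ : ChamState n N) : ℕ := 2 * ∑ v, σ.R v + ∑ v, σ.P v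

theorem ChamState.totalInk_eq (σ : ChamState n N) : σ.totalInk = (σ.total : ℝ) / 2 := by
  simp only [ChamState.totalInk, ChamState.ink, ChamState.total, Finset.sum_add_distrib,
    ← Finset.sum_div]
  push_cast
  ring

theorem ChamState.ink_eq (σ : ChamState n N) (v : Fin n) : σ.ink v = (σ.twoInk v : ℝ) / 2 := by
  simp only [ChamState.ink, ChamState.twoInk]
  push_cast
  ring

theorem ChamState.Valid.total_le {σ : ChamState n N} (h : σ.Valid a b) : σ.total ≤ 2 * N := by
  have := h.sum_W
  simp only [ChamState.total]
  omega

open Classical in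
/-- The number of particles that change colour at the end of a round. -/
def depinked (a b : ℕ) (σ : ChamState n N) : ℕ := if Saturated a b σ then ∑ v, σ.P v else 0

theorem roundEnd_total (d : Bool) (σ : ChamState n N) : ((roundEnd a b d σ).total : ℤ) =
    σ.total + (if d then 1 else -1) * depinked a b σ := by
  simp only [ChamState.total, depinked, roundEnd_R, roundEnd_P]
  by_cases h : Saturated a b σ
  · cases d
    · simp [h]
    · simp [h, Finset.sum_add_distrib]
      ring
  · simp [h]

/-- Averaged over the coin, the end of a round leaves the ink at every single vertex unchanged, not
only the total. -/
theorem roundEnd_twoInk_add (σ : ChamState n N) (v : Fin n) :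
    (roundEnd a b true σ).twoInk v + (roundEnd a b false σ).twoInk v = 2 * σ.twoInk v := by
  simp only [ChamState.twoInk, roundEnd_R, roundEnd_P]
  by_cases h : Saturated a b σ
  · simp only [h, if_true, Bool.false_eq_true, if_false]
    ring
  · simp only [h, if_false]
    ring

theorem roundEnd_sum_P_of_unsaturated (d : Bool) {σ : ChamState n N} (h : σ.Unsaturated a b) :
    ∑ v, (roundEnd a b d σ).P v = ∑ v, σ.P v := by
  simp only [roundEnd_P, if_neg (unsaturated_iff.1 h)]

end RoundEnd

/-! ### Pathwise properties of the processes -/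

section Path

variable {a b n N : ℕ} {G : SimpleGraph (Fin n)} (D : Drive G)

theorem chamRun_of_le {i k : ℕ} (h : k ≤ i) (σ : ChamState n N) : chamRun a b D i k σ = σ := by
  simp [chamRun, Nat.sub_eq_zero_of_le h]

theorem chamRun_succ {i k : ℕ} (h : i ≤ k) (σ : ChamState n N) :
    chamRun a b D i (k + 1) σ = chamRing a b D k (chamRun a b D i k σ) := by
  rw [chamRun, chamRun, Nat.succ_sub h, List.range'_1_concat, List.foldl_append]
  simp [Nat.add_sub_cancel' h]

/-- The configuration to which the black particles move at the `k`-th ring. -/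
abbrev nextBlack (a b : ℕ) (D : Drive G) (k : ℕ) (B : Fin n → ℕ) : Fin n → ℕ :=
  mabb ((b : ℝ) / a) (D.ub k) (D.edge k).1 B

theorem ringSetup (ha : 0 < a) (hb : 0 < b) {σ : ChamState n N} (h : σ.Valid a b) (k : ℕ) :
    RingSetup a b (D.edge k).1 (nextBlack a b D k σ.B) σ :=
  ⟨ha, hb, (D.edge k).2.1.ne, isSplit_mabb _ _ (D.edge k).2.1.ne _, h⟩

theorem chamRing_mem_support (k : ℕ) (σ : ChamState n N) : chamRing a b D k σ ∈
    (chamKernel a b (D.edge k).1 (nextBlack a b D k σ.B) σ).support :=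
  samplePMF_mem_support (finite_support_chamKernel _ _ _ _ _) _

theorem ringStep_chamRing (ha : 0 < a) (hb : 0 < b) {σ : ChamState n N} (h : σ.Valid a b) (k : ℕ) :
    RingStep a b (nextBlack a b D k σ.B) σ (chamRing a b D k σ) :=
  ringStep (ringSetup D ha hb h k) (chamRing_mem_support D k σ)

/-- A pair that turns pink replaces one unit of ink by two halves. -/
theorem RingStep.total {B' : Fin n → ℕ} {σ σ' : ChamState n N} (h : RingStep a b B' σ σ') :
    σ'.total = σ.total := by
  obtain ⟨k, h1, h2, h3⟩ := h.totals
  simp only [ChamState.total]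
  omega

theorem RingStep.sum_P_le {B' : Fin n → ℕ} {σ σ' : ChamState n N} (h : RingStep a b B' σ σ') :
    ∑ v, σ.P v ≤ ∑ v, σ'.P v := by
  obtain ⟨k, h1, h2, h3⟩ := h.totals
  omega

/-- Within a round pinks only increase while reds and whites only decrease, so the property passes
backwards in time. -/
theorem RingStep.unsaturated {B' : Fin n → ℕ} {σ σ' : ChamState n N} (h : RingStep a b B' σ σ')
    (h' : σ'.Unsaturated a b) : σ.Unsaturated a b := by
  obtain ⟨k, h1, h2, h3⟩ := h.totals
  simp only [ChamState.Unsaturated] at *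
  omega

theorem valid_chamRun (ha : 0 < a) (hb : 0 < b) {σ : ChamState n N} (h : σ.Valid a b) (i k : ℕ) :
    (chamRun a b D i k σ).Valid a b := by
  induction k with
  | zero => rwa [chamRun_of_le D (Nat.zero_le i)]
  | succ k ih =>
    rcases le_or_gt i k with hik | hik
    · rw [chamRun_succ D hik]
      exact (ringStep_chamRing D ha hb ih k).valid
    · rwa [chamRun_of_le D hik]

theorem total_chamRun (ha : 0 < a) (hb : 0 < b) {σ : ChamState n N} (h : σ.Valid a b) (i k : ℕ) :
    (chamRun a b D i k σ).total = σ.total := by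
  induction k with
  | zero => rw [chamRun_of_le D (Nat.zero_le i)]
  | succ k ih =>
    rcases le_or_gt i k with hik | hik
    · rw [chamRun_succ D hik, (ringStep_chamRing D ha hb (valid_chamRun D ha hb h i k) k).total, ih]
    · rw [chamRun_of_le D hik]

variable (T : ℝ) (ξ : Fin n → ℕ) (x : Fin n)

/-- The state before the `k`-th ring, if that ring is in the `j`-th round. -/
def preRing (a b N : ℕ) (D : Drive G) (T : ℝ) (ξ : Fin n → ℕ) (x : Fin n) (j k : ℕ) :
    ChamState n N :=
  chamRun a b D (ringCount D (j * T)) k (chamRound a b N D T ξ x j)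

/-- The state at the end of the `j`-th round. -/
def roundLast (a b N : ℕ) (D : Drive G) (T : ℝ) (ξ : Fin n → ℕ) (x : Fin n) (j : ℕ) :
    ChamState n N :=
  preRing a b N D T ξ x j (ringCount D ((j + 1) * T))

theorem chamRound_succ (j : ℕ) : chamRound a b N D T ξ x (j + 1) =
    roundEnd a b (D.coin j) (roundLast a b N D T ξ x j) := rfl

variable {ξ}

theorem valid_chamRound (ha : 0 < a) (hb : 0 < b) (hξ : ∑ v, chi a b (ξ v) = N) (j : ℕ) :
    (chamRound a b N D T ξ x j).Valid a b := by
  induction j with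
  | zero => exact valid_chamInit hξ x
  | succ j ih => exact valid_roundEnd (valid_chamRun D ha hb ih _ _) _

theorem valid_preRing (ha : 0 < a) (hb : 0 < b) (hξ : ∑ v, chi a b (ξ v) = N) (j k : ℕ) :
    (preRing a b N D T ξ x j k).Valid a b :=
  valid_chamRun D ha hb (valid_chamRound D T x ha hb hξ j) _ _

theorem total_preRing (ha : 0 < a) (hb : 0 < b) (hξ : ∑ v, chi a b (ξ v) = N) (j k : ℕ) :
    (preRing a b N D T ξ x j k).total = (chamRound a b N D T ξ x j).total :=
  total_chamRun D ha hb (valid_chamRound D T x ha hb hξ j) _ _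

theorem inkAt_eq (ha : 0 < a) (hb : 0 < b) (hξ : ∑ v, chi a b (ξ v) = N) (t : ℝ) :
    inkAt a b N D T ξ x t = ((chamRound a b N D T ξ x ⌊t / T⌋₊).total : ℝ) / 2 := by
  rw [inkAt, ChamState.totalInk_eq]
  exact congrArg (fun k : ℕ => (k : ℝ) / 2)
    (total_chamRun D ha hb (valid_chamRound D T x ha hb hξ _) _ _)

theorem preRing_succ {j k : ℕ} (h : ringCount D (j * T) ≤ k) :
    preRing a b N D T ξ x j (k + 1) = chamRing a b D k (preRing a b N D T ξ x j k) :=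
  chamRun_succ D h _

theorem preRing_of_le {j k : ℕ} (h : k ≤ ringCount D (j * T)) :
    preRing a b N D T ξ x j k = chamRound a b N D T ξ x j :=
  chamRun_of_le D h _

/-- Filling up is decided at the ends of the rounds. -/
theorem tendsto_inkAt_iff (ha : 0 < a) (hb : 0 < b) (hξ : ∑ v, chi a b (ξ v) = N) (hT : 0 < T) :
    Tendsto (fun t : ℝ => inkAt a b N D T ξ x t) atTop (𝓝 (N : ℝ)) ↔
      ∃ J, ∀ j ≥ J, (chamRound a b N D T ξ x j).total = 2 * N := by
  simp only [inkAt_eq D T x ha hb hξ]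
  constructor
  · intro h
    have h1 : Tendsto (fun j : ℕ => (j : ℝ) * T) atTop atTop :=
      tendsto_natCast_atTop_atTop.atTop_mul_const hT
    have h2 := h.comp h1
    rw [Metric.tendsto_atTop] at h2
    -- Ink takes values in halves and is at most `N`; closer to `N` than `1/2` means equal to `N`.
    obtain ⟨J, hJ⟩ := h2 (1 / 2) (by norm_num)
    refine ⟨J, fun j hj => ?_⟩
    have h3 := hJ j hj
    have h4 : ⌊(j : ℝ) * T / T⌋₊ = j := by
      rw [mul_div_cancel_right₀ _ hT.ne', Nat.floor_natCast]
    simp only [Function.comp, h4, Real.dist_eq] at h3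
    rw [abs_lt] at h3
    have h5 : (2 * N : ℝ) - 1 < ((chamRound a b N D T ξ x j).total : ℝ) := by linarith
    have h6 : (2 * N : ℕ) < (chamRound a b N D T ξ x j).total + 1 := by
      have : ((2 * N : ℕ) : ℝ) < (((chamRound a b N D T ξ x j).total + 1 : ℕ) : ℝ) := by
        push_cast
        linarith
      exact_mod_cast this
    have := (valid_chamRound D T x ha hb hξ j).total_le
    omega
  · rintro ⟨J, hJ⟩
    refine tendsto_const_nhds.congr' ?_
    filter_upwards [eventually_ge_atTop ((J : ℝ) * T)] with t ht
    rw [hJ _ (Nat.le_floor (by rwa [le_div_iff₀ hT]))]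
    push_cast
    ring

/-- Only finitely many rings happen in bounded time. -/
def Regular (D : Drive G) : Prop := ∀ t : ℝ, {k : ℕ | ringTime D k ≤ t}.Finite

variable {D}

/-- `Set.ncard` is 0 on infinite sets, so without regularity the count could fall back to 0. -/
theorem Regular.ringCount_mono (hD : Regular D) {t t' : ℝ} (h : t ≤ t') :
    ringCount D t ≤ ringCount D t' :=
  Set.ncard_le_ncard (fun _ hk => le_trans hk h) (hD t')

theorem Regular.round_le (hD : Regular D) (hT : 0 < T) (j : ℕ) :
    ringCount D (j * T) ≤ ringCount D ((j + 1) * T) :=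
  hD.ringCount_mono (by nlinarith)

variable (D)

theorem black_chamRun (ha : 0 < a) (hb : 0 < b) {σ : ChamState n N} (h : σ.Valid a b) {i k : ℕ}
    (hik : i ≤ k) (hB : σ.B = (mabbSkeleton ((b : ℝ) / a) D ξ x i).1) :
    (chamRun a b D i k σ).B = (mabbSkeleton ((b : ℝ) / a) D ξ x k).1 := by
  induction k, hik using Nat.le_induction with
  | base => rwa [chamRun_of_le D le_rfl]
  | succ k hk ih =>
    rw [chamRun_succ D hk, (ringStep_chamRing D ha hb (valid_chamRun D ha hb h i k) k).black, ih]
    rfl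

theorem black_chamRound (ha : 0 < a) (hb : 0 < b) (hξ : ∑ v, chi a b (ξ v) = N) (hT : 0 < T)
    (hD : Regular D) (h0 : ringCount D 0 = 0) (j : ℕ) : (chamRound a b N D T ξ x j).B =
      (mabbSkeleton ((b : ℝ) / a) D ξ x (ringCount D (j * T))).1 := by
  induction j with
  | zero =>
    rw [Nat.cast_zero, zero_mul, h0]
    rfl
  | succ j ih =>
    rw [chamRound_succ, roundEnd_B, roundLast, preRing, Nat.cast_add_one]
    exact black_chamRun D x ha hb (valid_chamRound D T x ha hb hξ j) (hD.round_le T hT j) ih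

theorem black_preRing (ha : 0 < a) (hb : 0 < b) (hξ : ∑ v, chi a b (ξ v) = N) (hT : 0 < T)
    (hD : Regular D) (h0 : ringCount D 0 = 0) {j k : ℕ} (hk : ringCount D (j * T) ≤ k) :
    (preRing a b N D T ξ x j k).B = (mabbSkeleton ((b : ℝ) / a) D ξ x k).1 :=
  black_chamRun D x ha hb (valid_chamRound D T x ha hb hξ j) hk
    (black_chamRound D T x ha hb hξ hT hD h0 j)

/-! ### Dependence on the graphical construction -/

theorem chamRun_congr {D D' : Drive G} {i k : ℕ} (he : ∀ l < k, D.edge l = D'.edge l)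
    (hu : ∀ l < k, D.ub l = D'.ub l) (hc : ∀ l < k, D.uc l = D'.uc l) (σ : ChamState n N) :
    chamRun a b D i k σ = chamRun a b D' i k σ := by
  induction k with
  | zero => rw [chamRun_of_le _ (Nat.zero_le i), chamRun_of_le _ (Nat.zero_le i)]
  | succ k ih =>
    rcases le_or_gt i k with hik | hik
    · rw [chamRun_succ _ hik, chamRun_succ _ hik, ih (fun l hl => he l (by omega))
        (fun l hl => hu l (by omega)) (fun l hl => hc l (by omega)), chamRing, chamRing,
        he k (by omega), hu k (by omega), hc k (by omega)]
    · rw [chamRun_of_le _ hik, chamRun_of_le _ hik]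

theorem ringCount_congr {D D' : Drive G} (hg : D.gap = D'.gap) (t : ℝ) :
    ringCount D t = ringCount D' t := by
  simp only [ringCount, ringTime, hg]

variable (ξ)

/-- Adaptedness of the process: given all gaps, the start of round `j` depends only on the variables
of earlier rings and on the first `j` coins. Resampling a later variable therefore has no effect on
it. -/
theorem chamRound_congr {D D' : Drive G} (hT : 0 < T) (hD : Regular D) (hg : D.gap = D'.gap)
    {j k : ℕ} (hk : ringCount D (j * T) ≤ k) (he : ∀ l < k, D.edge l = D'.edge l)
    (hu : ∀ l < k, D.ub l = D'.ub l) (hc : ∀ l < k, D.uc l = D'.uc l)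
    (hd : ∀ l < j, D.coin l = D'.coin l) :
    chamRound a b N D T ξ x j = chamRound a b N D' T ξ x j := by
  induction j with
  | zero => rfl
  | succ j ih =>
    rw [Nat.cast_add_one] at hk
    have h1 := (hD.round_le T hT j).trans hk
    rw [chamRound_succ, chamRound_succ, roundLast, roundLast, preRing, preRing,
      ih h1 fun l hl => hd l (by omega), hd j (by omega), ← ringCount_congr hg,
      ← ringCount_congr hg, chamRun_congr (fun l hl => he l (by omega))
        (fun l hl => hu l (by omega)) (fun l hl => hc l (by omega))]

theorem preRing_congr {D D' : Drive G} (hT : 0 < T) (hD : Regular D) (hg : D.gap = D'.gap)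
    {j k : ℕ} (hk : ringCount D (j * T) ≤ k) (he : ∀ l < k, D.edge l = D'.edge l)
    (hu : ∀ l < k, D.ub l = D'.ub l) (hc : ∀ l < k, D.uc l = D'.uc l)
    (hd : ∀ l < j, D.coin l = D'.coin l) :
    preRing a b N D T ξ x j k = preRing a b N D' T ξ x j k := by
  rw [preRing, preRing, chamRound_congr T ξ x hT hD hg hk he hu hc hd, ← ringCount_congr hg,
    chamRun_congr he hu hc]

/-- Later coin flips do not matter for a round. -/
theorem chamRound_congr_coin {D D' : Drive G} (hg : D.gap = D'.gap) (he : D.edge = D'.edge)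
    (hu : D.ub = D'.ub) (hc : D.uc = D'.uc) {j : ℕ} (hd : ∀ l < j, D.coin l = D'.coin l) :
    chamRound a b N D T ξ x j = chamRound a b N D' T ξ x j := by
  induction j with
  | zero => rfl
  | succ j ih =>
    rw [chamRound_succ, chamRound_succ, roundLast, roundLast, preRing, preRing,
      ih fun l hl => hd l (by omega), hd j (by omega), ← ringCount_congr hg,
      ← ringCount_congr hg, chamRun_congr (fun l _ => congrFun he l)
        (fun l _ => congrFun hu l) (fun l _ => congrFun hc l)]

theorem roundLast_congr_coin {D D' : Drive G} (hg : D.gap = D'.gap) (he : D.edge = D'.edge)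
    (hu : D.ub = D'.ub) (hc : D.uc = D'.uc) {j : ℕ} (hd : ∀ l < j, D.coin l = D'.coin l) :
    roundLast a b N D T ξ x j = roundLast a b N D' T ξ x j := by
  rw [roundLast, roundLast, preRing, preRing, chamRound_congr_coin T ξ x hg he hu hc hd,
    ← ringCount_congr hg, ← ringCount_congr hg, chamRun_congr (fun l _ => congrFun he l)
        (fun l _ => congrFun hu l) (fun l _ => congrFun hc l)]

theorem mabbSkeleton_congr (s : ℝ) {D D' : Drive G} {k : ℕ} (he : ∀ l < k, D.edge l = D'.edge l)
    (hu : ∀ l < k, D.ub l = D'.ub l) (hc : ∀ l < k, D.uc l = D'.uc l) :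
    mabbSkeleton s D ξ x k = mabbSkeleton s D' ξ x k := by
  induction k with
  | zero => rfl
  | succ k ih =>
    simp only [mabbSkeleton]
    rw [ih (fun l hl => he l (by omega)) (fun l hl => hu l (by omega))
      (fun l hl => hc l (by omega)), he k (by omega), hu k (by omega), hc k (by omega)]

theorem mabbSkeleton_fst_congr (s : ℝ) {D D' : Drive G} (he : D.edge = D'.edge)
    (hu : D.ub = D'.ub) (k : ℕ) :
    (mabbSkeleton s D ξ x k).1 = (mabbSkeleton s D' ξ x k).1 := by
  induction k with
  | zero => rfl
  | succ k ih =>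
    simp only [mabbSkeleton]
    rw [ih, he, hu]

theorem sum_mabbSkeleton (s : ℝ) (D : Drive G) (k : ℕ) :
    ∑ v, (mabbSkeleton s D ξ x k).1 v = ∑ v, ξ v := by
  induction k with
  | zero => rfl
  | succ k ih =>
    rw [← ih]
    exact IsSplit.sum_eq (D.edge k).2.1.ne (isSplit_mabb _ _ (D.edge k).2.1.ne _)

end Path

/-! ### Independent sequences -/

section Sequences

variable {α β : Type*} [MeasurableSpace α] [MeasurableSpace β]

/-- The law of a sequence of independent variables with law `ν`. -/
abbrev seqLaw (ν : Measure α) [IsProbabilityMeasure ν] : Measure (ℕ → α) :=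
  Measure.infinitePi fun _ => ν

theorem measurable_unzip :
    Measurable fun f : ℕ → α × β => ((fun k => (f k).1, fun k => (f k).2) : (ℕ → α) × (ℕ → β)) := by
  fun_prop

/-- The components of a sequence of independent pairs with independent components are independent
sequences. -/
theorem measurePreserving_unzip (ν : Measure α) (ν' : Measure β) [IsProbabilityMeasure ν]
    [IsProbabilityMeasure ν'] :
    MeasurePreserving
      (fun f : ℕ → α × β => ((fun k => (f k).1, fun k => (f k).2) : (ℕ → α) × (ℕ → β)))
      (seqLaw (ν.prod ν')) ((seqLaw ν).prod (seqLaw ν')) := by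
  classical
  refine ⟨measurable_unzip, ?_⟩
  have hspan1 : (seqLaw ν).FiniteSpanningSetsIn
      (squareCylinders fun _ : ℕ => {s : Set α | MeasurableSet s}) :=
    ⟨fun _ => Set.univ, fun _ => ⟨∅, fun _ => Set.univ, fun _ _ => MeasurableSet.univ, by simp⟩,
      fun _ => measure_lt_top _ _, Set.iUnion_const _⟩
  have hspan2 : (seqLaw ν').FiniteSpanningSetsIn
      (squareCylinders fun _ : ℕ => {s : Set β | MeasurableSet s}) :=
    ⟨fun _ => Set.univ, fun _ => ⟨∅, fun _ => Set.univ, fun _ _ => MeasurableSet.univ, by simp⟩,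
      fun _ => measure_lt_top _ _, Set.iUnion_const _⟩
  -- A product law is determined by rectangles of cylinder sets, and on these both sides are finite
  -- products.
  refine (Measure.prod_eq_generateFrom generateFrom_squareCylinders generateFrom_squareCylinders
    (isPiSystem_squareCylinders (fun _ => MeasurableSpace.isPiSystem_measurableSet) (by simp))
    (isPiSystem_squareCylinders (fun _ => MeasurableSpace.isPiSystem_measurableSet) (by simp))
    hspan1 hspan2 ?_).symm
  rintro _ ⟨s, t, ht, rfl⟩ _ ⟨s', t', ht', rfl⟩
  simp only [Set.mem_pi, Set.mem_univ, true_implies, Set.mem_ofPred_eq] at ht ht'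
  have hm1 : MeasurableSet ((s : Set ℕ).pi t) := MeasurableSet.pi s.countable_toSet fun i _ => ht i
  have hm2 : MeasurableSet ((s' : Set ℕ).pi t') :=
    MeasurableSet.pi s'.countable_toSet fun i _ => ht' i
  rw [Measure.map_apply measurable_unzip (hm1.prod hm2)]
  have hpre : (fun f : ℕ → α × β => ((fun k => (f k).1, fun k => (f k).2) : (ℕ → α) × (ℕ → β))) ⁻¹'
      ((s : Set ℕ).pi t ×ˢ (s' : Set ℕ).pi t') = ((s ∪ s' : Finset ℕ) : Set ℕ).pi fun k =>
        (if k ∈ s then t k else Set.univ) ×ˢ (if k ∈ s' then t' k else Set.univ) := by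
    ext f
    simp only [Set.mem_preimage, Set.mem_prod, Set.mem_pi, Finset.coe_union, Set.mem_union,
      Finset.mem_coe]
    constructor
    · rintro ⟨h1, h2⟩ k -
      constructor
      · split_ifs with hk
        exacts [h1 k hk, trivial]
      · split_ifs with hk
        exacts [h2 k hk, trivial]
    · intro h
      refine ⟨fun k hk => ?_, fun k hk => ?_⟩
      · have := (h k (Or.inl hk)).1
        rwa [if_pos hk] at this
      · have := (h k (Or.inr hk)).2
        rwa [if_pos hk] at this
  rw [hpre, seqLaw, Measure.infinitePi_pi, seqLaw, seqLaw, Measure.infinitePi_pi,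
    Measure.infinitePi_pi]
  · simp only [Measure.prod_prod, Finset.prod_mul_distrib]
    congr 1
    · rw [← Finset.prod_subset Finset.subset_union_left (fun k _ hk => by simp [hk])]
      exact Finset.prod_congr rfl fun k hk => by rw [if_pos hk]
    · rw [← Finset.prod_subset Finset.subset_union_right (fun k _ hk => by simp [hk])]
      exact Finset.prod_congr rfl fun k hk => by rw [if_pos hk]
  · exact fun i _ => ht' i
  · exact fun i _ => ht i
  · intro i _
    refine MeasurableSet.prod ?_ ?_
    · split_ifs
      exacts [ht i, MeasurableSet.univ]
    · split_ifs
      exacts [ht' i, MeasurableSet.univ]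

/-- Replacing the `k`-th entry by an independent copy does not change the law of the sequence. -/
theorem measurePreserving_update (ν : Measure α) [IsProbabilityMeasure ν] (k : ℕ) :
    MeasurePreserving (fun p : (ℕ → α) × α => Function.update p.1 k p.2)
      ((seqLaw ν).prod ν) (seqLaw ν) := by
  classical
  have hm : Measurable fun p : (ℕ → α) × α => Function.update p.1 k p.2 := measurable_update'
  refine ⟨hm, Measure.eq_infinitePi _ ?_⟩
  intro s t ht
  have hmt : MeasurableSet ((s : Set ℕ).pi t) := MeasurableSet.pi s.countable_toSet fun i _ => ht i
  rw [Measure.map_apply hm hmt]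
  have hpre : (fun p : (ℕ → α) × α => Function.update p.1 k p.2) ⁻¹' ((s : Set ℕ).pi t) =
      ((s.erase k : Finset ℕ) : Set ℕ).pi t ×ˢ (if k ∈ s then t k else Set.univ) := by
    ext p
    simp only [Set.mem_preimage, Set.mem_pi, Finset.mem_coe, Set.mem_prod, Finset.mem_erase]
    constructor
    · intro h
      refine ⟨fun i hi => ?_, ?_⟩
      · have := h i hi.2
        rwa [Function.update_of_ne hi.1] at this
      · split_ifs with hk
        · have := h k hk
          rwa [Function.update_self] at this
        · trivial
    · rintro ⟨h1, h2⟩ i hi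
      by_cases hik : i = k
      · subst hik
        rw [if_pos hi] at h2
        rwa [Function.update_self]
      · rw [Function.update_of_ne hik]
        exact h1 i ⟨hik, hi⟩
  rw [hpre, Measure.prod_prod, seqLaw, Measure.infinitePi_pi _ fun i _ => ht i]
  by_cases hk : k ∈ s
  · rw [if_pos hk, Finset.prod_erase_mul _ _ hk]
  · rw [if_neg hk, measure_univ, mul_one, Finset.erase_eq_of_notMem hk]

end Sequences

/-! ### Replacing one variable by an independent copy -/

section Resample

variable {Θ Θ' Y Y' : Type*} [MeasurableSpace Θ] [MeasurableSpace Θ'] [MeasurableSpace Y]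
  [MeasurableSpace Y'] {P : Measure Θ} {P' : Measure Θ'} {ν : Measure Y} {ν' : Measure Y'}
  [SFinite P] [SFinite P'] [SFinite ν] [SFinite ν']

/-- Replacing part of `θ` by means of an independent variable does not change the law. -/
def Resamples (P : Measure Θ) (ν : Measure Y) (Φ : Θ → Y → Θ) : Prop :=
  MeasurePreserving (fun p : Θ × Y => Φ p.1 p.2) (P.prod ν) P

theorem Resamples.right {Φ : Θ → Y → Θ} (h : Resamples P ν Φ) (P' : Measure Θ') [SFinite P'] :
    Resamples (P'.prod P) ν fun θ y => (θ.1, Φ θ.2 y) :=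
  ((MeasurePreserving.id P').prod h).comp (measurePreserving_prodAssoc P' P ν)

theorem Resamples.left {Φ : Θ → Y → Θ} (h : Resamples P ν Φ) (P' : Measure Θ') [SFinite P'] :
    Resamples (P.prod P') ν fun θ y => (Φ θ.1 y, θ.2) := by
  have h1 := h.right P'
  have h2 : MeasurePreserving (fun p : (Θ × Θ') × Y => (p.1.swap, p.2)) ((P.prod P').prod ν)
      ((P'.prod P).prod ν) := Measure.measurePreserving_swap.prod (MeasurePreserving.id ν)
  exact (Measure.measurePreserving_swap.comp h1).comp h2

/-- Used to resample the edge and the colour variable of a ring together. -/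
theorem Resamples.trans {Φ : Θ → Y → Θ} {Φ' : Θ → Y' → Θ} (h : Resamples P ν Φ)
    (h' : Resamples P ν' Φ') :
    Resamples P (ν.prod ν') fun θ y => Φ' (Φ θ y.1) y.2 := by
  have h1 : MeasurePreserving (fun p : (Θ × Y) × Y' => (Φ p.1.1 p.1.2, p.2))
      ((P.prod ν).prod ν') (P.prod ν') := MeasurePreserving.prod h (MeasurePreserving.id ν')
  have h2 : MeasurePreserving (MeasurableEquiv.prodAssoc.symm : Θ × Y × Y' → (Θ × Y) × Y')
      (P.prod (ν.prod ν')) ((P.prod ν).prod ν') :=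
    (measurePreserving_prodAssoc P ν ν').symm _
  exact (MeasurePreserving.comp h' h1).comp h2

omit [SFinite P] in
theorem Resamples.lintegral {Φ : Θ → Y → Θ} (h : Resamples P ν Φ) {f : Θ → ENNReal}
    (hf : Measurable f) : ∫⁻ θ, f θ ∂P = ∫⁻ θ, ∫⁻ y, f (Φ θ y) ∂ν ∂P := by
  rw [← h.lintegral_comp hf, lintegral_prod (fun p => f (Φ p.1 p.2)) (hf.comp h.measurable).aemeasurable]

theorem resamples_update {α : Type*} [MeasurableSpace α] (ν : Measure α) [IsProbabilityMeasure ν]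
    (k : ℕ) : Resamples (seqLaw ν) ν fun f y => Function.update f k y :=
  measurePreserving_update ν k

end Resample

/-! ### Runs of likely events -/

section Past

variable {Θ Y : Type*} {Φ : ℕ → Θ → Y → Θ}

/-- The event `A` does not depend on what is resampled at times `k, k + 1, …`. -/
def Past (Φ : ℕ → Θ → Y → Θ) (k : ℕ) (A : Set Θ) : Prop :=
  ∀ l ≥ k, ∀ θ y, Φ l θ y ∈ A ↔ θ ∈ A

theorem Past.mono {k l : ℕ} {A : Set Θ} (h : Past Φ k A) (hkl : k ≤ l) : Past Φ l A :=
  fun i hi => h i (hkl.trans hi)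

theorem Past.inter {k : ℕ} {A A' : Set Θ} (h : Past Φ k A) (h' : Past Φ k A') :
    Past Φ k (A ∩ A') := fun l hl θ y => and_congr (h l hl θ y) (h' l hl θ y)

theorem past_run {s : ℕ} {R : ℕ → Set Θ} {L : ℕ} (hpast : ∀ l < L, Past Φ (s + l + 1) (R l)) :
    Past Φ (s + L) {θ | ∀ l < L, θ ∈ R l} := fun i hi θ y =>
  forall_congr' fun l => forall_congr' fun hl => hpast l hl i (by omega) θ y

end Past

section Runs

variable {Θ Y : Type*} [MeasurableSpace Θ] [MeasurableSpace Y] {P : Measure Θ} {ν : Measure Y}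
  [IsProbabilityMeasure P] [SFinite ν] {Φ : ℕ → Θ → Y → Θ}

omit [IsProbabilityMeasure P] in
-- Replaces a conditional probability: resampling at `k` keeps the law and does not affect the past
-- event `A`, and for each fixed `θ` it produces `R` with probability at least `ε`.
theorem mul_le_measure_inter (hΦ : ∀ k, Resamples P ν (Φ k)) {k : ℕ} {A R : Set Θ}
    (hA : MeasurableSet A) (hR : MeasurableSet R) (hpast : Past Φ k A) {ε : ENNReal}
    (hε : ∀ θ, ε ≤ ν {y | Φ k θ y ∈ R}) : ε * P A ≤ P (A ∩ R) := by
  have h1 : P (A ∩ R) = ∫⁻ θ, (A ∩ R).indicator 1 θ ∂P := by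
    rw [lintegral_indicator_one (hA.inter hR)]
  rw [h1, (hΦ k).lintegral (measurable_one.indicator (hA.inter hR)),
    ← lintegral_indicator_const hA]
  refine lintegral_mono fun θ => ?_
  by_cases hθ : θ ∈ A
  · rw [Set.indicator_of_mem hθ]
    refine (hε θ).trans_eq ?_
    have hm : Measurable (Φ k θ) := (hΦ k).measurable.comp measurable_prodMk_left
    have h2 : ∀ y, (A ∩ R).indicator (1 : Θ → ENNReal) (Φ k θ y) =
        (Φ k θ ⁻¹' R).indicator 1 y := by
      intro y
      have h3 := (hpast k le_rfl θ y).2 hθ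
      by_cases h4 : Φ k θ y ∈ R
      · rw [Set.indicator_of_mem (Set.mem_inter h3 h4), Set.indicator_of_mem (by exact h4)]
        rfl
      · rw [Set.indicator_of_notMem fun h => h4 h.2, Set.indicator_of_notMem (by exact h4)]
    simp only [h2]
    rw [lintegral_indicator_one (hm hR)]
    rfl
  · rw [Set.indicator_of_notMem hθ]
    exact zero_le

theorem measurableSet_run {R : ℕ → Set Θ} (hR : ∀ l, MeasurableSet (R l)) (L : ℕ) :
    MeasurableSet {θ | ∀ l < L, θ ∈ R l} := by
  have : {θ | ∀ l < L, θ ∈ R l} = ⋂ l, ⋂ (_ : l < L), R l := by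
    ext θ
    simp
  rw [this]
  exact MeasurableSet.iInter fun l => MeasurableSet.iInter fun _ => hR l

omit [IsProbabilityMeasure P] in
theorem pow_mul_le_measure_run (hΦ : ∀ k, Resamples P ν (Φ k)) {s : ℕ} {A : Set Θ} {R : ℕ → Set Θ}
    (hA : MeasurableSet A) (hR : ∀ l, MeasurableSet (R l)) (hpastA : Past Φ s A) {L : ℕ}
    (hpast : ∀ l < L, Past Φ (s + l + 1) (R l)) {ε : ENNReal}
    (hε : ∀ l < L, ∀ θ, ε ≤ ν {y | Φ (s + l) θ y ∈ R l}) :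
    ε ^ L * P A ≤ P (A ∩ {θ | ∀ l < L, θ ∈ R l}) := by
  induction L with
  | zero => simp
  | succ L ih =>
    have h1 := ih (fun l hl => hpast l (by omega)) fun l hl => hε l (by omega)
    have h2 : A ∩ {θ | ∀ l < L + 1, θ ∈ R l} = (A ∩ {θ | ∀ l < L, θ ∈ R l}) ∩ R L := by
      ext θ
      simp only [Set.mem_inter_iff, Set.mem_ofPred_eq, Nat.lt_succ_iff_lt_or_eq, and_assoc]
      refine and_congr_right fun _ => ⟨fun h => ⟨fun l hl => h l (Or.inl hl), h L (Or.inr rfl)⟩, ?_⟩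
      rintro ⟨h3, h4⟩ l (hl | rfl)
      exacts [h3 l hl, h4]
    rw [h2, pow_succ', mul_assoc]
    refine (mul_le_mul_right h1 ε).trans ?_
    exact mul_le_measure_inter hΦ (hA.inter (measurableSet_run hR L)) (hR L)
      ((hpastA.mono (by omega)).inter (past_run fun l hl => hpast l (by omega))) (hε L (by omega))

/-- If each event of each block has conditional probability at least `ε`, then almost surely all
events of some block happen. -/
theorem ae_exists_run (hΦ : ∀ k, Resamples P ν (Φ k)) {L : ℕ} {s : ℕ → ℕ}
    (hs : ∀ i, s i + L ≤ s (i + 1)) {R : ℕ → ℕ → Set Θ} (hR : ∀ i l, MeasurableSet (R i l))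
    (hpast : ∀ i, ∀ l < L, Past Φ (s i + l + 1) (R i l)) {ε : ENNReal} (hε0 : 0 < ε)
    (hε : ∀ i, ∀ l < L, ∀ θ, ε ≤ ν {y | Φ (s i + l) θ y ∈ R i l}) :
    ∀ᵐ θ ∂P, ∃ i, ∀ l < L, θ ∈ R i l := by
  set E : ℕ → Set Θ := fun i => {θ | ∀ l < L, θ ∈ R i l} with hE
  have hEm : ∀ i, MeasurableSet (E i) := fun i => measurableSet_run (hR i) L
  have hDm : ∀ q : ℕ, MeasurableSet (⋂ i < q, (E i)ᶜ) := fun q =>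
    MeasurableSet.iInter fun i => MeasurableSet.iInter fun _ => (hEm i).compl
  have hsm : ∀ i j, i < j → s i + L ≤ s j := by
    intro i j hij
    induction j, hij using Nat.le_induction with
    | base => exact hs i
    | succ j hj ih =>
      have := hs j
      omega
  have hDpast : ∀ q : ℕ, Past Φ (s q) (⋂ i < q, (E i)ᶜ) := by
    intro q l hl θ y
    simp only [Set.mem_iInter, Set.mem_compl_iff]
    refine forall_congr' fun i => forall_congr' fun hi => not_congr ?_
    exact past_run (hpast i) l ((hsm i q hi).trans hl) θ y
  -- The failure of the first `q` blocks is a past event for block `q`, which succeeds with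
  -- conditional probability at least `ε ^ L`.
  have hbound : ∀ q : ℕ, P (⋂ i < q, (E i)ᶜ) ≤ (1 - ε ^ L) ^ q := by
    intro q
    induction q with
    | zero => simp
    | succ q ih =>
      have h1 := pow_mul_le_measure_run hΦ (hDm q) (hR q) (hDpast q) (hpast q) (hε q)
      have h2 : (⋂ i < q + 1, (E i)ᶜ) = (⋂ i < q, (E i)ᶜ) \ ((⋂ i < q, (E i)ᶜ) ∩ E q) := by
        ext θ
        simp only [Set.mem_iInter, Set.mem_compl_iff, Set.mem_sdiff, Set.mem_inter_iff, not_and,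
          Nat.lt_succ_iff_lt_or_eq]
        refine ⟨fun h => ⟨fun i hi => h i (Or.inl hi), fun _ => h q (Or.inr rfl)⟩, ?_⟩
        rintro ⟨h3, h4⟩ i (hi | rfl)
        exacts [h3 i hi, h4 h3]
      rw [h2, measure_sdiff Set.inter_subset_left ((hDm q).inter (hEm q)).nullMeasurableSet
        (measure_ne_top _ _), pow_succ']
      calc P (⋂ i < q, (E i)ᶜ) - P ((⋂ i < q, (E i)ᶜ) ∩ E q)
          ≤ P (⋂ i < q, (E i)ᶜ) - ε ^ L * P (⋂ i < q, (E i)ᶜ) := tsub_le_tsub_left h1 _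
        _ = (1 - ε ^ L) * P (⋂ i < q, (E i)ᶜ) := by
          rw [ENNReal.sub_mul fun _ _ => measure_ne_top _ _, one_mul]
        _ ≤ (1 - ε ^ L) * (1 - ε ^ L) ^ q := by gcongr
  have hlim : Tendsto (fun q : ℕ => (1 - ε ^ L) ^ q) atTop (𝓝 0) :=
    ENNReal.tendsto_pow_atTop_nhds_zero_of_lt_one
      (ENNReal.sub_lt_self ENNReal.one_ne_top one_ne_zero (pow_ne_zero L hε0.ne'))
  have hzero : P (⋂ i, (E i)ᶜ) = 0 := by
    refine le_antisymm (ge_of_tendsto' hlim fun q => le_trans (measure_mono ?_) (hbound q)) zero_le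
    intro θ hθ
    simp only [Set.mem_iInter] at hθ ⊢
    exact fun i _ => hθ i
  rw [ae_iff]
  refine measure_mono_null (fun θ hθ => ?_) hzero
  simp only [Set.mem_iInter, Set.mem_compl_iff]
  intro i hi
  exact hθ ⟨i, hi⟩

end Runs

/-! ### Measurability -/

section Measurability

/-- The states form a countable set, so with the discrete σ-algebra every function of a state is
measurable. -/
instance {n N : ℕ} : MeasurableSpace (ChamState n N) := ⊤

instance {n N : ℕ} : DiscreteMeasurableSpace (ChamState n N) :=
  ⟨fun _ => MeasurableSpace.measurableSet_top⟩

instance {n N : ℕ} : Countable (ChamState n N) := by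
  refine Function.Injective.countable (β := (Fin n → ℕ) × (Fin n → ℕ) × (Fin n → ℕ) ×
    (Fin N → Option (Fin n)) × (Fin N → Option (Fin n)))
    (f := fun σ => (σ.B, σ.R, σ.P, σ.LR, σ.LW)) ?_
  rintro ⟨B, R, P, LR, LW⟩ ⟨B', R', P', LR', LW'⟩ h
  simpa using h

variable {Θ : Type*} [MeasurableSpace Θ]

/-- Edges, configurations and states take countably many values. They may be frozen one value at a
time, after which only a threshold in a uniform variable remains to be checked. -/
theorem measurable_param {γ δ : Type*} [MeasurableSpace γ] [MeasurableSpace δ] [Countable γ]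
    [MeasurableSingletonClass γ] {h : Θ → γ} (hh : Measurable h) {F : γ → Θ → δ}
    (hF : ∀ c, Measurable (F c)) : Measurable fun θ => F (h θ) θ := by
  have : Measurable fun p : γ × Θ => F p.1 p.2 := measurable_from_prod_countable_right hF
  exact this.comp (hh.prodMk measurable_id)

/-- A positive value is attained on a countable union over finite sets; the value 0, which also
stands for infinite sets, is handled by taking the complement. -/
theorem measurable_ncard {S : Θ → Set ℕ} (hS : ∀ k, MeasurableSet {θ | k ∈ S θ}) :
    Measurable fun θ => (S θ).ncard := by
  have h1 : ∀ F : Finset ℕ, MeasurableSet {θ | S θ = F} := by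
    intro F
    have : {θ | S θ = F} = ⋂ k, {θ | k ∈ S θ ↔ k ∈ F} := by
      ext θ
      simp [Set.ext_iff]
    rw [this]
    refine MeasurableSet.iInter fun k => ?_
    by_cases hk : k ∈ F
    · simpa [hk] using hS k
    · have h : {θ | k ∈ S θ ↔ k ∈ F} = {θ | k ∈ S θ}ᶜ := by
        ext
        simp [hk]
      rw [h]
      exact (hS k).compl
  have h2 : ∀ k : ℕ, k ≠ 0 → MeasurableSet ((fun θ => (S θ).ncard) ⁻¹' {k}) := by
    intro k hk
    have : (fun θ => (S θ).ncard) ⁻¹' {k} =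
        ⋃ (F : Finset ℕ) (_ : F.card = k), {θ | S θ = F} := by
      ext θ
      simp only [Set.mem_preimage, Set.mem_singleton_iff, Set.mem_iUnion, Set.mem_ofPred_eq,
        exists_prop]
      constructor
      · intro h
        have hfin : (S θ).Finite := Set.finite_of_ncard_ne_zero (h ▸ hk)
        refine ⟨hfin.toFinset, ?_, by simp⟩
        rw [← h, Set.ncard_eq_toFinset_card _ hfin]
      · rintro ⟨F, hF, h⟩
        rw [h, Set.ncard_coe_finset, hF]
    rw [this]
    exact MeasurableSet.iUnion fun F => MeasurableSet.iUnion fun _ => h1 F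
  refine measurable_to_countable' fun k => ?_
  by_cases hk : k = 0
  · subst hk
    have : (fun θ => (S θ).ncard) ⁻¹' {0} = (⋃ k : ℕ, (fun θ => (S θ).ncard) ⁻¹' {k + 1})ᶜ := by
      ext θ
      simp only [Set.mem_preimage, Set.mem_singleton_iff, Set.mem_compl_iff, Set.mem_iUnion,
        not_exists]
      constructor
      · intro h k
        omega
      · intro h
        by_contra h0
        exact h ((S θ).ncard - 1) (by omega)
    rw [this]
    exact (MeasurableSet.iUnion fun k => h2 (k + 1) k.succ_ne_zero).compl
  · exact h2 k hk

variable {n : ℕ} {G : SimpleGraph (Fin n)}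

theorem measurable_mabb (s : ℝ) (e : Fin n × Fin n) (ξ : Fin n → ℕ) :
    Measurable fun u => mabb s u e ξ :=
  (Measurable.of_discrete (f := splitAt e ξ)).comp (measurable_quantile _ _ _)

/-- All components of the graphical construction are random variables. -/
structure MeasDrive (D : Θ → Drive G) : Prop where
  gap : ∀ k, Measurable fun θ => (D θ).gap k
  edge : ∀ k, Measurable fun θ => (D θ).edge k
  ub : ∀ k, Measurable fun θ => (D θ).ub k
  uc : ∀ k, Measurable fun θ => (D θ).uc k
  coin : ∀ k, Measurable fun θ => (D θ).coin k

namespace MeasDrive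

variable {D : Θ → Drive G} (hD : MeasDrive D)
include hD

theorem ringTime (k : ℕ) : Measurable fun θ => ringTime (D θ) k :=
  Finset.measurable_sum _ fun i _ => hD.gap i

theorem ringCount (t : ℝ) : Measurable fun θ => ringCount (D θ) t :=
  measurable_ncard fun k => measurableSet_le (hD.ringTime k) measurable_const

theorem nextBlack (s : ℝ) (k : ℕ) {B : Θ → Fin n → ℕ} (hB : Measurable B) :
    Measurable fun θ => mabb s ((D θ).ub k) ((D θ).edge k).1 (B θ) :=
  measurable_param (F := fun (c : Edge G × (Fin n → ℕ)) θ => mabb s ((D θ).ub k) c.1.1 c.2)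
    ((hD.edge k).prodMk hB) fun c => (measurable_mabb s c.1.1 c.2).comp (hD.ub k)

theorem mabbSkeleton (s : ℝ) (ξ : Fin n → ℕ) (x : Fin n) (k : ℕ) :
    Measurable fun θ => mabbSkeleton s (D θ) ξ x k := by
  induction k with
  | zero => exact measurable_const
  | succ k ih =>
    have h1 := hD.nextBlack s k ih.fst
    refine h1.prodMk ?_
    have hc := ((hD.edge k).prodMk (ih.prodMk h1))
    refine measurable_param
      (F := fun (c : Edge G × ((Fin n → ℕ) × Fin n) × (Fin n → ℕ)) θ =>
        if c.2.1.2 = c.1.1.1 then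
          (if (D θ).uc k < markProb s c.1.1 c.2.1.1 c.2.2 c.2.1.2 c.2.1.2 then c.2.1.2 else c.1.1.2)
        else if c.2.1.2 = c.1.1.2 then
          (if (D θ).uc k < markProb s c.1.1 c.2.1.1 c.2.2 c.2.1.2 c.2.1.2 then c.2.1.2 else c.1.1.1)
        else c.2.1.2) hc fun c => ?_
    have hlt : ∀ p : ℝ, MeasurableSet {θ | (D θ).uc k < p} := fun p =>
      measurableSet_lt (hD.uc k) measurable_const
    split_ifs
    · exact Measurable.ite (hlt _) measurable_const measurable_const
    · exact Measurable.ite (hlt _) measurable_const measurable_const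
    · exact measurable_const

theorem mabbAt (s : ℝ) (ξ : Fin n → ℕ) (x : Fin n) (t : ℝ) :
    Measurable fun θ => mabbAt s (D θ) ξ x t :=
  measurable_param (F := fun k θ => BBSplit.mabbSkeleton s (D θ) ξ x k) (hD.ringCount t)
    fun k => hD.mabbSkeleton s ξ x k

variable {N : ℕ} (a b : ℕ)

theorem chamRing (k : ℕ) {σ : Θ → ChamState n N} (hσ : Measurable σ) :
    Measurable fun θ => chamRing a b (D θ) k (σ θ) := by
  have h1 := hD.nextBlack ((b : ℝ) / a) k (B := fun θ => (σ θ).B)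
    ((Measurable.of_discrete (f := ChamState.B)).comp hσ)
  exact measurable_param
    (F := fun (c : Edge G × (Fin n → ℕ) × ChamState n N) θ =>
      samplePMF (chamKernel a b c.1.1 c.2.1 c.2.2) ((D θ).uc k))
    ((hD.edge k).prodMk (h1.prodMk hσ)) fun c => (measurable_samplePMF _).comp (hD.uc k)

theorem chamRun_const (i k : ℕ) {σ : Θ → ChamState n N} (hσ : Measurable σ) :
    Measurable fun θ => chamRun a b (D θ) i k (σ θ) := by
  induction k with
  | zero => simpa only [chamRun_of_le _ (Nat.zero_le i)] using hσ
  | succ k ih =>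
    rcases le_or_gt i k with h | h
    · simp only [chamRun_succ _ h]
      exact hD.chamRing a b k ih
    · simpa only [chamRun_of_le _ (Nat.succ_le_of_lt h)] using hσ

theorem chamRun {i k : Θ → ℕ} (hi : Measurable i) (hk : Measurable k) {σ : Θ → ChamState n N}
    (hσ : Measurable σ) : Measurable fun θ => chamRun a b (D θ) (i θ) (k θ) (σ θ) :=
  measurable_param (F := fun (c : ℕ × ℕ) θ => BBSplit.chamRun a b (D θ) c.1 c.2 (σ θ))
    (hi.prodMk hk) fun c => hD.chamRun_const a b c.1 c.2 hσ

theorem chamRound (N : ℕ) (T : ℝ) (ξ : Fin n → ℕ) (x : Fin n) (j : ℕ) :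
    Measurable fun θ => chamRound a b N (D θ) T ξ x j := by
  induction j with
  | zero => exact measurable_const
  | succ j ih =>
    have h := hD.chamRun a b (hD.ringCount (j * T)) (hD.ringCount ((j + 1) * T)) ih
    exact (Measurable.of_discrete (f := fun p : Bool × ChamState n N => roundEnd a b p.1 p.2)).comp
      ((hD.coin j).prodMk h)

theorem preRing (N : ℕ) (T : ℝ) (ξ : Fin n → ℕ) (x : Fin n) (j k : ℕ) :
    Measurable fun θ => preRing a b N (D θ) T ξ x j k :=
  hD.chamRun a b (hD.ringCount _) measurable_const (hD.chamRound a b N T ξ x j)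

theorem roundLast (N : ℕ) (T : ℝ) (ξ : Fin n → ℕ) (x : Fin n) (j : ℕ) :
    Measurable fun θ => roundLast a b N (D θ) T ξ x j :=
  hD.chamRun a b (hD.ringCount _) (hD.ringCount _) (hD.chamRound a b N T ξ x j)

theorem chamAt (N : ℕ) (T : ℝ) (ξ : Fin n → ℕ) (x : Fin n) (t : ℝ) :
    Measurable fun θ => chamAt a b N (D θ) T ξ x t :=
  hD.chamRun a b (hD.ringCount _) (hD.ringCount _) (hD.chamRound a b N T ξ x _)

end MeasDrive

end Measurability

/-! ### The product space -/

section ProductSpace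

variable {n : ℕ} {G : SimpleGraph (Fin n)}

/-- The randomness that is used only by the marked particle and the colours. -/
abbrev Colour : Type := (ℕ → ℝ) × (ℕ → Bool)

/-- The values of a graphical construction: gaps, edges, uniform variables and coins. -/
abbrev Seqs {n : ℕ} (G : SimpleGraph (Fin n)) : Type :=
  (ℕ → ℝ) × (ℕ → Edge G) × (ℕ → ℝ) × Colour

/-- The graphical construction with the given values. -/
def toDrive (θ : Seqs G) : Drive G := ⟨θ.1, θ.2.1, θ.2.2.1, θ.2.2.2.1, θ.2.2.2.2⟩

/-- The values of a graphical construction. -/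
def ofDrive (D : Drive G) : Seqs G := (D.gap, D.edge, D.ub, D.uc, D.coin)

theorem measDrive_toDrive : MeasDrive (toDrive : Seqs G → Drive G) := by
  constructor <;> intro k <;> simp only [toDrive] <;> fun_prop

theorem MeasDrive.comp {Θ Θ' : Type*} [MeasurableSpace Θ] [MeasurableSpace Θ'] {D : Θ → Drive G}
    (hD : MeasDrive D) {f : Θ' → Θ} (hf : Measurable f) : MeasDrive fun θ => D (f θ) :=
  ⟨fun k => (hD.gap k).comp hf, fun k => (hD.edge k).comp hf, fun k => (hD.ub k).comp hf,
    fun k => (hD.uc k).comp hf, fun k => (hD.coin k).comp hf⟩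

/-- The law of a fair coin. -/
abbrev coinLaw : Measure Bool := (PMF.uniformOfFintype Bool).toMeasure

/-- The law of the randomness that is used only by the marked particle and the colours. -/
abbrev colourLaw : Measure Colour := (seqLaw unitLaw).prod (seqLaw coinLaw)

theorem isProbabilityMeasure_edgeLaw {r : Edge G → ℝ} (hr : ∀ e, 0 < r e) (e₀ : Edge G) :
    IsProbabilityMeasure (edgeLaw r) := by
  have hpos : 0 < ∑ e, r e := Finset.sum_pos (fun e _ => hr e) ⟨e₀, Finset.mem_univ _⟩
  constructor
  rw [edgeLaw, Measure.finsetSum_apply]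
  simp only [Measure.smul_apply, measure_univ, smul_eq_mul, mul_one]
  rw [← ENNReal.ofReal_sum_of_nonneg fun e _ => div_nonneg (hr e).le hpos.le, ← Finset.sum_div,
    div_self hpos.ne', ENNReal.ofReal_one]

theorem edgeLaw_singleton_pos {r : Edge G → ℝ} (hr : ∀ e, 0 < r e) (e : Edge G) :
    0 < edgeLaw r {e} := by
  have hpos : 0 < ∑ e, r e := Finset.sum_pos (fun e _ => hr e) ⟨e, Finset.mem_univ _⟩
  rw [edgeLaw, Measure.finsetSum_apply]
  refine lt_of_lt_of_le ?_ (Finset.single_le_sum (fun _ _ => zero_le) (Finset.mem_univ e))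
  simp [hr e, hpos]

/-- There is an edge, because the law of a tick is a probability law. -/
theorem IsGraphical.exists_edge {r : Edge G → ℝ} {Ω : Type*} [MeasurableSpace Ω] {μ : Measure Ω}
    [IsProbabilityMeasure μ] {D : Ω → Drive G} (hD : IsGraphical r μ D) : Nonempty (Edge G) := by
  by_contra h
  rw [not_nonempty_iff] at h
  have h1 : edgeLaw r = 0 := by
    rw [edgeLaw, Finset.univ_eq_empty, Finset.sum_empty]
  have h2 := hD.law_tick 0
  rw [tickLaw, h1, Measure.zero_prod, Measure.prod_zero] at h2
  have h3 : IsProbabilityMeasure (0 : Measure (ℝ × Edge G × ℝ × ℝ × Bool)) :=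
    h2 ▸ Measure.isProbabilityMeasure_map (hD.measurable_tick 0).aemeasurable
  have h4 := h3.measure_univ
  rw [Measure.coe_zero, Pi.zero_apply] at h4
  exact zero_ne_one h4

theorem IsGraphical.measDrive {r : Edge G → ℝ} {Ω : Type*} [MeasurableSpace Ω] {μ : Measure Ω}
    {D : Ω → Drive G} (hD : IsGraphical r μ D) : MeasDrive D :=
  ⟨fun k => (hD.measurable_tick k).fst, fun k => (hD.measurable_tick k).snd.fst,
    fun k => (hD.measurable_tick k).snd.snd.fst, fun k => (hD.measurable_tick k).snd.snd.snd.fst,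
    fun k => (hD.measurable_tick k).snd.snd.snd.snd⟩

/-- The law of a graphical construction. -/
theorem IsGraphical.map_ofDrive {r : Edge G → ℝ} [IsProbabilityMeasure (edgeLaw r)]
    [IsProbabilityMeasure (expMeasure (∑ e, r e))] {Ω : Type*} [MeasurableSpace Ω] {μ : Measure Ω}
    [IsProbabilityMeasure μ] {D : Ω → Drive G} (hD : IsGraphical r μ D) :
    MeasurePreserving (fun ω => ofDrive (D ω)) μ
      ((seqLaw (expMeasure (∑ e, r e))).prod ((seqLaw (edgeLaw r)).prod
        ((seqLaw unitLaw).prod colourLaw))) := by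
  have h0 : MeasurePreserving (fun ω k =>
      ((D ω).gap k, (D ω).edge k, (D ω).ub k, (D ω).uc k, (D ω).coin k)) μ
      (seqLaw ((expMeasure (∑ e, r e)).prod ((edgeLaw r).prod
        (unitLaw.prod (unitLaw.prod coinLaw))))) := by
    refine ⟨measurable_pi_lambda _ hD.measurable_tick, ?_⟩
    rw [hD.indep_tick.map_fun_eq_infinitePi_map hD.measurable_tick]
    simp only [hD.law_tick]
    rfl
  -- The independent sequence of 5-tuples is split into five independent sequences, one component at
  -- a time.
  have h1 := (measurePreserving_unzip (expMeasure (∑ e, r e)) ((edgeLaw r).prod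
        (unitLaw.prod (unitLaw.prod coinLaw)))).comp h0
  have h4 := (MeasurePreserving.id (seqLaw unitLaw)).prod (measurePreserving_unzip unitLaw coinLaw)
  have h3 := h4.comp (measurePreserving_unzip unitLaw (unitLaw.prod coinLaw))
  have h2 := ((MeasurePreserving.id (seqLaw (edgeLaw r))).prod h3).comp
    (measurePreserving_unzip (edgeLaw r) (unitLaw.prod (unitLaw.prod coinLaw)))
  exact ((MeasurePreserving.id (seqLaw (expMeasure (∑ e, r e)))).prod h2).comp h1

end ProductSpace

/-! ### Mean ink and the marked particle -/

theorem lintegral_coinLaw (f : Bool → ENNReal) : ∫⁻ d, f d ∂coinLaw = (f true + f false) / 2 := by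
  rw [lintegral_fintype, Fintype.sum_bool]
  simp only [PMF.toMeasure_apply_singleton _ _ (measurableSet_singleton _),
    PMF.uniformOfFintype_apply, Fintype.card_bool, Nat.cast_ofNat]
  rw [← add_mul, ENNReal.div_eq_inv_mul, mul_comm]

section EdgeMix

variable {n : ℕ}

/-- The masses on the ends of `e` are redistributed in proportion to `c`. -/
structure EdgeMix (e : Fin n × Fin n) (c : Fin n → ℕ) (f f' : Fin n → ENNReal) : Prop where
  fst : f' e.1 = (f e.1 + f e.2) * ENNReal.ofReal ((c e.1 : ℝ) / (c e.1 + c e.2))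
  snd : f' e.2 = (f e.1 + f e.2) * ENNReal.ofReal ((c e.2 : ℝ) / (c e.1 + c e.2))
  off : ∀ v, v ≠ e.1 → v ≠ e.2 → f' v = f v

/-- The redistribution is a linear map determined by `e` and `c`, so proportional inputs have
proportional outputs. This is what carries the comparison of ink and mark through a ring. -/
theorem EdgeMix.eq_mul {e : Fin n × Fin n} {c : Fin n → ℕ} {f f' g g' : Fin n → ENNReal}
    (hf : EdgeMix e c f f') (hg : EdgeMix e c g g') {z : ENNReal} (h : ∀ v, f v = z * g v)
    (v : Fin n) : f' v = z * g' v := by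
  by_cases h1 : v = e.1
  · rw [h1, hf.fst, hg.fst, h, h]
    ring
  by_cases h2 : v = e.2
  · rw [h2, hf.snd, hg.snd, h, h]
    ring
  rw [hf.off v h1 h2, hg.off v h1 h2, h]

end EdgeMix

section InkMark

variable {n : ℕ} {G : SimpleGraph (Fin n)} {a b N : ℕ}

theorem resamples_uc (k : ℕ) :
    Resamples colourLaw unitLaw fun (c : Colour) y => (Function.update c.1 k y, c.2) :=
  (resamples_update unitLaw k).left _

theorem resamples_coin (j : ℕ) :
    Resamples colourLaw coinLaw fun (c : Colour) d => (c.1, Function.update c.2 j d) :=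
  (resamples_update coinLaw j).right _

theorem unitLaw_Iio {p : ℝ} (h1 : p ≤ 1) :
    unitLaw (Set.Iio p) = ENNReal.ofReal p := by
  rw [Measure.restrict_apply measurableSet_Iio]
  have : Set.Iio p ∩ Set.Icc (0 : ℝ) 1 = Set.Ico 0 p := by
    ext y
    simp only [Set.mem_inter_iff, Set.mem_Iio, Set.mem_Icc, Set.mem_Ico]
    constructor
    · rintro ⟨h, h', -⟩
      exact ⟨h', h⟩
    · rintro ⟨h, h'⟩
      exact ⟨h', h, by linarith⟩
  rw [this, Real.volume_Ico, sub_zero]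

theorem unitLaw_Ici {p : ℝ} (h0 : 0 ≤ p) (h1 : p ≤ 1) :
    unitLaw (Set.Ici p) = ENNReal.ofReal (1 - p) := by
  rw [← Set.compl_Iio, prob_compl_eq_one_sub measurableSet_Iio, unitLaw_Iio h1,
    ENNReal.ofReal_sub _ h0, ENNReal.ofReal_one]

/-- The law of the marked particle after a ring. -/
theorem unitLaw_mabbStar (ha : 0 < a) (hb : 0 < b) (u : ℝ) {e : Fin n × Fin n} (he : e.1 ≠ e.2)
    (B : Fin n → ℕ) (y : Fin n) :
    EdgeMix e (fun v => chi a b (mabb ((b : ℝ) / a) u e B v)) (fun v => if y = v then 1 else 0)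
      fun v => unitLaw {z | mabbStar ((b : ℝ) / a) u z e B y = v} := by
  have hs := isSplit_mabb ((b : ℝ) / a) u he B
  have hpos : ∀ k, (0 : ℝ) < chi a b k := fun k => by
    have : 0 < chi a b k := by
      simp only [chi]
      omega
    exact_mod_cast this
  have h1 := markProb_eq_chi ha hb he hs (Or.inl rfl) (Or.inl rfl)
  have h2 := markProb_eq_chi ha hb he hs (Or.inr rfl) (Or.inr rfl)
  set B' := mabb ((b : ℝ) / a) u e B
  have hv := hpos (B' e.1)
  have hw := hpos (B' e.2)
  have hsum : (chi a b (B' e.2) : ℝ) / (chi a b (B' e.1) + chi a b (B' e.2)) =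
      1 - chi a b (B' e.1) / (chi a b (B' e.1) + chi a b (B' e.2)) := by
    field_simp
    ring
  have hle : ∀ x y : ℝ, 0 < x → 0 < y → 0 ≤ x / (x + y) ∧ x / (x + y) ≤ 1 := fun x y hx hy =>
    ⟨by positivity, (div_le_one (by positivity)).2 (by linarith)⟩
  have hp := hle _ _ hv hw
  have hq := hle _ _ hw hv
  rw [add_comm (chi a b (B' e.2) : ℝ)] at hq
  by_cases hy1 : y = e.1
  · subst hy1
    have hst : ∀ z, mabbStar ((b : ℝ) / a) u z e B e.1 = if z <
        (chi a b (B' e.1) : ℝ) / (chi a b (B' e.1) + chi a b (B' e.2)) then e.1 else e.2 := by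
      intro z
      rw [mabbStar, if_pos rfl, h1]
    simp only [hst]
    constructor
    · have : {z : ℝ | (if z < (chi a b (B' e.1) : ℝ) / (chi a b (B' e.1) + chi a b (B' e.2)) then
          e.1 else e.2) = e.1} =
          Set.Iio ((chi a b (B' e.1) : ℝ) / (chi a b (B' e.1) + chi a b (B' e.2))) := by
        ext z
        simp only [Set.mem_ofPred_eq, Set.mem_Iio]
        split_ifs with h
        · simp [h]
        · simp [h, he.symm]
      rw [this, unitLaw_Iio hp.2, if_pos rfl, if_neg he]
      simp
    · have : {z : ℝ | (if z < (chi a b (B' e.1) : ℝ) / (chi a b (B' e.1) + chi a b (B' e.2)) then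
          e.1 else e.2) = e.2} =
          Set.Ici ((chi a b (B' e.1) : ℝ) / (chi a b (B' e.1) + chi a b (B' e.2))) := by
        ext z
        simp only [Set.mem_ofPred_eq, Set.mem_Ici, ← not_lt]
        split_ifs with h
        · simp [h, he]
        · simp [h]
      rw [this, unitLaw_Ici hp.1 hp.2, if_pos rfl, if_neg he, hsum]
      simp
    · intro v hv1 hv2
      have : {z : ℝ | (if z < (chi a b (B' e.1) : ℝ) / (chi a b (B' e.1) + chi a b (B' e.2)) then
          e.1 else e.2) = v} = ∅ := by
        ext z
        simp only [Set.mem_ofPred_eq, Set.mem_empty_iff_false, iff_false]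
        split_ifs
        · exact hv1.symm
        · exact hv2.symm
      rw [this, measure_empty, if_neg hv1.symm]
  by_cases hy2 : y = e.2
  · subst hy2
    have hst : ∀ z, mabbStar ((b : ℝ) / a) u z e B e.2 = if z <
        (chi a b (B' e.2) : ℝ) / (chi a b (B' e.1) + chi a b (B' e.2)) then e.2 else e.1 := by
      intro z
      rw [mabbStar, if_neg hy1, if_pos rfl, h2]
    simp only [hst]
    constructor
    · have : {z : ℝ | (if z < (chi a b (B' e.2) : ℝ) / (chi a b (B' e.1) + chi a b (B' e.2)) then
          e.2 else e.1) = e.1} =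
          Set.Ici ((chi a b (B' e.2) : ℝ) / (chi a b (B' e.1) + chi a b (B' e.2))) := by
        ext z
        simp only [Set.mem_ofPred_eq, Set.mem_Ici, ← not_lt]
        split_ifs with h
        · simp [h, he.symm]
        · simp [h]
      rw [this, unitLaw_Ici hq.1 hq.2, if_pos rfl, if_neg he.symm, hsum]
      simp
    · have : {z : ℝ | (if z < (chi a b (B' e.2) : ℝ) / (chi a b (B' e.1) + chi a b (B' e.2)) then
          e.2 else e.1) = e.2} =
          Set.Iio ((chi a b (B' e.2) : ℝ) / (chi a b (B' e.1) + chi a b (B' e.2))) := by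
        ext z
        simp only [Set.mem_ofPred_eq, Set.mem_Iio]
        split_ifs with h
        · simp [h]
        · simp [h, he]
      rw [this, unitLaw_Iio hq.2, if_pos rfl, if_neg he.symm]
      simp
    · intro v hv1 hv2
      have : {z : ℝ | (if z < (chi a b (B' e.2) : ℝ) / (chi a b (B' e.1) + chi a b (B' e.2)) then
          e.2 else e.1) = v} = ∅ := by
        ext z
        simp only [Set.mem_ofPred_eq, Set.mem_empty_iff_false, iff_false]
        split_ifs
        · exact hv2.symm
        · exact hv1.symm
      rw [this, measure_empty, if_neg hv2.symm]
  · have hst : ∀ z, mabbStar ((b : ℝ) / a) u z e B y = y := by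
      intro z
      rw [mabbStar, if_neg hy1, if_neg hy2]
    simp only [hst]
    have hset : ∀ v, unitLaw {_z : ℝ | y = v} = if y = v then 1 else 0 := by
      intro v
      by_cases h : y = v
      · simp [h]
      · simp [h]
    simp only [hset]
    exact ⟨by simp [hy1, hy2], by simp [hy1, hy2], fun _ _ _ => rfl⟩

theorem RingSetup.edgeMix {e : Fin n × Fin n} {B' : Fin n → ℕ} {σ : ChamState n N}
    (h : RingSetup a b e B' σ) :
    EdgeMix e (fun v => chi a b (B' v)) (fun v => (σ.twoInk v : ENNReal)) fun v =>
      ∫⁻ y, ((samplePMF (chamKernel a b e B' σ) y).twoInk v : ENNReal) ∂unitLaw := by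
  have hfin := finite_support_chamKernel a b e B' σ
  have key : ∀ v, ∫⁻ y, ((samplePMF (chamKernel a b e B' σ) y).twoInk v : ENNReal) ∂unitLaw =
      pmfMean (chamKernel a b e B' σ) fun τ => ENNReal.ofReal (τ.twoInk v) := by
    intro v
    rw [← lintegral_samplePMF hfin]
    simp only [ENNReal.ofReal_natCast]
  constructor
  · rw [key, mean_twoInk_fst h, ENNReal.ofReal_mul (by positivity), ← Nat.cast_add,
      ENNReal.ofReal_natCast, Nat.cast_add]
  · rw [key, mean_twoInk_snd h, ENNReal.ofReal_mul (by positivity), ← Nat.cast_add,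
      ENNReal.ofReal_natCast, Nat.cast_add]
  · intro v h1 h2
    have : ∀ y, (samplePMF (chamKernel a b e B' σ) y).twoInk v = σ.twoInk v := fun y =>
      (twoInk_edge h (samplePMF_mem_support hfin y)).2 v h1 h2
    simp [this]

theorem EdgeMix.lintegral {Θ : Type*} [MeasurableSpace Θ] {P : Measure Θ} {e : Fin n × Fin n}
    {c : Fin n → ℕ} {f f' : Θ → Fin n → ENNReal} (h : ∀ θ, EdgeMix e c (f θ) (f' θ))
    (hf : ∀ v, Measurable fun θ => f θ v) :
    EdgeMix e c (fun v => ∫⁻ θ, f θ v ∂P) fun v => ∫⁻ θ, f' θ v ∂P := by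
  constructor
  · simp only [fun θ => (h θ).fst]
    rw [lintegral_mul_const _ (by fun_prop), lintegral_add_left (hf _)]
  · simp only [fun θ => (h θ).snd]
    rw [lintegral_mul_const _ (by fun_prop), lintegral_add_left (hf _)]
  · intro v h1 h2
    simp only [fun θ => (h θ).off v h1 h2]

variable (γ : (ℕ → ℝ) × (ℕ → Edge G) × (ℕ → ℝ)) (c : Colour)

/-- The graphical construction with given colour randomness. -/
def colourDrive (γ : (ℕ → ℝ) × (ℕ → Edge G) × (ℕ → ℝ)) (c : Colour) : Drive G :=
  toDrive (γ.1, γ.2.1, γ.2.2, c)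

theorem measDrive_colourDrive : MeasDrive (colourDrive γ) :=
  measDrive_toDrive.comp (f := fun c : Colour => (γ.1, γ.2.1, γ.2.2, c)) (by fun_prop)

variable {γ} {T : ℝ} {ξ : Fin n → ℕ} (x : Fin n)

theorem mabbSkeleton_fst_colourDrive (s : ℝ) (c c' : Colour) (k : ℕ) :
    (mabbSkeleton s (colourDrive γ c) ξ x k).1 = (mabbSkeleton s (colourDrive γ c') ξ x k).1 :=
  mabbSkeleton_fst_congr ξ x s (D := colourDrive γ c) (D' := colourDrive γ c') rfl rfl k

/-- Given the frame, the black configuration is the same for every colour `c`, so the mixing weights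
are constants and may be taken out of the integral over the colours. -/
theorem edgeMix_mark (ha : 0 < a) (hb : 0 < b) (k : ℕ) :
    EdgeMix (γ.2.1 k).1 (fun v => chi a b ((mabbSkeleton ((b : ℝ) / a) (colourDrive γ c) ξ x
        (k + 1)).1 v))
      (fun v => colourLaw {c | (mabbSkeleton ((b : ℝ) / a) (colourDrive γ c) ξ x k).2 = v})
      fun v => colourLaw {c | (mabbSkeleton ((b : ℝ) / a) (colourDrive γ c) ξ x (k + 1)).2 = v} := by
  have hD := measDrive_colourDrive γ
  have hm : ∀ k v, MeasurableSet {c | (mabbSkeleton ((b : ℝ) / a) (colourDrive γ c) ξ x k).2 = v} :=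
    fun k v => (hD.mabbSkeleton _ ξ x k).snd (measurableSet_singleton v)
  have h1 : ∀ k v, colourLaw {c | (mabbSkeleton ((b : ℝ) / a) (colourDrive γ c) ξ x k).2 = v} =
      ∫⁻ c, (if (mabbSkeleton ((b : ℝ) / a) (colourDrive γ c) ξ x k).2 = v then 1 else 0)
        ∂colourLaw := by
    intro k v
    rw [← lintegral_indicator_one (hm k v)]
    exact lintegral_congr fun c => by simp only [Set.indicator, Set.mem_ofPred_eq, Pi.one_apply]
  have hmf : ∀ k v, Measurable fun c =>
      (if (mabbSkeleton ((b : ℝ) / a) (colourDrive γ c) ξ x k).2 = v then 1 else 0 : ENNReal) :=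
    fun k v => Measurable.ite (hm k v) measurable_const measurable_const
  have h2 : ∀ v, colourLaw {c | (mabbSkeleton ((b : ℝ) / a) (colourDrive γ c) ξ x (k + 1)).2 = v} =
      ∫⁻ c', unitLaw {z | mabbStar ((b : ℝ) / a) (γ.2.2 k) z (γ.2.1 k).1
        (mabbSkeleton ((b : ℝ) / a) (colourDrive γ c) ξ x k).1
        (mabbSkeleton ((b : ℝ) / a) (colourDrive γ c') ξ x k).2 = v} ∂colourLaw := by
    intro v
    rw [h1, (resamples_uc k).lintegral (hmf _ v)]
    refine lintegral_congr fun c' => ?_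
    have hms : MeasurableSet {z | mabbStar ((b : ℝ) / a) (γ.2.2 k) z (γ.2.1 k).1
        (mabbSkeleton ((b : ℝ) / a) (colourDrive γ c) ξ x k).1
        (mabbSkeleton ((b : ℝ) / a) (colourDrive γ c') ξ x k).2 = v} := by
      have : Measurable fun z => mabbStar ((b : ℝ) / a) (γ.2.2 k) z (γ.2.1 k).1
        (mabbSkeleton ((b : ℝ) / a) (colourDrive γ c) ξ x k).1
        (mabbSkeleton ((b : ℝ) / a) (colourDrive γ c') ξ x k).2 := by
        unfold mabbStar
        have hlt : ∀ p : ℝ, MeasurableSet {z : ℝ | z < p} := fun p => measurableSet_Iio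
        split_ifs
        · exact Measurable.ite (hlt _) measurable_const measurable_const
        · exact Measurable.ite (hlt _) measurable_const measurable_const
        · exact measurable_const
      exact this (measurableSet_singleton v)
    rw [← lintegral_indicator_one hms]
    refine lintegral_congr fun y => ?_
    -- The `k`-th colour variable is not used before ring `k`, so an independent copy may be put in
    -- its place.
    have e1 : mabbSkeleton ((b : ℝ) / a) (colourDrive γ (Function.update c'.1 k y, c'.2)) ξ x k =
        mabbSkeleton ((b : ℝ) / a) (colourDrive γ c') ξ x k :=
      mabbSkeleton_congr ξ x _ (D := colourDrive γ (Function.update c'.1 k y, c'.2))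
        (D' := colourDrive γ c') (fun _ _ => rfl) (fun _ _ => rfl)
        fun l hl => Function.update_of_ne hl.ne _ _
    have e2 : (mabbSkeleton ((b : ℝ) / a) (colourDrive γ c') ξ x k).1 =
        (mabbSkeleton ((b : ℝ) / a) (colourDrive γ c) ξ x k).1 :=
      mabbSkeleton_fst_colourDrive x _ _ _ k
    have e3 : (mabbSkeleton ((b : ℝ) / a) (colourDrive γ (Function.update c'.1 k y, c'.2)) ξ x
        (k + 1)).2 = mabbStar ((b : ℝ) / a) (γ.2.2 k) y (γ.2.1 k).1
        (mabbSkeleton ((b : ℝ) / a) (colourDrive γ c) ξ x k).1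
        (mabbSkeleton ((b : ℝ) / a) (colourDrive γ c') ξ x k).2 := by
      rw [mabbSkeleton, e1, e2]
      simp [colourDrive, toDrive]
    simp only [e3, Set.indicator, Set.mem_ofPred_eq, Pi.one_apply]
  simp only [h2]
  simp only [h1]
  exact EdgeMix.lintegral (fun c' => unitLaw_mabbStar ha hb _ (γ.2.1 k).2.1.ne _ _) fun v => hmf k v

/-- The weights are those of `edgeMix_mark`, because the black particles of the chameleon process
coincide with the non-marked particles. -/
theorem edgeMix_ink (ha : 0 < a) (hb : 0 < b) (hξ : ∑ v, chi a b (ξ v) = N) (hT : 0 < T)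
    (hreg : Regular (colourDrive γ c)) (h0 : ringCount (colourDrive γ c) 0 = 0) {j k : ℕ}
    (hk : ringCount (colourDrive γ c) (j * T) ≤ k) :
    EdgeMix (γ.2.1 k).1 (fun v => chi a b ((mabbSkeleton ((b : ℝ) / a) (colourDrive γ c) ξ x
        (k + 1)).1 v))
      (fun v => ∫⁻ c, ((preRing a b N (colourDrive γ c) T ξ x j k).twoInk v : ENNReal) ∂colourLaw)
      fun v => ∫⁻ c, ((preRing a b N (colourDrive γ c) T ξ x j (k + 1)).twoInk v : ENNReal)
        ∂colourLaw := by
  have hD := measDrive_colourDrive γ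
  have hm : ∀ k v, Measurable fun c =>
      ((preRing a b N (colourDrive γ c) T ξ x j k).twoInk v : ENNReal) := fun k v =>
    (Measurable.of_discrete (f := fun σ : ChamState n N => (σ.twoInk v : ENNReal))).comp
      (hD.preRing a b N T ξ x j k)
  have h2 : ∀ v, ∫⁻ c, ((preRing a b N (colourDrive γ c) T ξ x j (k + 1)).twoInk v : ENNReal)
        ∂colourLaw = ∫⁻ c', ∫⁻ y, ((samplePMF (chamKernel a b (γ.2.1 k).1
          (mabbSkeleton ((b : ℝ) / a) (colourDrive γ c) ξ x (k + 1)).1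
          (preRing a b N (colourDrive γ c') T ξ x j k)) y).twoInk v : ENNReal) ∂unitLaw
          ∂colourLaw := by
    intro v
    rw [(resamples_uc k).lintegral (hm _ v)]
    refine lintegral_congr fun c' => lintegral_congr fun y => ?_
    have hreg' : Regular (colourDrive γ (Function.update c'.1 k y, c'.2)) := hreg
    have e1 : preRing a b N (colourDrive γ (Function.update c'.1 k y, c'.2)) T ξ x j k =
        preRing a b N (colourDrive γ c') T ξ x j k :=
      preRing_congr T ξ x (D := colourDrive γ (Function.update c'.1 k y, c'.2))
        (D' := colourDrive γ c') hT hreg' rfl hk (fun _ _ => rfl) (fun _ _ => rfl)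
        (fun l hl => Function.update_of_ne hl.ne _ _) fun _ _ => rfl
    have e2 : (preRing a b N (colourDrive γ c') T ξ x j k).B =
        (mabbSkeleton ((b : ℝ) / a) (colourDrive γ c) ξ x k).1 := by
      rw [black_preRing (colourDrive γ c') T x ha hb hξ hT hreg h0 hk]
      exact mabbSkeleton_fst_colourDrive x _ _ _ k
    rw [preRing_succ (colourDrive γ (Function.update c'.1 k y, c'.2)) T x hk, e1, chamRing, e2]
    simp [colourDrive, toDrive, mabbSkeleton]
  simp only [h2]
  refine EdgeMix.lintegral (fun c' => ?_) fun v => hm k v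
  refine RingSetup.edgeMix ⟨ha, hb, (γ.2.1 k).2.1.ne, ?_, valid_preRing _ T x ha hb hξ j k⟩
  have e2 : (preRing a b N (colourDrive γ c') T ξ x j k).B =
      (mabbSkeleton ((b : ℝ) / a) (colourDrive γ c) ξ x k).1 := by
    rw [black_preRing (colourDrive γ c') T x ha hb hξ hT hreg h0 hk]
    exact mabbSkeleton_fst_colourDrive x _ _ _ k
  rw [e2]
  exact isSplit_mabb _ _ (γ.2.1 k).2.1.ne _

/-- The state at the end of round `j` does not depend on coin `j`, which may be resampled and
averaged. -/
theorem lintegral_chamRound_succ (j : ℕ) (f : ChamState n N → ENNReal) :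
    ∫⁻ c, f (chamRound a b N (colourDrive γ c) T ξ x (j + 1)) ∂colourLaw =
      ∫⁻ c, (f (roundEnd a b true (roundLast a b N (colourDrive γ c) T ξ x j)) +
        f (roundEnd a b false (roundLast a b N (colourDrive γ c) T ξ x j))) / 2 ∂colourLaw := by
  refine ((resamples_coin j).lintegral ((Measurable.of_discrete (f := f)).comp
    ((measDrive_colourDrive γ).chamRound a b N T ξ x (j + 1)))).trans ?_
  refine lintegral_congr fun c => ?_
  have e1 : ∀ d, chamRound a b N (colourDrive γ (c.1, Function.update c.2 j d)) T ξ x (j + 1) =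
      roundEnd a b d (roundLast a b N (colourDrive γ c) T ξ x j) := by
    intro d
    have e2 : roundLast a b N (colourDrive γ (c.1, Function.update c.2 j d)) T ξ x j =
        roundLast a b N (colourDrive γ c) T ξ x j :=
      roundLast_congr_coin T ξ x (D := colourDrive γ (c.1, Function.update c.2 j d))
        (D' := colourDrive γ c) rfl rfl rfl rfl fun l hl => Function.update_of_ne hl.ne _ _
    rw [chamRound_succ, e2]
    simp [colourDrive, toDrive]
  simp only [Function.comp_def, e1]
  exact lintegral_coinLaw _

theorem lintegral_twoInk_chamRound_succ (j : ℕ) (v : Fin n) :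
    ∫⁻ c, ((chamRound a b N (colourDrive γ c) T ξ x (j + 1)).twoInk v : ENNReal) ∂colourLaw =
      ∫⁻ c, ((roundLast a b N (colourDrive γ c) T ξ x j).twoInk v : ENNReal) ∂colourLaw := by
  rw [lintegral_chamRound_succ x j fun σ => (σ.twoInk v : ENNReal)]
  refine lintegral_congr fun c => ?_
  rw [← Nat.cast_add, roundEnd_twoInk_add, Nat.cast_mul, Nat.cast_ofNat,
    mul_comm, ENNReal.mul_div_cancel_right (by norm_num) (by norm_num)]

/-- The mean ink at a vertex is proportional to the probability that the marked particle is there. -/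
theorem lintegral_twoInk (ha : 0 < a) (hb : 0 < b) (hξ : ∑ v, chi a b (ξ v) = N) (hT : 0 < T)
    (hreg : Regular (colourDrive γ c)) (h0 : ringCount (colourDrive γ c) 0 = 0) (j k : ℕ)
    (hk : ringCount (colourDrive γ c) (j * T) ≤ k) (v : Fin n) :
    ∫⁻ c, ((preRing a b N (colourDrive γ c) T ξ x j k).twoInk v : ENNReal) ∂colourLaw =
      (2 * chi a b (ξ x) : ℕ) *
        colourLaw {c | (mabbSkeleton ((b : ℝ) / a) (colourDrive γ c) ξ x k).2 = v} := by
  -- Inside a round the proportionality passes from one ring to the next; from one round to the next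
  -- it survives because the coin preserves the mean ink at each vertex.
  have step : ∀ j : ℕ, (∀ v, ∫⁻ c', ((preRing a b N (colourDrive γ c') T ξ x j
      (ringCount (colourDrive γ c) (j * T))).twoInk v : ENNReal) ∂colourLaw =
      (2 * chi a b (ξ x) : ℕ) * colourLaw {c' | (mabbSkeleton ((b : ℝ) / a) (colourDrive γ c') ξ x
        (ringCount (colourDrive γ c) (j * T))).2 = v}) → ∀ k,
      ringCount (colourDrive γ c) (j * T) ≤ k → ∀ v,
      ∫⁻ c', ((preRing a b N (colourDrive γ c') T ξ x j k).twoInk v : ENNReal) ∂colourLaw =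
      (2 * chi a b (ξ x) : ℕ) *
        colourLaw {c' | (mabbSkeleton ((b : ℝ) / a) (colourDrive γ c') ξ x k).2 = v} := by
    intro j hj k hk
    induction k, hk using Nat.le_induction with
    | base => exact hj
    | succ k hk ih =>
      exact (edgeMix_ink c x ha hb hξ hT hreg h0 hk).eq_mul (edgeMix_mark c x ha hb k) ih
  refine step j ?_ k hk v
  clear hk k v
  induction j with
  | zero =>
    intro v
    have hr : ringCount (colourDrive γ c) ((0 : ℕ) * T) = 0 := by
      rw [Nat.cast_zero, zero_mul, h0]
    have hr' : ∀ c', preRing a b N (colourDrive γ c') T ξ x 0 0 = chamInit a b N ξ x := fun c' =>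
      preRing_of_le _ T x (Nat.zero_le _)
    rw [hr]
    simp only [hr', mabbSkeleton]
    by_cases h : v = x
    · subst h
      simp [ChamState.twoInk, chamInit]
    · simp [ChamState.twoInk, chamInit, h, Ne.symm h]
  | succ j ih =>
    intro v
    have h1 : ∀ c', preRing a b N (colourDrive γ c') T ξ x (j + 1)
        (ringCount (colourDrive γ c) ((j + 1 : ℕ) * T)) =
        chamRound a b N (colourDrive γ c') T ξ x (j + 1) := fun c' => preRing_of_le _ T x le_rfl
    simp only [h1]
    rw [lintegral_twoInk_chamRound_succ]
    have h2 : ∀ c', roundLast a b N (colourDrive γ c') T ξ x j =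
        preRing a b N (colourDrive γ c') T ξ x j
          (ringCount (colourDrive γ c) ((j + 1 : ℕ) * T)) := by
      intro c'
      rw [Nat.cast_add_one]
      rfl
    simp only [h2]
    refine step j ih _ ?_ v
    rw [Nat.cast_add_one]
    exact hreg.round_le T hT j

end InkMark

/-! ### The total ink is a martingale -/

section Martingale

variable {n : ℕ} {G : SimpleGraph (Fin n)} {a b N : ℕ} {T : ℝ} {ξ : Fin n → ℕ} (x : Fin n)
  (γ : (ℕ → ℝ) × (ℕ → Edge G) × (ℕ → ℝ))

theorem roundEnd_total_true (σ : ChamState n N) :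
    (roundEnd a b true σ).total = σ.total + depinked a b σ := by
  have := roundEnd_total (a := a) (b := b) true σ
  simp only [if_true, one_mul] at this
  exact_mod_cast this

theorem roundEnd_total_false (σ : ChamState n N) :
    (roundEnd a b false σ).total + depinked a b σ = σ.total := by
  have := roundEnd_total (a := a) (b := b) false σ
  simp only [Bool.false_eq_true, if_false] at this
  omega

theorem lintegral_total (ha : 0 < a) (hb : 0 < b) (hξ : ∑ v, chi a b (ξ v) = N) (j : ℕ) :
    ∫⁻ c, ((chamRound a b N (colourDrive γ c) T ξ x j).total : ENNReal) ∂colourLaw =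
      (2 * chi a b (ξ x) : ℕ) := by
  induction j with
  | zero =>
    have : ∀ c, (chamRound a b N (colourDrive γ c) T ξ x 0).total = 2 * chi a b (ξ x) := by
      intro c
      simp [chamRound, chamInit, ChamState.total]
    simp [this]
  | succ j ih =>
    rw [← ih, lintegral_chamRound_succ x j fun σ => (σ.total : ENNReal)]
    refine lintegral_congr fun c => ?_
    have h1 := roundEnd_total_true (a := a) (b := b) (roundLast a b N (colourDrive γ c) T ξ x j)
    have h2 := roundEnd_total_false (a := a) (b := b) (roundLast a b N (colourDrive γ c) T ξ x j)
    have h3 : (roundLast a b N (colourDrive γ c) T ξ x j).total = _ :=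
      total_preRing (colourDrive γ c) T x ha hb hξ j _
    rw [h3] at h1 h2
    rw [← Nat.cast_add, h1, ← h2]
    generalize (roundEnd a b false (roundLast a b N (colourDrive γ c) T ξ x j)).total = p
    generalize depinked a b (roundLast a b N (colourDrive γ c) T ξ x j) = q
    rw [show p + q + q + p = (p + q) * 2 by ring, Nat.cast_mul, Nat.cast_ofNat,
      ENNReal.mul_div_cancel_right (by norm_num) (by norm_num)]

/-- Orthogonality of martingale increments: the fair sign removes the cross term of the square. -/
theorem lintegral_sq_total (ha : 0 < a) (hb : 0 < b) (hξ : ∑ v, chi a b (ξ v) = N) (j : ℕ) :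
    ∫⁻ c, (((chamRound a b N (colourDrive γ c) T ξ x j).total ^ 2 : ℕ) : ENNReal) ∂colourLaw +
      ∫⁻ c, ((depinked a b (roundLast a b N (colourDrive γ c) T ξ x j) ^ 2 : ℕ) : ENNReal)
        ∂colourLaw =
      ∫⁻ c, (((chamRound a b N (colourDrive γ c) T ξ x (j + 1)).total ^ 2 : ℕ) : ENNReal)
        ∂colourLaw := by
  have hm : Measurable fun c =>
      (((chamRound a b N (colourDrive γ c) T ξ x j).total ^ 2 : ℕ) : ENNReal) :=
    (Measurable.of_discrete (f := fun σ : ChamState n N => ((σ.total ^ 2 : ℕ) : ENNReal))).comp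
      ((measDrive_colourDrive γ).chamRound a b N T ξ x j)
  rw [← lintegral_add_left hm, lintegral_chamRound_succ x j fun σ => ((σ.total ^ 2 : ℕ) : ENNReal)]
  refine lintegral_congr fun c => ?_
  have h1 := roundEnd_total_true (a := a) (b := b) (roundLast a b N (colourDrive γ c) T ξ x j)
  have h2 := roundEnd_total_false (a := a) (b := b) (roundLast a b N (colourDrive γ c) T ξ x j)
  have h3 : (roundLast a b N (colourDrive γ c) T ξ x j).total = _ :=
    total_preRing (colourDrive γ c) T x ha hb hξ j _
  rw [h3] at h1 h2
  rw [← Nat.cast_add, ← Nat.cast_add, h1, ← h2]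
  generalize (roundEnd a b false (roundLast a b N (colourDrive γ c) T ξ x j)).total = p
  generalize depinked a b (roundLast a b N (colourDrive γ c) T ξ x j) = q
  rw [show (p + q + q) ^ 2 + p ^ 2 = ((p + q) ^ 2 + q ^ 2) * 2 by ring, Nat.cast_mul, Nat.cast_ofNat,
    ENNReal.mul_div_cancel_right (by norm_num) (by norm_num)]

/-- Almost surely, pink particles are depinked at the ends of finitely many rounds only. -/
theorem ae_depinked_eventually_zero (ha : 0 < a) (hb : 0 < b) (hξ : ∑ v, chi a b (ξ v) = N) :
    ∀ᵐ c ∂colourLaw, ∃ J, ∀ j ≥ J,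
      depinked a b (roundLast a b N (colourDrive γ c) T ξ x j) = 0 := by
  have hm : ∀ j, Measurable fun c =>
      ((depinked a b (roundLast a b N (colourDrive γ c) T ξ x j) ^ 2 : ℕ) : ENNReal) := fun j =>
    (Measurable.of_discrete (f := fun σ : ChamState n N =>
      ((depinked a b σ ^ 2 : ℕ) : ENNReal))).comp
      ((measDrive_colourDrive γ).roundLast a b N T ξ x j)
  -- The second moments telescope and are bounded by `(2N)²`, so the squared increments have a
  -- finite mean sum.
  have hsum : ∀ J, ∑ j ∈ Finset.range J,
      ∫⁻ c, ((depinked a b (roundLast a b N (colourDrive γ c) T ξ x j) ^ 2 : ℕ) : ENNReal)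
        ∂colourLaw ≤
      ∫⁻ c, (((chamRound a b N (colourDrive γ c) T ξ x J).total ^ 2 : ℕ) : ENNReal)
        ∂colourLaw := by
    intro J
    induction J with
    | zero => simp
    | succ J ih =>
      rw [Finset.sum_range_succ, ← lintegral_sq_total x γ ha hb hξ J]
      gcongr
  have hbd : ∀ J, ∫⁻ c, (((chamRound a b N (colourDrive γ c) T ξ x J).total ^ 2 : ℕ) : ENNReal)
        ∂colourLaw ≤ (((2 * N) ^ 2 : ℕ) : ENNReal) := by
    intro J
    calc _ ≤ ∫⁻ _, (((2 * N) ^ 2 : ℕ) : ENNReal) ∂colourLaw := by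
          refine lintegral_mono fun c => Nat.cast_le.2 (Nat.pow_le_pow_left ?_ 2)
          exact (valid_chamRound (colourDrive γ c) T x ha hb hξ J).total_le
      _ = _ := by simp
  have hfin : ∫⁻ c, ∑' j, ((depinked a b (roundLast a b N (colourDrive γ c) T ξ x j) ^ 2 : ℕ)
      : ENNReal) ∂colourLaw ≠ ⊤ := by
    rw [lintegral_tsum fun j => (hm j).aemeasurable]
    refine ne_top_of_le_ne_top (ENNReal.natCast_ne_top ((2 * N) ^ 2)) ?_
    rw [ENNReal.tsum_eq_iSup_nat]
    exact iSup_le fun J => (hsum J).trans (hbd J)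
  filter_upwards [ae_lt_top (Measurable.tsum hm) hfin] with c hc
  have h0 := ENNReal.tendsto_atTop_zero_of_tsum_ne_top hc.ne
  -- The terms of a convergent series of natural numbers vanish from some point on.
  have h1 := h0.eventually (gt_mem_nhds (zero_lt_one' ENNReal))
  obtain ⟨J, hJ⟩ := eventually_atTop.1 h1
  refine ⟨J, fun j hj => ?_⟩
  have h2 := hJ j hj
  rw [← Nat.cast_one, Nat.cast_lt, Nat.lt_one_iff] at h2
  exact pow_eq_zero_iff (two_ne_zero) |>.1 h2

end Martingale

/-! ### The ring times -/

section Gaps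

theorem expMeasure_Iic {r : ℝ} (hr : 0 < r) {y : ℝ} (hy : 0 ≤ y) :
    expMeasure r (Set.Iic y) = ENNReal.ofReal (1 - Real.exp (-(r * y))) := by
  have := isProbabilityMeasure_expMeasure hr
  rw [← ofReal_cdf, cdf_expMeasure_eq hr, if_pos hy]

theorem expMeasure_Iic_pos {r : ℝ} (hr : 0 < r) {y : ℝ} (hy : 0 < y) :
    0 < expMeasure r (Set.Iic y) := by
  rw [expMeasure_Iic hr hy.le, ENNReal.ofReal_pos, sub_pos, Real.exp_lt_one_iff]
  have := mul_pos hr hy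
  linarith

theorem expMeasure_Ioi_pos {r : ℝ} (hr : 0 < r) {y : ℝ} (hy : 0 ≤ y) :
    0 < expMeasure r (Set.Ioi y) := by
  have := isProbabilityMeasure_expMeasure hr
  rw [← Set.compl_Iic, prob_compl_eq_one_sub measurableSet_Iic, expMeasure_Iic hr hy,
    tsub_pos_iff_lt, ← ENNReal.ofReal_one, ENNReal.ofReal_lt_ofReal_iff one_pos]
  have := Real.exp_pos (-(r * y))
  linarith

theorem ae_expMeasure_pos {r : ℝ} (hr : 0 < r) : ∀ᵐ y ∂expMeasure r, 0 < y := by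
  rw [ae_iff]
  have : {y : ℝ | ¬ 0 < y} = Set.Iic 0 := by
    ext
    simp
  rw [this, expMeasure_Iic hr le_rfl]
  simp

/-- Infinitely often there are `L` consecutive values in a set of positive probability. -/
theorem ae_exists_run_mem {ν : Measure ℝ} [IsProbabilityMeasure ν] {A : Set ℝ}
    (hA : MeasurableSet A) (hpos : 0 < ν A) (L K : ℕ) :
    ∀ᵐ g ∂seqLaw ν, ∃ k ≥ K, ∀ l < L, g (k + l) ∈ A := by
  -- Disjoint blocks of length `L` from index `K` on; each entry is in `A` with probability `ν A`,
  -- independently of the others.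
  have h := ae_exists_run (Φ := fun k (g : ℕ → ℝ) y => Function.update g k y)
    (fun k => resamples_update ν k) (L := L) (s := fun i => K + i * L)
    (fun i => by
      show K + i * L + L ≤ K + (i + 1) * L
      ring_nf
      omega)
    (R := fun i l => {g | g (K + i * L + l) ∈ A}) (fun i l => measurable_pi_apply _ hA)
    (fun i l _ k hk θ y => by
      show Function.update θ k y (K + i * L + l) ∈ A ↔ θ (K + i * L + l) ∈ A
      rw [Function.update_of_ne (by omega)])
    hpos
    (fun i l _ θ => by
      show ν A ≤ ν {y | Function.update θ (K + i * L + l) y (K + i * L + l) ∈ A}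
      simp)
  filter_upwards [h] with g ⟨i, hi⟩
  exact ⟨K + i * L, by omega, hi⟩

variable {n : ℕ} {G : SimpleGraph (Fin n)} {D : Drive G} {T : ℝ}

theorem ringTime_succ (k : ℕ) : ringTime D (k + 1) = ringTime D k + D.gap (k + 1) :=
  Finset.sum_range_succ _ _

theorem ringTime_strictMono (hpos : ∀ k, 0 < D.gap k) : StrictMono (ringTime D) :=
  strictMono_nat_of_lt_succ fun k => by
    rw [ringTime_succ]
    linarith [hpos (k + 1)]

theorem ringTime_pos (hpos : ∀ k, 0 < D.gap k) (k : ℕ) : 0 < ringTime D k :=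
  Finset.sum_pos (fun i _ => hpos i) ⟨0, by simp⟩

theorem ringCount_zero (hpos : ∀ k, 0 < D.gap k) : ringCount D 0 = 0 := by
  have : {k : ℕ | ringTime D k ≤ 0} = ∅ := by
    ext k
    simp [ringTime_pos hpos k]
  rw [ringCount, this, Set.ncard_empty]

/-- Infinitely many rings in bounded time would make the gaps summable, against gaps longer than 1
that occur infinitely often. -/
theorem regular_of_gap (hpos : ∀ k, 0 < D.gap k) (hbig : ∀ K, ∃ k ≥ K, 1 < D.gap k) :
    Regular D := by
  intro t
  by_contra h
  have h1 : ∀ k, ringTime D k ≤ t := by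
    intro k
    obtain ⟨l, hl, hkl⟩ := Set.Infinite.exists_gt h k
    exact ((ringTime_strictMono hpos).monotone hkl.le).trans hl
  have h2 : Summable D.gap := by
    refine summable_of_sum_range_le (c := t) (fun k => (hpos k).le) fun k => ?_
    refine le_trans ?_ (h1 k)
    exact Finset.sum_le_sum_of_subset_of_nonneg (Finset.range_mono (Nat.le_succ k))
      fun i _ _ => (hpos i).le
  obtain ⟨K, hK⟩ := eventually_atTop.1 (h2.tendsto_atTop_zero.eventually (gt_mem_nhds one_pos))
  obtain ⟨k, hk, hk1⟩ := hbig K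
  exact absurd hk1 (not_lt.2 (hK k hk).le)

/-- The rings up to time `t` form an initial segment of indices beginning with 0, so their number is
the first index not among them. -/
theorem lt_ringCount_iff (hpos : ∀ k, 0 < D.gap k) (hreg : Regular D) (k : ℕ) (t : ℝ) :
    k < ringCount D t ↔ ringTime D k ≤ t := by
  have hmono := (ringTime_strictMono hpos).monotone
  constructor
  · intro h
    by_contra h1
    have h2 : {l : ℕ | ringTime D l ≤ t} ⊆ Set.Iio k := by
      intro l hl
      by_contra h3
      exact h1 ((hmono (not_lt.1 h3)).trans hl)
    have h3 := Set.ncard_le_ncard h2 (Set.finite_Iio k)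
    rw [show (Set.Iio k).ncard = k by
      rw [Set.ncard_eq_toFinset_card', Set.toFinset_Iio, Nat.card_Iio]] at h3
    exact absurd h (not_lt.2 h3)
  · intro h
    have h2 : Set.Iic k ⊆ {l : ℕ | ringTime D l ≤ t} := fun l hl => (hmono hl).trans h
    have h3 := Set.ncard_le_ncard h2 (hreg t)
    rw [show (Set.Iic k).ncard = k + 1 by
      rw [Set.ncard_eq_toFinset_card', Set.toFinset_Iic, Nat.card_Iic]] at h3
    exact h3

theorem ringTime_add_le {k M : ℕ} {δ : ℝ} (h : ∀ l < M, D.gap (k + 1 + l) ≤ δ) :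
    ringTime D (k + M) ≤ ringTime D k + M * δ := by
  induction M with
  | zero => simp
  | succ M ih =>
    have h1 := ih fun l hl => h l (by omega)
    have h2 := h M (by omega)
    rw [← add_assoc, ringTime_succ]
    rw [show k + 1 + M = k + M + 1 by ring] at h2
    push_cast
    linarith

/-- A run of short gaps gives `L` consecutive rings in one round. -/
theorem exists_window_of_run (hT : 0 < T) (hpos : ∀ k, 0 < D.gap k) (hreg : Regular D) {L k : ℕ}
    (hrun : ∀ l < 2 * L, D.gap (k + 1 + l) ≤ T / (2 * L + 1)) :
    ∃ j k' : ℕ, k ≤ k' ∧ ringCount D (j * T) ≤ k' ∧ k' + L ≤ ringCount D ((j + 1) * T) := by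
  -- Ring `k` falls into the time interval `(jT, (j+1)T]`.
  obtain ⟨j, hj⟩ : ∃ j : ℕ, ⌈ringTime D k / T⌉₊ = j + 1 :=
    Nat.exists_eq_succ_of_ne_zero (Nat.ceil_pos.2 (div_pos (ringTime_pos hpos k) hT)).ne'
  have h1 : ringTime D k ≤ (j + 1) * T := by
    rw [← div_le_iff₀ hT]
    refine (Nat.le_ceil _).trans ?_
    rw [hj]
    push_cast
    rfl
  have h2 : j * T < ringTime D k := by
    rw [← lt_div_iff₀ hT]
    exact Nat.lt_ceil.1 (by omega)
  have hlt : ∀ (t : ℝ) (l : ℕ), t < ringTime D l → ringCount D t ≤ l := fun t l h => by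
    by_contra h'
    exact absurd ((lt_ringCount_iff hpos hreg l t).1 (not_le.1 h')) (not_le.2 h)
  -- Either the first `L` of the short gaps stay in this round, or ring `k + L` is in a later one.
  -- In the second case all `2L` gaps together last less than `T`, so ring `k + 2L` still comes
  -- within round `j + 1`.
  by_cases h3 : ringTime D (k + L) ≤ (j + 1) * T
  · exact ⟨j, k, le_rfl, hlt _ _ h2, ((lt_ringCount_iff hpos hreg _ _).2 h3).le⟩
  · refine ⟨j + 1, k + L, by omega, ?_, ?_⟩
    · push_cast
      exact hlt _ _ (not_le.1 h3)
    · refine ((lt_ringCount_iff hpos hreg (k + L + L) _).2 ?_).le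
      have h4 := ringTime_add_le hrun
      have h5 : ((2 * L : ℕ) : ℝ) * (T / (2 * L + 1)) ≤ T := by
        rw [mul_div_assoc', div_le_iff₀ (by positivity)]
        push_cast
        nlinarith
      rw [show k + L + L = k + 2 * L by ring]
      push_cast
      push_cast at h4 h5
      linarith

/-- There are late rounds with many rings. -/
def Windows (D : Drive G) (T : ℝ) : Prop :=
  ∀ L K : ℕ, ∃ j k : ℕ, K ≤ j ∧ K ≤ k ∧ ringCount D (j * T) ≤ k ∧ k + L ≤ ringCount D ((j + 1) * T)

theorem windows_of_run (hT : 0 < T) (hpos : ∀ k, 0 < D.gap k) (hreg : Regular D)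
    (hrun : ∀ L K : ℕ, ∃ k ≥ K, ∀ l < 2 * L, D.gap (k + l) ≤ T / (2 * L + 1)) : Windows D T := by
  intro L K
  -- The extra ring makes the window nonempty even for `L = 0`. A ring with index at least
  -- `ringCount D (K * T)` can only be in a round `j ≥ K`.
  obtain ⟨k, hk, h⟩ := hrun (L + 1) (max K (ringCount D (K * T)) + 1)
  obtain ⟨k, rfl⟩ : ∃ k', k = k' + 1 := ⟨k - 1, by omega⟩
  obtain ⟨j, k', hkk', h1, h2⟩ := exists_window_of_run hT hpos hreg h
  refine ⟨j, k', ?_, by omega, h1, by omega⟩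
  by_contra hjK
  have h3 : ringCount D ((j + 1) * T) ≤ ringCount D (K * T) := by
    refine hreg.ringCount_mono (mul_le_mul_of_nonneg_right ?_ hT.le)
    exact_mod_cast not_le.1 hjK
  omega

/-- Almost surely, the rings do not accumulate and there are late rounds with many rings. -/
theorem ae_gap {r : ℝ} [IsProbabilityMeasure (expMeasure r)] (hr : 0 < r) (hT : 0 < T) :
    ∀ᵐ g ∂seqLaw (expMeasure r), ∀ D : Drive G, D.gap = g →
      Regular D ∧ ringCount D 0 = 0 ∧ Windows D T := by
  have h1 : ∀ᵐ g ∂seqLaw (expMeasure r), ∀ k, 0 < g k := by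
    rw [ae_all_iff]
    intro k
    exact (measurePreserving_eval_infinitePi (fun _ => expMeasure r) k).quasiMeasurePreserving.ae
      (ae_expMeasure_pos hr)
  have h2 : ∀ᵐ g ∂seqLaw (expMeasure r), ∀ K, ∃ k ≥ K, ∀ l < 1, g (k + l) ∈ Set.Ioi (1 : ℝ) :=
    ae_all_iff.2 fun K =>
      ae_exists_run_mem measurableSet_Ioi (expMeasure_Ioi_pos hr zero_le_one) 1 K
  have h3 : ∀ᵐ g ∂seqLaw (expMeasure r), ∀ L K : ℕ, ∃ k ≥ K, ∀ l < 2 * L,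
      g (k + l) ∈ Set.Iic (T / (2 * L + 1)) :=
    ae_all_iff.2 fun L => ae_all_iff.2 fun K =>
      ae_exists_run_mem measurableSet_Iic (expMeasure_Iic_pos hr (by positivity)) (2 * L) K
  filter_upwards [h1, h2, h3] with g h1 h2 h3
  rintro D rfl
  have hreg : Regular D := regular_of_gap h1 fun K => by
    obtain ⟨k, hk, h⟩ := h2 K
    exact ⟨k, hk, h 0 one_pos⟩
  exact ⟨hreg, ringCount_zero h1, windows_of_run hT h1 hreg h3⟩

end Gaps

/-! ### The ink is absorbed -/

/-- Finitely many positive bounds have a positive minimum; the bound `ε ≤ 1` serves the states for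
which there is nothing to prove. -/
theorem exists_uniform_pos {α : Type*} {S : Set α} (hS : S.Finite) {p : α → ENNReal → Prop}
    (hp : ∀ s ε ε', ε ≤ ε' → p s ε' → p s ε) (h : ∀ s ∈ S, ∃ ε > 0, p s ε) :
    ∃ ε > 0, ε ≤ 1 ∧ ∀ s ∈ S, p s ε := by
  induction S, hS using Set.Finite.induction_on with
  | empty => exact ⟨1, one_pos, le_rfl, by simp⟩
  | @insert s S _ _ ih =>
    obtain ⟨ε, h0, h1, h2⟩ := ih fun s hs => h s (Or.inr hs)
    obtain ⟨ε', h0', h'⟩ := h s (Or.inl rfl)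
    refine ⟨min ε ε', lt_min h0 h0', (min_le_left _ _).trans h1, ?_⟩
    rintro z (rfl | hz)
    · exact hp _ _ _ (min_le_right _ _) h'
    · exact hp _ _ _ (min_le_left _ _) (h2 z hz)

section Absorption

variable {n : ℕ} {G : SimpleGraph (Fin n)} {a b N : ℕ}

/-- All counts are bounded by `N`; for the black particles this uses `χ(k) ≥ k`, which holds as `a ≥
1`. -/
theorem finite_valid (ha : 0 < a) : {σ : ChamState n N | σ.Valid a b}.Finite := by
  have hfin : (Set.univ : Set ((Fin n → Fin (N + 1)) × (Fin n → Fin (N + 1)) ×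
    (Fin n → Fin (N + 1)) × (Fin N → Option (Fin n)) × (Fin N → Option (Fin n)))).Finite :=
    Set.finite_univ
  refine (hfin.image fun p => (⟨fun v => p.1 v, fun v => p.2.1 v, fun v => p.2.2.1 v, p.2.2.2.1,
    p.2.2.2.2⟩ : ChamState n N)).subset ?_
  intro σ hσ
  have h0 : ∀ v, chi a b (σ.B v) ≤ N := fun v =>
    le_of_le_of_eq (Finset.single_le_sum (f := fun v => chi a b (σ.B v))
      (fun _ _ => Nat.zero_le _) (Finset.mem_univ v)) hσ.chi_sum
  have h1 : ∀ v, σ.B v < N + 1 := by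
    intro v
    have h2 := h0 v
    simp only [chi] at h2
    nlinarith
  have h2 : ∀ v, σ.R v < N + 1 := by
    intro v
    have := hσ.le v
    have := h0 v
    omega
  have h3 : ∀ v, σ.P v < N + 1 := by
    intro v
    have := hσ.le v
    have := h0 v
    omega
  exact ⟨(fun v => ⟨σ.B v, h1 v⟩, fun v => ⟨σ.R v, h2 v⟩, fun v => ⟨σ.P v, h3 v⟩, σ.LR, σ.LW),
    trivial, rfl⟩

theorem finite_isSplit {e : Fin n × Fin n} (he : e.1 ≠ e.2) (B : Fin n → ℕ) :
    {B' | IsSplit e B B'}.Finite :=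
  (configs n (∑ v, B v)).finite_toSet.subset fun _ hB =>
    Finset.mem_coe.2 (mem_configs.2 (IsSplit.sum_eq he hB))

/-- There is a uniform lower bound for the probability of progress at a ring. -/
theorem exists_progress_rate (hG : G.Connected) (e₀ : Edge G) (ha : 0 < a) (hb : 0 < b)
    {r : Edge G → ℝ} [IsProbabilityMeasure (edgeLaw r)] (hr : ∀ e, 0 < r e) :
    ∃ ε : ENNReal, ε > 0 ∧ ε ≤ 1 ∧
      ∀ σ ∈ {σ : ChamState n N | σ.Valid a b}, σ.Unsaturated a b → ∀ u : ℝ,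
      ε ≤ ((edgeLaw r).prod unitLaw) {y | Progress G σ
        (samplePMF (chamKernel a b y.1.1 (mabb ((b : ℝ) / a) u y.1.1 σ.B) σ) y.2)} := by
  refine exists_uniform_pos (finite_valid ha) (fun σ ε ε' h hp hu u => h.trans (hp hu u)) ?_
  intro σ hσ
  by_cases hu : σ.Unsaturated a b
  swap
  · exact ⟨1, one_pos, fun h => absurd h hu⟩
  obtain ⟨e, he⟩ := exists_progress hG e₀ ha hb hσ hu
  -- Taking the minimum over the finitely many moves of the black particles makes the bound
  -- independent of the black variable `u`.
  obtain ⟨q, hq0, -, hq⟩ := exists_uniform_pos (finite_isSplit e.2.1.ne σ.B)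
    (p := fun B' ε => ∃ σ', ε ≤ chamKernel a b e.1 B' σ σ' ∧ Progress G σ σ')
    (fun _ _ _ h ⟨σ', h1, h2⟩ => ⟨σ', h.trans h1, h2⟩) fun B' hB' => by
      obtain ⟨σ', h1, h2⟩ := he B' hB'
      exact ⟨_, (PMF.mem_support_iff _ _).1 h1 |> pos_iff_ne_zero.2, σ', le_rfl, h2⟩
  refine ⟨edgeLaw r {e} * q, ENNReal.mul_pos (edgeLaw_singleton_pos hr e).ne' hq0.ne', ?_⟩
  intro _ u
  obtain ⟨σ', h1, h2⟩ := hq _ (isSplit_mabb ((b : ℝ) / a) u e.2.1.ne σ.B)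
  calc edgeLaw r {e} * q
      ≤ edgeLaw r {e} * unitLaw {z | samplePMF
          (chamKernel a b e.1 (mabb ((b : ℝ) / a) u e.1 σ.B) σ) z = σ'} := by
        rw [unitLaw_samplePMF_eq (finite_support_chamKernel _ _ _ _ _)]
        gcongr
    _ = ((edgeLaw r).prod unitLaw) ({e} ×ˢ {z | samplePMF
          (chamKernel a b e.1 (mabb ((b : ℝ) / a) u e.1 σ.B) σ) z = σ'}) :=
        (Measure.prod_prod _ _).symm
    _ ≤ _ := by
        refine measure_mono ?_
        rintro ⟨e', z⟩ ⟨h3, h4⟩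
        rw [Set.mem_singleton_iff] at h3
        subst h3
        rw [Set.mem_ofPred_eq] at h4 ⊢
        rwa [h4]

theorem exists_pairDist_bound (G : SimpleGraph (Fin n)) (ha : 0 < a) (b N : ℕ) :
    ∃ L : ℕ, ∀ σ : ChamState n N, σ.Valid a b → pairDist G σ < L := by
  obtain ⟨L, hL⟩ := ((finite_valid (n := n) (b := b) (N := N) ha).image (pairDist G)).bddAbove
  exact ⟨L + 1, fun σ hσ => Nat.lt_succ_of_le (hL ⟨σ, hσ, rfl⟩)⟩

variable {T : ℝ} {ξ : Fin n → ℕ} (x : Fin n)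

/-- The randomness of the graphical construction apart from the ring times. -/
abbrev Rest {n : ℕ} (G : SimpleGraph (Fin n)) : Type := (ℕ → Edge G) × (ℕ → ℝ) × Colour

/-- The law of the randomness apart from the ring times. -/
abbrev restLaw (r : Edge G → ℝ) [IsProbabilityMeasure (edgeLaw r)] : Measure (Rest G) :=
  (seqLaw (edgeLaw r)).prod ((seqLaw unitLaw).prod colourLaw)

/-- Replacement of the edge and the colour variable of the `k`-th ring. -/
def resampleRing (k : ℕ) (θ : Rest G) (y : Edge G × ℝ) : Rest G :=
  (Function.update θ.1 k y.1, θ.2.1, Function.update θ.2.2.1 k y.2, θ.2.2.2)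

theorem resamples_ring (r : Edge G → ℝ) [IsProbabilityMeasure (edgeLaw r)] (k : ℕ) :
    Resamples (restLaw r) ((edgeLaw r).prod unitLaw) (resampleRing k) :=
  ((resamples_update (edgeLaw r) k).left ((seqLaw unitLaw).prod colourLaw)).trans
    (((resamples_uc k).right (seqLaw unitLaw)).right (seqLaw (edgeLaw r)))

theorem preRing_resampleRing {g : ℕ → ℝ} (hT : 0 < T) (θ : Rest G)
    (hreg : Regular (toDrive (g, θ))) {j k l : ℕ}
    (hk : ringCount (toDrive (g, θ)) (j * T) ≤ k) (hl : k ≤ l) (y : Edge G × ℝ) :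
    preRing a b N (toDrive (g, resampleRing l θ y)) T ξ x j k =
      preRing a b N (toDrive (g, θ)) T ξ x j k :=
  (preRing_congr T ξ x (D := toDrive (g, θ)) (D' := toDrive (g, resampleRing l θ y)) hT hreg rfl hk
    (fun i hi => (Function.update_of_ne (by omega) _ _).symm) (fun _ _ => rfl)
    (fun i hi => (Function.update_of_ne (by omega) _ _).symm) fun _ _ => rfl).symm

/-- Almost surely, there are late runs of rings in one round with progress at every ring. -/
theorem ae_exists_progress_run (hG : G.Connected) (e₀ : Edge G) (ha : 0 < a) (hb : 0 < b)
    (hξ : ∑ v, chi a b (ξ v) = N) (hT : 0 < T) {r : Edge G → ℝ} [IsProbabilityMeasure (edgeLaw r)]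
    (hr : ∀ e, 0 < r e) {g : ℕ → ℝ} (hg : ∀ D : Drive G, D.gap = g → Regular D ∧ Windows D T)
    (L J : ℕ) :
    ∀ᵐ θ ∂restLaw r, ∃ j k : ℕ, J ≤ j ∧ ringCount (toDrive (g, θ)) (j * T) ≤ k ∧
      k + L ≤ ringCount (toDrive (g, θ)) ((j + 1) * T) ∧
      ∀ l < L, (preRing a b N (toDrive (g, θ)) T ξ x j (k + l)).Unsaturated a b →
        Progress G (preRing a b N (toDrive (g, θ)) T ξ x j (k + l))
          (preRing a b N (toDrive (g, θ)) T ξ x j (k + l + 1)) := by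
  obtain ⟨ε, hε0, hε1, hε⟩ := exists_progress_rate (N := N) hG e₀ ha hb hr
  -- The windows depend on the gaps only, so they can be read off from any choice of the remaining
  -- variables.
  let θ₀ : Rest G := (fun _ => e₀, fun _ => 0, fun _ => 0, fun _ => true)
  choose jf kf h1 h2 h3 h4 using (hg (toDrive (g, θ₀)) rfl).2 L
  -- Each window is requested beyond the end of the previous one, so that the runs are disjoint; the
  -- summand `J` keeps the rounds late.
  let K : ℕ → ℕ := fun i => Nat.rec J (fun _ K => kf K + L + J) i
  have hK0 : ∀ i, J ≤ K i := by
    intro i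
    cases i with
    | zero => exact le_rfl
    | succ i => exact Nat.le_add_left _ _
  let R : ℕ → ℕ → Set (Rest G) := fun i l =>
    {θ | (preRing a b N (toDrive (g, θ)) T ξ x (jf (K i)) (kf (K i) + l)).Unsaturated a b →
        Progress G (preRing a b N (toDrive (g, θ)) T ξ x (jf (K i)) (kf (K i) + l))
          (preRing a b N (toDrive (g, θ)) T ξ x (jf (K i)) (kf (K i) + l + 1))}
  have hD : MeasDrive fun θ : Rest G => toDrive (g, θ) :=
    measDrive_toDrive.comp (f := fun θ : Rest G => (g, θ)) (by fun_prop)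
  have hrun := ae_exists_run (P := restLaw r) (resamples_ring r) (L := L) (s := fun i => kf (K i))
    (R := R) (fun i => ?_) (fun i l => ?_) (fun i l _ => ?_) hε0 (fun i l _ θ => ?_)
  · filter_upwards [hrun] with θ ⟨i, hi⟩
    exact ⟨jf (K i), kf (K i), (hK0 i).trans (h1 _), h3 _, h4 _, hi⟩
  · have h5 : kf (K i) + L + J ≤ kf (K (i + 1)) := h2 (K (i + 1))
    omega
  · exact ((hD.preRing a b N T ξ x _ _).prodMk (hD.preRing a b N T ξ x _ _))
      (MeasurableSet.of_discrete (s := {p : ChamState n N × ChamState n N |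
        p.1.Unsaturated a b → Progress G p.1 p.2}))
  · intro k hk θ y
    have h5 : ringCount (toDrive (g, θ)) (jf (K i) * T) ≤ kf (K i) := h3 _
    have hreg := (hg (toDrive (g, θ)) rfl).1
    show (_ → _) ↔ (_ → _)
    rw [preRing_resampleRing x hT θ hreg (h5.trans (by omega)) (by omega) y,
      preRing_resampleRing x hT θ hreg (h5.trans (by omega)) (by omega) y]
  · have h5 : ringCount (toDrive (g, θ)) (jf (K i) * T) ≤ kf (K i) := h3 _
    have hreg := (hg (toDrive (g, θ)) rfl).1
    by_cases hu : (preRing a b N (toDrive (g, θ)) T ξ x (jf (K i)) (kf (K i) + l)).Unsaturated a b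
    · refine (hε _ (valid_preRing _ T x ha hb hξ _ _) hu (θ.2.1 (kf (K i) + l))).trans
        (measure_mono ?_)
      intro y hy
      rw [Set.mem_ofPred_eq] at hy ⊢
      intro _
      have h6 := preRing_resampleRing (a := a) (b := b) (N := N) (ξ := ξ) x hT θ hreg
        (h5.trans (Nat.le_add_right _ l)) le_rfl y
      rw [preRing_succ (toDrive (g, resampleRing (kf (K i) + l) θ y)) T x
        (h5.trans (Nat.le_add_right _ l)), h6, chamRing]
      simpa [toDrive, resampleRing] using hy
    -- If nothing can be created, the event is the whole space, and `ε ≤ 1` suffices.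
    · refine le_of_le_of_eq hε1 ?_
      rw [← measure_univ (μ := (edgeLaw r).prod unitLaw)]
      congr 1
      symm
      rw [Set.eq_univ_iff_forall]
      intro y hu'
      have h6 := preRing_resampleRing (a := a) (b := b) (N := N) (ξ := ξ) x hT θ hreg
        (h5.trans (Nat.le_add_right _ l)) le_rfl y
      rw [h6] at hu'
      exact absurd hu' hu

variable {x}

/-- The total ink stays at one of the extremes, if few particles are depinked and there are late runs
of rings with progress. -/
theorem total_eventually_extreme {D : Drive G} (ha : 0 < a) (hb : 0 < b)
    (hξ : ∑ v, chi a b (ξ v) = N) (hT : 0 < T) (hreg : Regular D) {L : ℕ}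
    (hL : ∀ σ : ChamState n N, σ.Valid a b → pairDist G σ < L) {J₀ : ℕ}
    (hd : ∀ j ≥ J₀, depinked a b (roundLast a b N D T ξ x j) = 0)
    (hrun : ∀ J : ℕ, ∃ j k : ℕ, J ≤ j ∧ ringCount D (j * T) ≤ k ∧
      k + L ≤ ringCount D ((j + 1) * T) ∧
      ∀ l < L, (preRing a b N D T ξ x j (k + l)).Unsaturated a b →
        Progress G (preRing a b N D T ξ x j (k + l)) (preRing a b N D T ξ x j (k + l + 1))) :
    (∀ j ≥ J₀, (chamRound a b N D T ξ x j).total = 0) ∨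
      ∀ j ≥ J₀, (chamRound a b N D T ξ x j).total = 2 * N := by
  have hconst : ∀ j ≥ J₀, (chamRound a b N D T ξ x j).total =
      (chamRound a b N D T ξ x J₀).total := by
    intro j hj
    induction j, hj using Nat.le_induction with
    | base => rfl
    | succ j hj ih =>
      have h1 := roundEnd_total (a := a) (b := b) (D.coin j) (roundLast a b N D T ξ x j)
      have h2 : (roundLast a b N D T ξ x j).total = _ := total_preRing D T x ha hb hξ j _
      rw [hd j hj, h2, ih] at h1
      rw [chamRound_succ]
      simpa using h1
  by_contra hcon
  rw [not_or] at hcon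
  have hne0 : (chamRound a b N D T ξ x J₀).total ≠ 0 := fun h =>
    hcon.1 fun j hj => (hconst j hj).trans h
  have hneN : (chamRound a b N D T ξ x J₀).total ≠ 2 * N := fun h =>
    hcon.2 fun j hj => (hconst j hj).trans h
  -- A saturated round end at which nothing is depinked has no pinks, and no reds or no whites; its
  -- ink would be `0` or `N`.
  have hun : ∀ j ≥ J₀, (roundLast a b N D T ξ x j).Unsaturated a b := by
    intro j hj
    rw [unsaturated_iff]
    intro hs
    have h1 := hd j hj
    rw [depinked, if_pos hs] at h1
    have h2 : (roundLast a b N D T ξ x j).total = _ := total_preRing D T x ha hb hξ j _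
    rw [hconst j hj, ChamState.total, h1] at h2
    have h3 := (valid_preRing D T x ha hb hξ j (ringCount D ((j + 1) * T))).sum_W
    change ∑ v, (roundLast a b N D T ξ x j).R v + ∑ v, (roundLast a b N D T ξ x j).P v +
      ∑ v, (roundLast a b N D T ξ x j).W a b v = N at h3
    rw [Saturated, h1] at hs
    omega
  have hstep : ∀ j k : ℕ, ringCount D (j * T) ≤ k → RingStep a b
      (nextBlack a b D k (preRing a b N D T ξ x j k).B) (preRing a b N D T ξ x j k)
      (preRing a b N D T ξ x j (k + 1)) := by
    intro j k hk
    rw [preRing_succ D T x hk]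
    exact ringStep_chamRing D ha hb (valid_preRing D T x ha hb hξ j k) k
  have hPmono : ∀ j k l : ℕ, ringCount D (j * T) ≤ k → k ≤ l →
      ∑ v, (preRing a b N D T ξ x j k).P v ≤ ∑ v, (preRing a b N D T ξ x j l).P v := by
    intro j k l hk hl
    induction l, hl using Nat.le_induction with
    | base => rfl
    | succ l hl ih => exact ih.trans (hstep j l (hk.trans hl)).sum_P_le
  have hunk : ∀ j ≥ J₀, ∀ k, ringCount D (j * T) ≤ k → k ≤ ringCount D ((j + 1) * T) →
      (preRing a b N D T ξ x j k).Unsaturated a b := by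
    intro j hj k hk hk'
    have : ∀ l, k ≤ l → (preRing a b N D T ξ x j l).Unsaturated a b →
        (preRing a b N D T ξ x j k).Unsaturated a b := by
      intro l hl
      induction l, hl using Nat.le_induction with
      | base => exact id
      | succ l hl ih => exact fun h => ih ((hstep j l (hk.trans hl)).unsaturated h)
    exact this _ hk' (hun j hj)
  have hround : ∀ j ≥ J₀, ∑ v, (chamRound a b N D T ξ x (j + 1)).P v =
      ∑ v, (roundLast a b N D T ξ x j).P v := fun j hj => by
    rw [chamRound_succ, roundEnd_sum_P_of_unsaturated _ (hun j hj)]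
  have hstart : ∀ j, preRing a b N D T ξ x j (ringCount D (j * T)) = chamRound a b N D T ξ x j :=
    fun j => preRing_of_le D T x le_rfl
  have hPround : ∀ j j', J₀ ≤ j → j ≤ j' → ∑ v, (chamRound a b N D T ξ x j).P v ≤
      ∑ v, (chamRound a b N D T ξ x j').P v := by
    intro j j' hj hj'
    induction j', hj' using Nat.le_induction with
    | base => rfl
    | succ j' hj' ih =>
      rw [hround j' (hj.trans hj')]
      refine ih.trans ?_
      rw [← hstart j']
      exact hPmono j' _ _ le_rfl (hreg.round_le T hT j')
  -- From `J₀` on the number of pinks never decreases, and it is at most `N`; from the round of its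
  -- maximum on it is constant.
  obtain ⟨J₁, hJ₁, hmax⟩ : ∃ J₁ ≥ J₀, ∀ j ≥ J₁, ∑ v, (chamRound a b N D T ξ x j).P v ≤
      ∑ v, (chamRound a b N D T ξ x J₁).P v := by
    have hb' : BddAbove ((fun j => ∑ v, (chamRound a b N D T ξ x j).P v) '' Set.Ici J₀) := by
      refine ⟨N, ?_⟩
      rintro _ ⟨j, -, rfl⟩
      have := (valid_chamRound D T x ha hb hξ j).sum_W
      show ∑ v, (chamRound a b N D T ξ x j).P v ≤ N
      omega
    obtain ⟨J₁, hJ₁, h⟩ := Nat.sSup_mem (Set.nonempty_Ici.image _) hb'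
    refine ⟨J₁, hJ₁, fun j hj => ?_⟩
    have h2 := le_csSup hb' ⟨j, le_trans hJ₁ hj, rfl⟩
    rw [← h] at h2
    exact h2
  obtain ⟨j, k, hj, hk, hkL, hprog⟩ := hrun J₁
  -- With no new pinks, progress can only mean a smaller distance. After `L` rings it would have
  -- dropped by `L`, although it was less than `L` at the start.
  have hdec : ∀ l ≤ L, pairDist G (preRing a b N D T ξ x j (k + l)) + l ≤
      pairDist G (preRing a b N D T ξ x j k) := by
    intro l hl
    induction l with
    | zero => exact le_rfl
    | succ l ih =>
      have h1 := ih (by omega)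
      rcases hprog l (by omega) (hunk j (hJ₁.trans hj) _ (by omega) (by omega)) with h2 | h2
      · exfalso
        have h3 := hPmono j (k + l + 1) _ (by omega) (show k + l + 1 ≤ ringCount D ((j + 1) * T) by omega)
        have h4 := hPmono j _ (k + l) le_rfl (by omega)
        have h5 : ∑ v, (chamRound a b N D T ξ x (j + 1)).P v = ∑ v, (preRing a b N D T ξ x j
          (ringCount D ((j + 1) * T))).P v := hround j (hJ₁.trans hj)
        rw [hstart j] at h4
        have h6 := hmax (j + 1) (by omega)
        have h7 := hPround J₁ j hJ₁ hj
        omega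
      · rw [show k + (l + 1) = k + l + 1 by ring]
        omega
  have h1 := hdec L le_rfl
  have h2 := hL _ (valid_preRing D T x ha hb hξ j k)
  omega

end Absorption

/-! ### The probability of Fill -/

section Fill

variable {n : ℕ} {G : SimpleGraph (Fin n)} {a b N : ℕ} {T : ℝ} {ξ : Fin n → ℕ} {x : Fin n}

/-- The values of the gaps, the edges and the variables for the non-marked particles. -/
abbrev Frame {n : ℕ} (G : SimpleGraph (Fin n)) : Type := (ℕ → ℝ) × (ℕ → Edge G) × (ℕ → ℝ)

/-- The part of a graphical construction that determines the non-marked particles. -/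
def frame (D : Drive G) : Frame G := (D.gap, D.edge, D.ub)

/-- The part of a graphical construction that is used only by the marked particle and the
colours. -/
def colour (D : Drive G) : Colour := (D.uc, D.coin)

theorem measDrive_frame : MeasDrive fun p : Frame G × Colour => colourDrive p.1 p.2 :=
  measDrive_toDrive.comp (f := fun p : Frame G × Colour => (p.1.1, p.1.2.1, p.1.2.2, p.2))
    (by fun_prop)

/-- The law of the part of a graphical construction that determines the non-marked particles. -/
abbrev frameLaw (r : Edge G → ℝ) [IsProbabilityMeasure (edgeLaw r)]
    [IsProbabilityMeasure (expMeasure (∑ e, r e))] : Measure (Frame G) :=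
  (seqLaw (expMeasure (∑ e, r e))).prod ((seqLaw (edgeLaw r)).prod (seqLaw unitLaw))

/-- The chameleon process fills up. -/
def Fills (a b N : ℕ) (T : ℝ) (ξ : Fin n → ℕ) (x : Fin n) (D : Drive G) : Prop :=
  ∃ J, ∀ j ≥ J, (chamRound a b N D T ξ x j).total = 2 * N

theorem measurableSet_fills {Θ : Type*} [MeasurableSpace Θ] {D : Θ → Drive G}
    (hD : MeasDrive D) : MeasurableSet {θ | Fills a b N T ξ x (D θ)} := by
  have : {θ | Fills a b N T ξ x (D θ)} =
      ⋃ J, ⋂ (j) (_ : j ≥ J), {θ | (chamRound a b N (D θ) T ξ x j).total = 2 * N} := by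
    ext θ
    simp [Fills]
  rw [this]
  exact MeasurableSet.iUnion fun J => MeasurableSet.iInter fun j => MeasurableSet.iInter fun _ =>
    hD.chamRound a b N T ξ x j (MeasurableSet.of_discrete (s := {σ : ChamState n N | σ.total = 2 * N}))

/-- If the ink is absorbed, then the probability of filling up is proportional to the initial
ink. -/
theorem mul_colourLaw_fills (ha : 0 < a) (hb : 0 < b) (hξ : ∑ v, chi a b (ξ v) = N) (γ : Frame G)
    (h : ∀ᵐ c ∂colourLaw, ∃ J,
      (∀ j ≥ J, (chamRound a b N (colourDrive γ c) T ξ x j).total = 0) ∨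
        ∀ j ≥ J, (chamRound a b N (colourDrive γ c) T ξ x j).total = 2 * N) :
    ((2 * N : ℕ) : ENNReal) * colourLaw {c | Fills a b N T ξ x (colourDrive γ c)} =
      (2 * chi a b (ξ x) : ℕ) := by
  have hD := measDrive_colourDrive γ
  have hF := measurableSet_fills hD (a := a) (b := b) (N := N) (T := T) (ξ := ξ) (x := x)
  have hm : ∀ j, Measurable fun c =>
      ((chamRound a b N (colourDrive γ c) T ξ x j).total : ENNReal) := fun j =>
    (Measurable.of_discrete (f := fun σ : ChamState n N => (σ.total : ENNReal))).comp
      (hD.chamRound a b N T ξ x j)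
  -- Optional stopping at infinity: the constant mean of the bounded martingale passes to its limit,
  -- which is `2N` on Fill and 0 elsewhere.
  have hlim := tendsto_lintegral_of_dominated_convergence (μ := colourLaw)
    (F := fun j c => ((chamRound a b N (colourDrive γ c) T ξ x j).total : ENNReal))
    (f := {c | Fills a b N T ξ x (colourDrive γ c)}.indicator fun _ => ((2 * N : ℕ) : ENNReal))
    (fun _ => ((2 * N : ℕ) : ENNReal)) hm
    (fun j => ae_of_all _ fun c => Nat.cast_le.2
      (valid_chamRound (colourDrive γ c) T x ha hb hξ j).total_le)
    (by simpa using ENNReal.mul_ne_top ENNReal.ofNat_ne_top (ENNReal.natCast_ne_top N)) ?_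
  · simp only [lintegral_total x γ ha hb hξ] at hlim
    rw [lintegral_indicator_const hF] at hlim
    exact (tendsto_nhds_unique tendsto_const_nhds hlim).symm
  · filter_upwards [h] with c ⟨J, hJ⟩
    rcases hJ with hJ | hJ
    · refine tendsto_const_nhds.congr' ?_
      filter_upwards [eventually_ge_atTop J] with j hj
      rw [hJ j hj]
      -- Both limits can occur together only if `2N = 0`, and then the values agree.
      by_cases hc : Fills a b N T ξ x (colourDrive γ c)
      · obtain ⟨J', hJ'⟩ := hc
        have h1 := hJ' (max J J') (le_max_right _ _)
        rw [hJ _ (le_max_left _ _)] at h1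
        rw [← h1]
        simp
      · simp [Set.indicator, hc]
    · refine tendsto_const_nhds.congr' ?_
      filter_upwards [eventually_ge_atTop J] with j hj
      rw [hJ j hj, Set.indicator_of_mem]
      exact ⟨J, hJ⟩

theorem ae_mul_colourLaw_fills (hG : G.Connected) (e₀ : Edge G) (ha : 0 < a) (hb : 0 < b)
    (hξ : ∑ v, chi a b (ξ v) = N) (hT : 0 < T) {r : Edge G → ℝ} [IsProbabilityMeasure (edgeLaw r)]
    [IsProbabilityMeasure (expMeasure (∑ e, r e))] (hr : ∀ e, 0 < r e) :
    ∀ᵐ γ ∂frameLaw r,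
      ((2 * N : ℕ) : ENNReal) * colourLaw {c | Fills a b N T ξ x (colourDrive γ c)} =
        (2 * chi a b (ξ x) : ℕ) := by
  have hpos : 0 < ∑ e, r e := Finset.sum_pos (fun e _ => hr e) ⟨e₀, Finset.mem_univ _⟩
  have hmeas : MeasurableSet {γ : Frame G |
      ((2 * N : ℕ) : ENNReal) * colourLaw {c | Fills a b N T ξ x (colourDrive γ c)} =
        (2 * chi a b (ξ x) : ℕ)} :=
    ((measurable_measure_prodMk_left (measurableSet_fills measDrive_frame)).const_mul _)
      (measurableSet_singleton _)
  obtain ⟨L, hL⟩ := exists_pairDist_bound G ha b N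
  refine (Measure.ae_prod_iff_ae_ae hmeas).2 ?_
  -- The gaps are fixed before anything else, so that the windows are deterministic; the runs of
  -- progress then use the randomness of edges and colours.
  filter_upwards [ae_gap hpos hT] with g hg
  refine (Measure.ae_prod_iff_ae_ae (measurable_prodMk_left hmeas)).2 ?_
  have h1 := ae_all_iff.2 fun J => ae_exists_progress_run x hG e₀ ha hb hξ hT hr
    (fun D hD => ⟨(hg D hD).1, (hg D hD).2.2⟩) L J
  filter_upwards [Measure.ae_ae_of_ae_prod h1] with e he
  filter_upwards [Measure.ae_ae_of_ae_prod he] with u hu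
  refine mul_colourLaw_fills ha hb hξ (g, e, u) ?_
  filter_upwards [hu, ae_depinked_eventually_zero (T := T) x (g, e, u) ha hb hξ] with c hc ⟨J, hJ⟩
  exact ⟨J, total_eventually_extreme ha hb hξ hT (hg (colourDrive (g, e, u) c) rfl).1 hL hJ hc⟩

end Fill

/-! ### From the product space to a graphical construction -/

section Transfer

variable {n : ℕ} {G : SimpleGraph (Fin n)} {a b N : ℕ} {T : ℝ} {ξ : Fin n → ℕ} {x : Fin n}
  {r : Edge G → ℝ} [IsProbabilityMeasure (edgeLaw r)]
  [IsProbabilityMeasure (expMeasure (∑ e, r e))] {Ω : Type*} [MeasurableSpace Ω] {μ : Measure Ω}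
  [IsProbabilityMeasure μ] {D : Ω → Drive G}

theorem IsGraphical.map_frame (hD : IsGraphical r μ D) :
    MeasurePreserving (fun ω => (frame (D ω), colour (D ω))) μ ((frameLaw r).prod colourLaw) := by
  have h1 := (MeasurePreserving.id (seqLaw (expMeasure (∑ e, r e)))).prod
    ((measurePreserving_prodAssoc (seqLaw (edgeLaw r)) (seqLaw unitLaw) colourLaw).symm
      MeasurableEquiv.prodAssoc)
  have h2 := (measurePreserving_prodAssoc (seqLaw (expMeasure (∑ e, r e)))
    ((seqLaw (edgeLaw r)).prod (seqLaw unitLaw)) colourLaw).symm MeasurableEquiv.prodAssoc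
  exact (h2.comp h1).comp hD.map_ofDrive

/-- A relation between conditional means given the frame passes to the means. -/
theorem IsGraphical.setLIntegral_eq (hD : IsGraphical r μ D) {f f' : Drive G → ENNReal}
    (hf : Measurable fun p : Frame G × Colour => f (colourDrive p.1 p.2))
    (hf' : Measurable fun p : Frame G × Colour => f' (colourDrive p.1 p.2)) {z z' : ENNReal}
    (h : ∀ᵐ γ ∂frameLaw r, z * ∫⁻ c, f (colourDrive γ c) ∂colourLaw =
      z' * ∫⁻ c, f' (colourDrive γ c) ∂colourLaw) {S : Set (Frame G)} (hS : MeasurableSet S) :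
    z * ∫⁻ ω in {ω | frame (D ω) ∈ S}, f (D ω) ∂μ =
      z' * ∫⁻ ω in {ω | frame (D ω) ∈ S}, f' (D ω) ∂μ := by
  have key : ∀ {f : Drive G → ENNReal},
      Measurable (fun p : Frame G × Colour => f (colourDrive p.1 p.2)) →
      ∫⁻ ω in {ω | frame (D ω) ∈ S}, f (D ω) ∂μ =
        ∫⁻ γ in S, ∫⁻ c, f (colourDrive γ c) ∂colourLaw ∂frameLaw r := by
    intro f hf
    have h1 := hD.map_frame.setLIntegral_comp_preimage (hS.prod MeasurableSet.univ) hf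
    rw [← Measure.prod_restrict, Measure.restrict_univ, lintegral_prod _ hf.aemeasurable] at h1
    rw [← h1]
    congr 2
    ext ω
    simp
  rw [key hf, key hf', ← lintegral_const_mul _ hf.lintegral_prod_right',
    ← lintegral_const_mul _ hf'.lintegral_prod_right']
  exact lintegral_congr_ae (ae_restrict_of_ae h)

theorem IsGraphical.ae_regular (hr : 0 < ∑ e, r e) (hD : IsGraphical r μ D) :
    ∀ᵐ ω ∂μ, Regular (D ω) ∧ ringCount (D ω) 0 = 0 := by
  have h1 := (measurePreserving_fst.comp (measurePreserving_fst.comp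
    hD.map_frame)).quasiMeasurePreserving.ae (ae_gap (G := G) hr one_pos)
  filter_upwards [h1] with ω h
  exact ⟨(h (D ω) rfl).1, (h (D ω) rfl).2.1⟩

theorem ae_frame_regular (hr : 0 < ∑ e, r e) :
    ∀ᵐ γ ∂frameLaw r, ∀ c, Regular (colourDrive γ c) ∧ ringCount (colourDrive γ c) 0 = 0 := by
  have h1 := (measurePreserving_fst (μ := seqLaw (expMeasure (∑ e, r e)))
    (ν := (seqLaw (edgeLaw r)).prod (seqLaw unitLaw))).quasiMeasurePreserving.ae
      (ae_gap (G := G) hr one_pos)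
  filter_upwards [h1] with γ h c
  exact ⟨(h (colourDrive γ c) rfl).1, (h (colourDrive γ c) rfl).2.1⟩

end Transfer

/-! ### Comparison of the two laws -/

/-- The positive and negative parts of a difference of total 0 have equal sums. The argument bounds
the excess of the mixed law, which is the opposite of the direction in the statement. -/
theorem tvDist_comm_of_sum_eq {α : Type*} {S : Finset α} {p q : α → ℝ}
    (h : ∑ ω ∈ S, p ω = ∑ ω ∈ S, q ω) : tvDist S p q = tvDist S q p := by
  have h1 : ∀ y : ℝ, max y 0 - max (-y) 0 = y := fun y => by
    rcases le_total y 0 with h | h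
    · rw [max_eq_right h, max_eq_left (neg_nonneg.2 h)]
      ring
    · rw [max_eq_left h, max_eq_right (neg_nonpos.2 h)]
      ring
  have h2 : tvDist S p q - tvDist S q p = 0 := by
    rw [tvDist, tvDist, ← Finset.sum_sub_distrib]
    refine (Finset.sum_congr rfl fun ω _ => ?_).trans
      ((Finset.sum_sub_distrib p q).trans (sub_eq_zero.2 h))
    rw [← neg_sub (p ω), h1]
  exact sub_eq_zero.1 h2

section Comparison

variable {n : ℕ} {G : SimpleGraph (Fin n)} {a b N : ℕ} {T : ℝ} {ξ : Fin n → ℕ} {x : Fin n}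

theorem ChamState.Valid.ink_le {σ : ChamState n N} (h : σ.Valid a b) (v : Fin n) :
    σ.ink v ≤ chi a b (σ.B v) := by
  have h1 : ((σ.R v + σ.P v : ℕ) : ℝ) ≤ chi a b (σ.B v) := Nat.cast_le.2 (h.le v)
  have h2 : (0 : ℝ) ≤ σ.P v := Nat.cast_nonneg _
  rw [ChamState.ink]
  push_cast at h1
  linarith

theorem ChamState.ink_nonneg (σ : ChamState n N) (v : Fin n) : 0 ≤ σ.ink v := by
  rw [ChamState.ink]
  positivity

theorem ChamState.Valid.chi_le {σ : ChamState n N} (h : σ.Valid a b) (v : Fin n) :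
    (chi a b (σ.B v) : ℝ) ≤ N := by
  refine Nat.cast_le.2 (le_of_le_of_eq ?_ h.chi_sum)
  exact Finset.single_le_sum (f := fun v => chi a b (σ.B v)) (fun _ _ => Nat.zero_le _)
    (Finset.mem_univ v)

theorem valid_chamAt (D : Drive G) (ha : 0 < a) (hb : 0 < b) (hξ : ∑ v, chi a b (ξ v) = N) (t : ℝ) :
    (chamAt a b N D T ξ x t).Valid a b :=
  valid_chamRun D ha hb (valid_chamRound D T x ha hb hξ _) _ _

theorem Regular.floor_le {D : Drive G} (hD : Regular D) (hT : 0 < T) {t : ℝ} (ht : 0 < t) :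
    ringCount D (⌊t / T⌋₊ * T) ≤ ringCount D t :=
  hD.ringCount_mono ((le_div_iff₀ hT).1 (Nat.floor_le (div_pos ht hT).le))

theorem black_chamAt (D : Drive G) (ha : 0 < a) (hb : 0 < b) (hξ : ∑ v, chi a b (ξ v) = N)
    (hT : 0 < T) (hD : Regular D) (h0 : ringCount D 0 = 0) {t : ℝ} (ht : 0 < t) :
    (chamAt a b N D T ξ x t).B = (mabbAt ((b : ℝ) / a) D ξ x t).1 :=
  black_preRing D T x ha hb hξ hT hD h0 (hD.floor_le hT ht)

theorem fillEvent_eq {Ω : Type*} (D : Ω → Drive G) (ha : 0 < a) (hb : 0 < b)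
    (hξ : ∑ v, chi a b (ξ v) = N) (hT : 0 < T) :
    fillEvent a b N D T ξ x = {ω | Fills a b N T ξ x (D ω)} := by
  ext ω
  exact tendsto_inkAt_iff (D ω) T x ha hb hξ hT

variable {r : Edge G → ℝ} {Ω : Type*} [MeasurableSpace Ω] {μ : Measure Ω} {D : Ω → Drive G}

theorem MeasDrive.mark (hD : MeasDrive D) (s t : ℝ) (v : Fin n) :
    MeasurableSet {ω | (BBSplit.mabbAt s (D ω) ξ x t).2 = v} :=
  (hD.mabbAt s ξ x t).snd (measurableSet_singleton v)

theorem MeasDrive.twoInk (hD : MeasDrive D) (t : ℝ) (v : Fin n) :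
    Measurable fun ω => ((BBSplit.chamAt a b N (D ω) T ξ x t).twoInk v : ENNReal) :=
  (Measurable.of_discrete (f := fun σ : ChamState n N => (σ.twoInk v : ENNReal))).comp
    (hD.chamAt a b N T ξ x t)

theorem IsGraphical.measurableSet_black (hD : IsGraphical r μ D) (s : ℝ) (t : ℝ) (ζ : Fin n → ℕ) :
    MeasurableSet {ω | (mabbAt s (D ω) ξ x t).1 = ζ} :=
  (hD.measDrive.mabbAt s ξ x t).fst (measurableSet_singleton ζ)

variable [IsProbabilityMeasure μ]

theorem IsGraphical.integrable_ink (hD : IsGraphical r μ D) (ha : 0 < a)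
    (hb : 0 < b) (hξ : ∑ v, chi a b (ξ v) = N) (t : ℝ) (v : Fin n) :
    Integrable (fun ω => (chamAt a b N (D ω) T ξ x t).ink v) μ := by
  refine Integrable.of_bound ((Measurable.of_discrete (f := fun σ : ChamState n N => σ.ink v)).comp
      (hD.measDrive.chamAt a b N T ξ x t)).aestronglyMeasurable N (ae_of_all _ fun ω => ?_)
  have h := valid_chamAt (T := T) (x := x) (D ω) ha hb hξ t
  rw [Real.norm_of_nonneg (ChamState.ink_nonneg _ v)]
  exact (h.ink_le v).trans (h.chi_le v)

theorem IsGraphical.integrable_chi (hD : IsGraphical r μ D) (ha : 0 < a)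
    (hb : 0 < b) (hξ : ∑ v, chi a b (ξ v) = N) (t : ℝ) (v : Fin n) :
    Integrable (fun ω => (chi a b ((chamAt a b N (D ω) T ξ x t).B v) : ℝ)) μ := by
  refine Integrable.of_bound ((Measurable.of_discrete
    (f := fun σ : ChamState n N => (chi a b (σ.B v) : ℝ))).comp
      (hD.measDrive.chamAt a b N T ξ x t)).aestronglyMeasurable N (ae_of_all _ fun ω => ?_)
  have h := valid_chamAt (T := T) (x := x) (D ω) ha hb hξ t
  rw [Real.norm_of_nonneg (Nat.cast_nonneg _)]
  exact h.chi_le v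

/-- Both laws have the same non-marked marginal, as `π_ζ` has total mass 1. -/
theorem sum_mabbLaw_eq (hD : IsGraphical r μ D) (ha : 0 < a)
    (hb : 0 < b) {m : ℕ} (hm : 1 ≤ m) (t : ℝ) :
    ∑ c ∈ configs n (m - 1) ×ˢ Finset.univ, mabbLaw ((b : ℝ) / a) μ D ξ x t c =
      ∑ c ∈ configs n (m - 1) ×ˢ Finset.univ, mixedLaw ((b : ℝ) / a) μ D m ξ x t c := by
  have hNpos : (0 : ℝ) < (a * (m - 1) + b * n : ℕ) := by
    have h1 : 0 < b * n := Nat.mul_pos hb (lt_of_le_of_lt (Nat.zero_le _) x.2)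
    exact_mod_cast (by omega : 0 < a * (m - 1) + b * n)
  rw [Finset.sum_product, Finset.sum_product]
  refine Finset.sum_congr rfl fun ζ hζ => ?_
  simp only [mixedLaw, condEquil_eq ha hb hm hζ]
  rw [← Finset.mul_sum, ← Finset.sum_div, ← Nat.cast_sum, sum_chi a b (mem_configs.1 hζ),
    div_self hNpos.ne', mul_one]
  have h1 : {ω | (mabbAt ((b : ℝ) / a) (D ω) ξ x t).1 = ζ} =
      ⋃ v ∈ (Finset.univ : Finset (Fin n)), {ω | mabbAt ((b : ℝ) / a) (D ω) ξ x t = (ζ, v)} := by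
    ext ω
    simp only [Set.mem_ofPred_eq, Finset.mem_univ, Set.iUnion_true, Set.mem_iUnion, Prod.ext_iff,
      exists_and_left, exists_eq', and_true]
  rw [h1, measureReal_biUnion_finset]
  · rfl
  · intro v _ w _ hvw
    refine Set.disjoint_left.2 fun ω h2 h3 => hvw ?_
    rw [Set.mem_ofPred_eq] at h2 h3
    rw [h2] at h3
    exact (Prod.ext_iff.1 h3).2
  · exact fun v _ => hD.measDrive.mabbAt _ ξ x t (measurableSet_singleton _)

variable [IsProbabilityMeasure (edgeLaw r)] [IsProbabilityMeasure (expMeasure (∑ e, r e))]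

/-- The configuration of the non-marked particles is determined by the frame. -/
theorem mabbAt_fst_frame (s : ℝ) (D : Drive G) (ξ : Fin n → ℕ) (x : Fin n) (t : ℝ) (c : Colour) :
    (mabbAt s D ξ x t).1 = (mabbAt s (colourDrive (frame D) c) ξ x t).1 :=
  mabbSkeleton_fst_congr ξ x s (D := D) (D' := colourDrive (frame D) c) rfl rfl _

/-- Events about the non-marked particles are events about the frame; any fixed colour can be used
to express them. -/
theorem exists_frame_set (s : ℝ) (ξ : Fin n → ℕ) (x : Fin n) (t : ℝ) (ζ : Fin n → ℕ) :
    ∃ S : Set (Frame G), MeasurableSet S ∧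
      ∀ D : Drive G, frame D ∈ S ↔ (mabbAt s D ξ x t).1 = ζ := by
  let c₀ : Colour := (fun _ => 0, fun _ => true)
  have hD : MeasDrive fun γ : Frame G => colourDrive γ c₀ :=
    measDrive_frame.comp (f := fun γ : Frame G => (γ, c₀)) (by fun_prop)
  refine ⟨{γ | (mabbAt s (colourDrive γ c₀) ξ x t).1 = ζ},
    (hD.mabbAt s ξ x t).fst (measurableSet_singleton ζ), fun D => ?_⟩
  rw [mabbAt_fst_frame s D ξ x t c₀]
  rfl

/-- Given the non-marked particles, the probability of filling up is constant. -/
theorem IsGraphical.measure_fills_inter (hD : IsGraphical r μ D) (hG : G.Connected) (ha : 0 < a)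
    (hb : 0 < b) (hξ : ∑ v, chi a b (ξ v) = N) (hT : 0 < T) (hr : ∀ e, 0 < r e)
    {S : Set (Frame G)} (hS : MeasurableSet S) :
    (N : ℝ) * μ.real ({ω | Fills a b N T ξ x (D ω)} ∩ {ω | frame (D ω) ∈ S}) =
      chi a b (ξ x) * μ.real {ω | frame (D ω) ∈ S} := by
  obtain ⟨e₀⟩ := hD.exists_edge
  have hF := measurableSet_fills (measDrive_frame (G := G)) (a := a) (b := b) (N := N) (T := T)
    (ξ := ξ) (x := x)
  have h1 := hD.setLIntegral_eq (f := {D | Fills a b N T ξ x D}.indicator 1) (f' := 1)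
    (z := (2 * N : ℕ)) (z' := (2 * chi a b (ξ x) : ℕ))
    (measurable_one.indicator hF) measurable_one ?_ hS
  · have hF' := measurableSet_fills hD.measDrive (a := a) (b := b) (N := N) (T := T) (ξ := ξ)
      (x := x)
    have h2 : ∀ ω, {D | Fills a b N T ξ x D}.indicator (1 : Drive G → ENNReal) (D ω) =
        {ω | Fills a b N T ξ x (D ω)}.indicator 1 ω := fun _ => rfl
    simp only [h2, Pi.one_apply] at h1
    rw [lintegral_indicator_one hF', Measure.restrict_apply hF', setLIntegral_one] at h1
    have h3 := congrArg ENNReal.toReal h1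
    rw [ENNReal.toReal_mul, ENNReal.toReal_mul, ENNReal.toReal_natCast,
      ENNReal.toReal_natCast] at h3
    simp only [Measure.real]
    push_cast at h3
    linarith
  · filter_upwards [ae_mul_colourLaw_fills (x := x) hG e₀ ha hb hξ hT hr] with γ hγ
    have h2 : ∀ c, {D | Fills a b N T ξ x D}.indicator (1 : Drive G → ENNReal) (colourDrive γ c) =
        {c | Fills a b N T ξ x (colourDrive γ c)}.indicator 1 c := fun _ => rfl
    simp only [h2, Pi.one_apply]
    rw [lintegral_indicator_one (measurableSet_fills (measDrive_colourDrive γ)), hγ]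
    simp

/-- The law of the marked process in terms of the ink. -/
theorem IsGraphical.setIntegral_ink (hD : IsGraphical r μ D) (ha : 0 < a)
    (hb : 0 < b) (hξ : ∑ v, chi a b (ξ v) = N) (hT : 0 < T) (hr : 0 < ∑ e, r e) {t : ℝ}
    (ht : 0 < t) (ζ : Fin n → ℕ) (v : Fin n) :
    ∫ ω in {ω | (mabbAt ((b : ℝ) / a) (D ω) ξ x t).1 = ζ}, (chamAt a b N (D ω) T ξ x t).ink v ∂μ =
      chi a b (ξ x) * mabbLaw ((b : ℝ) / a) μ D ξ x t (ζ, v) := by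
  obtain ⟨S, hS, hS'⟩ := exists_frame_set (G := G) ((b : ℝ) / a) ξ x t ζ
  have h1 := hD.setLIntegral_eq (f := fun D => ((chamAt a b N D T ξ x t).twoInk v : ENNReal))
    (f' := {D | (mabbAt ((b : ℝ) / a) D ξ x t).2 = v}.indicator 1)
    (z := 1) (z' := (2 * chi a b (ξ x) : ℕ)) (MeasDrive.twoInk measDrive_frame t v)
    (measurable_one.indicator (MeasDrive.mark measDrive_frame _ t v)) ?_ hS
  · have h2 : ∀ ω, {D | (mabbAt ((b : ℝ) / a) D ξ x t).2 = v}.indicator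
        (1 : Drive G → ENNReal) (D ω) =
        {ω | (mabbAt ((b : ℝ) / a) (D ω) ξ x t).2 = v}.indicator 1 ω := fun _ => rfl
    simp only [h2, hS', one_mul] at h1
    rw [lintegral_indicator_one (hD.measDrive.mark _ t v),
      Measure.restrict_apply (hD.measDrive.mark _ t v)] at h1
    have h3 := congrArg ENNReal.toReal h1
    rw [ENNReal.toReal_mul, ENNReal.toReal_natCast] at h3
    have h4 : ∀ ω, (chamAt a b N (D ω) T ξ x t).ink v =
        ((chamAt a b N (D ω) T ξ x t).twoInk v : ENNReal).toReal / 2 := fun ω => by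
      rw [ChamState.ink_eq, ENNReal.toReal_natCast]
    simp only [h4]
    rw [integral_div, integral_toReal (hD.measDrive.twoInk t v).aemeasurable
      (ae_of_all _ fun ω => ENNReal.natCast_lt_top _), h3, mabbLaw, Measure.real]
    have h5 : {ω | (mabbAt ((b : ℝ) / a) (D ω) ξ x t).2 = v} ∩
        {ω | (mabbAt ((b : ℝ) / a) (D ω) ξ x t).1 = ζ} =
        {ω | mabbAt ((b : ℝ) / a) (D ω) ξ x t = (ζ, v)} := by
      ext ω
      simp only [Set.mem_inter_iff, Set.mem_ofPred_eq, Prod.ext_iff]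
      tauto
    rw [h5]
    push_cast
    ring
  · filter_upwards [ae_frame_regular hr] with γ hγ
    let c₀ : Colour := (fun _ => 0, fun _ => true)
    have h2 : ∀ c, {D | (mabbAt ((b : ℝ) / a) D ξ x t).2 = v}.indicator
        (1 : Drive G → ENNReal) (colourDrive γ c) =
        {c | (mabbAt ((b : ℝ) / a) (colourDrive γ c) ξ x t).2 = v}.indicator 1 c := fun _ => rfl
    simp only [h2, one_mul]
    rw [lintegral_indicator_one ((measDrive_colourDrive γ).mark _ t v)]
    exact lintegral_twoInk c₀ x ha hb hξ hT (hγ c₀).1 (hγ c₀).2 ⌊t / T⌋₊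
      (ringCount (colourDrive γ c₀) t) ((hγ c₀).1.floor_le hT ht) v

/-- The deficit of ink at `v`. -/
def deficit (a b N : ℕ) (T : ℝ) (ξ : Fin n → ℕ) (x : Fin n) (t : ℝ) (v : Fin n) (D : Drive G) : ℝ :=
  chi a b ((chamAt a b N D T ξ x t).B v) - (chamAt a b N D T ξ x t).ink v

/-- Fill is independent of the frame, so the mixed law is an integral of `χ` over Fill, while the
law of the marked process is an integral of ink over a larger event. The positive part costs
nothing, because ink never exceeds `χ`. -/
theorem IsGraphical.mixedLaw_sub_le (hD : IsGraphical r μ D) (hG : G.Connected) (ha : 0 < a)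
    (hb : 0 < b) {m : ℕ} (hm : 1 ≤ m) (hN : N = a * (m - 1) + b * n) (hξ : ∑ v, ξ v = m - 1)
    (hT : 0 < T) (hr : ∀ e, 0 < r e)
    {t : ℝ} (ht : 0 < t) {ζ : Fin n → ℕ} (hζ : ζ ∈ configs n (m - 1)) (v : Fin n) :
    chi a b (ξ x) * max (mixedLaw ((b : ℝ) / a) μ D m ξ x t (ζ, v) -
        mabbLaw ((b : ℝ) / a) μ D ξ x t (ζ, v)) 0 ≤
      ∫ ω in {ω | Fills a b N T ξ x (D ω)} ∩ {ω | (mabbAt ((b : ℝ) / a) (D ω) ξ x t).1 = ζ},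
        deficit a b N T ξ x t v (D ω) ∂μ := by
  have hξ' : ∑ v, chi a b (ξ v) = N := hN ▸ sum_chi a b hξ
  obtain ⟨e₀⟩ := hD.exists_edge
  have hr' : 0 < ∑ e, r e := Finset.sum_pos (fun e _ => hr e) ⟨e₀, Finset.mem_univ _⟩
  have hNpos : (0 : ℝ) < N := by
    have h1 : 0 < b * n := Nat.mul_pos hb (lt_of_le_of_lt (Nat.zero_le _) x.2)
    exact_mod_cast (by omega : 0 < N)
  have hF := measurableSet_fills hD.measDrive (a := a) (b := b) (N := N) (T := T) (ξ := ξ) (x := x)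
  have hB := hD.measurableSet_black (ξ := ξ) (x := x) ((b : ℝ) / a) t ζ
  obtain ⟨S, hS, hS'⟩ := exists_frame_set (G := G) ((b : ℝ) / a) ξ x t ζ
  have hfill := hD.measure_fills_inter (x := x) hG ha hb hξ' hT hr hS
  simp only [hS'] at hfill
  have hink := hD.setIntegral_ink (x := x) ha hb hξ' hT hr' ht ζ v
  have hI := hD.integrable_ink (T := T) (x := x) ha hb hξ' t v
  have hC := hD.integrable_chi (T := T) (x := x) ha hb hξ' t v
  rw [mul_max_of_nonneg _ _ (Nat.cast_nonneg _), mul_zero]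
  refine max_le ?_ ?_
  · have h1 : ∫ ω in {ω | Fills a b N T ξ x (D ω)} ∩
          {ω | (mabbAt ((b : ℝ) / a) (D ω) ξ x t).1 = ζ},
          (chi a b ((chamAt a b N (D ω) T ξ x t).B v) : ℝ) ∂μ =
        chi a b (ξ x) * mixedLaw ((b : ℝ) / a) μ D m ξ x t (ζ, v) := by
      have h2 : ∫ ω in {ω | Fills a b N T ξ x (D ω)} ∩
          {ω | (mabbAt ((b : ℝ) / a) (D ω) ξ x t).1 = ζ},
          (chi a b ((chamAt a b N (D ω) T ξ x t).B v) : ℝ) ∂μ =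
          ∫ ω in {ω | Fills a b N T ξ x (D ω)} ∩
          {ω | (mabbAt ((b : ℝ) / a) (D ω) ξ x t).1 = ζ}, (chi a b (ζ v) : ℝ) ∂μ := by
        refine setIntegral_congr_ae (hF.inter hB) ?_
        filter_upwards [hD.ae_regular hr'] with ω hω h
        rw [black_chamAt (D ω) ha hb hξ' hT hω.1 hω.2 ht, h.2]
      rw [h2, setIntegral_const, smul_eq_mul, mixedLaw, condEquil_eq ha hb hm hζ, ← hN]
      field_simp
      linear_combination (chi a b (ζ v) : ℝ) * hfill
    -- Restricting to Fill discards a nonnegative amount of ink; this is the only inequality besides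
    -- the positive part.
    have h3 : ∫ ω in {ω | Fills a b N T ξ x (D ω)} ∩
          {ω | (mabbAt ((b : ℝ) / a) (D ω) ξ x t).1 = ζ},
          (chamAt a b N (D ω) T ξ x t).ink v ∂μ ≤
        chi a b (ξ x) * mabbLaw ((b : ℝ) / a) μ D ξ x t (ζ, v) := by
      rw [← hink]
      exact setIntegral_mono_set hI.integrableOn (ae_of_all _ fun ω => ChamState.ink_nonneg _ v)
        (Set.inter_subset_right.eventuallyLE)
    simp only [deficit]
    rw [integral_sub hC.integrableOn hI.integrableOn, h1, mul_sub]
    linarith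
  · exact integral_nonneg fun ω => sub_nonneg.2
      ((valid_chamAt (T := T) (x := x) (D ω) ha hb hξ' t).ink_le v)

theorem sum_deficit (ha : 0 < a) (hb : 0 < b) (hξ : ∑ v, chi a b (ξ v) = N) (t : ℝ) (D : Drive G) :
    ∑ v, deficit a b N T ξ x t v D = N - inkAt a b N D T ξ x t := by
  simp only [deficit, Finset.sum_sub_distrib]
  rw [← Nat.cast_sum, (valid_chamAt (T := T) (x := x) D ha hb hξ t).chi_sum]
  rfl

end Comparison

end BBSplit

/-! ### The proposition. -/

theorem propositionP {n : ℕ} (G : SimpleGraph (Fin n)) (hG : G.Connected)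
    (r : BBSplit.Edge G → ℝ) (hr : ∀ e, 0 < r e)
    (a b : ℕ) (ha : 0 < a) (hb : 0 < b) (hab : Nat.Coprime a b) (m : ℕ) (hm : 2 ≤ m)
    {Ω : Type*} [MeasurableSpace Ω] (μ : Measure Ω) [IsProbabilityMeasure μ]
    (D : Ω → BBSplit.Drive G) (hD : BBSplit.IsGraphical r μ D)
    (ξ : Fin n → ℕ) (hξ : ∑ v, ξ v = m - 1) (x : Fin n) (T : ℝ) (hT : 0 < T) :
    μ.real (BBSplit.fillEvent a b (a * (m - 1) + b * n) D T ξ x) =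
        (BBSplit.chi a b (ξ x) : ℝ) / (a * ((m : ℝ) - 1) + b * n) ∧
      ∀ t : ℝ, 0 < t →
        BBSplit.tvDist (BBSplit.configs n (m - 1) ×ˢ Finset.univ)
            (BBSplit.mabbLaw ((b : ℝ) / a) μ D ξ x t)
            (BBSplit.mixedLaw ((b : ℝ) / a) μ D m ξ x t) ≤
          1 - ∫ ω, BBSplit.inkAt a b (a * (m - 1) + b * n) (D ω) T ξ x t /
                (a * ((m : ℝ) - 1) + b * n)
              ∂(ProbabilityTheory.cond μ
                (BBSplit.fillEvent a b (a * (m - 1) + b * n) D T ξ x)) := by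
  obtain ⟨e₀⟩ := hD.exists_edge
  have hr' : 0 < ∑ e, r e := Finset.sum_pos (fun e _ => hr e) ⟨e₀, Finset.mem_univ _⟩
  have := BBSplit.isProbabilityMeasure_edgeLaw hr e₀
  have := isProbabilityMeasure_expMeasure hr'
  have hcast : (a * ((m : ℝ) - 1) + b * n) = ((a * (m - 1) + b * n : ℕ) : ℝ) := by
    push_cast [Nat.cast_sub (show 1 ≤ m by omega)]
    ring
  have hξ' := BBSplit.sum_chi a b hξ
  rw [hcast]
  have hNpos : (0 : ℝ) < (a * (m - 1) + b * n : ℕ) := by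
    have h1 : 0 < b * n := Nat.mul_pos hb (lt_of_le_of_lt (Nat.zero_le _) x.2)
    exact_mod_cast (by omega : 0 < a * (m - 1) + b * n)
  have hcpos : (0 : ℝ) < BBSplit.chi a b (ξ x) := by
    have : 0 < BBSplit.chi a b (ξ x) := by
      simp only [BBSplit.chi]
      omega
    exact_mod_cast this
  rw [BBSplit.fillEvent_eq D ha hb hξ' hT]
  have hF := BBSplit.measurableSet_fills hD.measDrive (a := a) (b := b)
    (N := a * (m - 1) + b * n) (T := T) (ξ := ξ) (x := x)
  -- The full frame space gives the unconditional probability of Fill.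
  have hfill := hD.measure_fills_inter (x := x) hG ha hb hξ' hT hr MeasurableSet.univ
  simp only [Set.mem_univ, Set.ofPred_true, Set.inter_univ, probReal_univ, mul_one] at hfill
  refine ⟨by rw [eq_div_iff hNpos.ne', mul_comm, hfill], fun t ht => ?_⟩
  have hB := fun ζ => hD.measurableSet_black (ξ := ξ) (x := x) ((b : ℝ) / a) t ζ
  have hI := fun v => hD.integrable_ink (T := T) (x := x) ha hb hξ' t v
  have hC := fun v => hD.integrable_chi (T := T) (x := x) ha hb hξ' t v
  have hDef : ∀ v, Integrable (fun ω => BBSplit.deficit a b (a * (m - 1) + b * n) T ξ x t v (D ω))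
      μ := fun v => (hC v).sub (hI v)
  have hInk : Integrable (fun ω => BBSplit.inkAt a b (a * (m - 1) + b * n) (D ω) T ξ x t) μ :=
    integrable_finsetSum Finset.univ fun v _ => hI v
  have hbound : BBSplit.chi a b (ξ x) * BBSplit.tvDist (BBSplit.configs n (m - 1) ×ˢ Finset.univ)
        (BBSplit.mabbLaw ((b : ℝ) / a) μ D ξ x t) (BBSplit.mixedLaw ((b : ℝ) / a) μ D m ξ x t) ≤
      ∫ ω in {ω | BBSplit.Fills a b (a * (m - 1) + b * n) T ξ x (D ω)},
        ((a * (m - 1) + b * n : ℕ) - BBSplit.inkAt a b (a * (m - 1) + b * n) (D ω) T ξ x t) ∂μ := by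
    -- The distance is reversed so that the bound for the excess of the mixed law applies to each
    -- term.
    rw [BBSplit.tvDist_comm_of_sum_eq (BBSplit.sum_mabbLaw_eq hD ha hb (by omega) t),
      BBSplit.tvDist, Finset.mul_sum, Finset.sum_product]
    have hunion : {ω | BBSplit.Fills a b (a * (m - 1) + b * n) T ξ x (D ω)} =
        ⋃ ζ ∈ BBSplit.configs n (m - 1),
          {ω | BBSplit.Fills a b (a * (m - 1) + b * n) T ξ x (D ω)} ∩
          {ω | (BBSplit.mabbAt ((b : ℝ) / a) (D ω) ξ x t).1 = ζ} := by
      ext ω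
      simp only [Set.mem_iUnion, Set.mem_inter_iff, Set.mem_ofPred_eq, exists_prop]
      constructor
      · intro h
        refine ⟨_, BBSplit.mem_configs.2 ?_, h, rfl⟩
        rw [BBSplit.mabbAt, BBSplit.sum_mabbSkeleton, hξ]
      · rintro ⟨_, _, h, _⟩
        exact h
    calc _ ≤ ∑ ζ ∈ BBSplit.configs n (m - 1), ∑ v,
          ∫ ω in {ω | BBSplit.Fills a b (a * (m - 1) + b * n) T ξ x (D ω)} ∩
            {ω | (BBSplit.mabbAt ((b : ℝ) / a) (D ω) ξ x t).1 = ζ},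
            BBSplit.deficit a b (a * (m - 1) + b * n) T ξ x t v (D ω) ∂μ :=
          Finset.sum_le_sum fun ζ hζ => Finset.sum_le_sum fun v _ =>
            hD.mixedLaw_sub_le hG ha hb (by omega) rfl hξ hT hr ht hζ v
      _ = ∑ ζ ∈ BBSplit.configs n (m - 1),
          ∫ ω in {ω | BBSplit.Fills a b (a * (m - 1) + b * n) T ξ x (D ω)} ∩
            {ω | (BBSplit.mabbAt ((b : ℝ) / a) (D ω) ξ x t).1 = ζ},
            ((a * (m - 1) + b * n : ℕ) -
              BBSplit.inkAt a b (a * (m - 1) + b * n) (D ω) T ξ x t) ∂μ := by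
          refine Finset.sum_congr rfl fun ζ _ => ?_
          rw [← integral_finsetSum _ fun v _ => (hDef v).integrableOn]
          simp only [BBSplit.sum_deficit ha hb hξ']
      _ = _ := by
          rw [← integral_biUnion_finset _ (fun ζ _ => hF.inter (hB ζ)), ← hunion]
          · intro ζ _ ζ' _ hne
            refine Set.disjoint_left.2 fun ω h1 h2 => hne ?_
            exact h1.2.symm.trans h2.2
          · exact fun ζ _ => ((integrable_const _).sub hInk).integrableOn
  rw [integral_sub (integrable_const _) hInk.integrableOn, setIntegral_const, smul_eq_mul,
    mul_comm (μ.real _), hfill] at hbound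
  rw [ProbabilityTheory.cond, integral_smul_measure, integral_div, smul_eq_mul,
    ENNReal.toReal_inv]
  change _ ≤ 1 - (μ.real _)⁻¹ * _
  have hp : μ.real {ω | BBSplit.Fills a b (a * (m - 1) + b * n) T ξ x (D ω)} =
      BBSplit.chi a b (ξ x) / (a * (m - 1) + b * n : ℕ) := by
    rw [eq_div_iff hNpos.ne', mul_comm, hfill]
  -- Since `χ(ξ(x)) = N P(Fill)`, multiplication by `χ(ξ(x))` turns the conditional mean given Fill
  -- into the integral over Fill.
  rw [hp, inv_div, ← mul_le_mul_iff_right₀ hcpos]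
  refine hbound.trans_eq ?_
  field_simp

end
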